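/- Let $k$ be a field and $Q$ a finite quiver with vertex set $I$ and arrow set $Q_1$ (loops and multiple arrows are allowed). For a path or arrow $p$ write $s(p)$ and $t(p)$ for its start and end, and write $pq$ for the path $q$ followed by the path $p$. Let $kQ$ be the path algebra, graded by path length, and let $e_i$ be the trivial path at $i\in I$. Let $kQ_n$ be the span of the paths of length $n$ and $kI=kQ_0$. Let $\mathsf{Gr}(A)$ denote the category of $\mathbb Z$-graded left modules over a graded algebra $A$, with degree-preserving homomorphisms. Let $\mathsf{QGr}(kQ)=\mathsf{Gr}(kQ)/\mathsf{Fdim}(kQ)$ be the quotient category, where $\mathsf{Fdim}(kQ)$ is the full subcategory of the modules that are the sum of their finite-dimensional submodules. Let $S(Q)=\varinjlim_n \operatorname{End}_{kI}(kQ_n)$ (endomorphisms of left $kI$-modules), with transition maps $\theta_n(f)(x\otimes y)=x\otimes f(y)$ for $x\in kQ_1$, $y\in kQ_n$, where $kQ_{n+1}=kQ_1\otimes_{kI}kQ_n$. Let $Q^\circ$ be the quiver without sources or sinks (possibly empty) obtained from $Q$ by repeatedly removing all sources and sinks together with the attached arrows. Let $L=L(Q^\circ)$ be its Leavitt path algebra,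 i.e. the $k$-algebra generated by $kQ^\circ$ and elements $a^*$, one for each arrow $a$ of $Q^\circ$, subject to $e_{s(a)}a^*e_{t(a)}=a^*$, $aa^*=e_{t(a)}$, $ab^*=0$ for arrows $a\neq b$, and $e_i=\sum_{s(a)=i}a^*a$ for every vertex $i$. It is $\mathbb Z$-graded by $\deg e_i=0$, $\deg a=1$, $\deg a^*=-1$, with homogeneous components $L_n$. Then there are equivalences of categories $$\mathsf{QGr}(kQ)\;\equiv\;\mathsf{Mod}\,S(Q)\;\equiv\;\mathsf{Gr}\,L\;\equiv\;\mathsf{Mod}\,L_0,$$ where $\mathsf{Mod}\,S(Q)$ is the category of right $S(Q)$-modules and $\mathsf{Mod}\,L_0$ is the category of left $L_0$-modules. Moreover $L$ is strongly graded, that is, $L_nL_{-n}=L_0$ for all $n\in\mathbb Z$, and the last equivalence is given by the functor $M\mapsto M_0$. -/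

import Mathlib

open CategoryTheory

universe u

namespace QuiverLeavitt

/-! ### Arrows and paths of a quiver -/

section Paths

/-- The arrows of a quiver, bundled with their starting vertex `src` and end vertex `tgt`. -/
@[ext]
structure Arr (V : Type u) [Quiver.{u} V] : Type u where
  src : V
  tgt : V
  hom : src ⟶ tgt

/-- A path in a quiver, bundled with the vertex `src` at which it starts and the vertex `tgt` at
which it terminates. -/
@[ext]
structure Pth (V : Type u) [Quiver.{u} V] : Type u where
  src : V
  tgt : V
  path : Quiver.Path src tgt

variable {V : Type u} [Quiver.{u} V]

/-- The length of a path. -/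
def Pth.length (p : Pth V) : ℕ := p.path.length

/-- The trivial path at a vertex. -/
def Pth.nil (v : V) : Pth V := ⟨v, v, .nil⟩

/-- The product `pq` of paths with `t(q) = s(p)`: the path `q` followed by the path `p`. -/
def Pth.comp (p q : Pth V) (h : q.tgt = p.src) : Pth V :=
  ⟨q.src, p.tgt, (q.path.cast rfl h).comp p.path⟩

@[simp] theorem Pth.comp_src (p q : Pth V) (h : q.tgt = p.src) : (p.comp q h).src = q.src := rfl
@[simp] theorem Pth.comp_tgt (p q : Pth V) (h : q.tgt = p.src) : (p.comp q h).tgt = p.tgt := rfl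

@[simp] theorem Pth.comp_length (p q : Pth V) (h : q.tgt = p.src) :
    (p.comp q h).length = p.length + q.length := by
  obtain ⟨a, b, p⟩ := p
  obtain ⟨c, d, q⟩ := q
  obtain rfl : d = a := h
  simp [Pth.length, Pth.comp, add_comm]

theorem Pth.comp_assoc (p q r : Pth V) (h : q.tgt = p.src) (h' : r.tgt = q.src) :
    (p.comp q h).comp r h' = p.comp (q.comp r h') h := by
  obtain ⟨a, b, p⟩ := p
  obtain ⟨c, d, q⟩ := q
  obtain ⟨e, f, r⟩ := r
  obtain rfl : d = a := h
  obtain rfl : f = c := h'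
  simp [Pth.comp]

theorem Pth.nil_comp (p : Pth V) : (Pth.nil p.tgt).comp p rfl = p := rfl

theorem Pth.comp_nil (p : Pth V) : p.comp (Pth.nil p.src) rfl = p := by
  simp [Pth.comp, Pth.nil]

@[simp] theorem Pth.nil_src (v : V) : (Pth.nil v).src = v := rfl
@[simp] theorem Pth.nil_tgt (v : V) : (Pth.nil v).tgt = v := rfl
@[simp] theorem Pth.nil_length (v : V) : (Pth.nil v).length = 0 := rfl

end Paths

/-! ### The path algebra and its grading -/

section PathAlgebra

/-- The path algebra `kQ`: the vector space with basis the paths of the quiver. -/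
def PathAlgebra (k : Type u) [Field k] (V : Type u) [Quiver.{u} V] : Type u := Pth V →₀ k

variable (k : Type u) [Field k] {V : Type u} [Quiver.{u} V]

noncomputable instance : AddCommGroup (PathAlgebra k V) :=
  inferInstanceAs (AddCommGroup (Pth V →₀ k))

noncomputable instance : Module k (PathAlgebra k V) :=
  inferInstanceAs (Module k (Pth V →₀ k))

/-- A path as an element of the path algebra. -/
noncomputable def ofPth (p : Pth V) : PathAlgebra k V := Finsupp.single p (1 : k)

/-- A linear map out of the path algebra, from its values on paths. -/
noncomputable def PathAlgebra.lift {W : Type u} [AddCommGroup W] [Module k W] (g : Pth V → W) :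
    PathAlgebra k V →ₗ[k] W :=
  Finsupp.linearCombination k g

variable {k} in
@[simp] theorem PathAlgebra.lift_of {W : Type u} [AddCommGroup W] [Module k W] (g : Pth V → W)
    (p : Pth V) : PathAlgebra.lift k g (ofPth k p) = g p := by
  have := Finsupp.linearCombination_single k (v := g) (1 : k) p
  rw [one_smul] at this
  exact this

variable {k} in
theorem PathAlgebra.hom_ext {W : Type u} [AddCommGroup W] [Module k W]
    {f g : PathAlgebra k V →ₗ[k] W} (h : ∀ p, f (ofPth k p) = g (ofPth k p)) : f = g :=
  Finsupp.lhom_ext' fun p => LinearMap.ext_ring (h p)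

open Classical in
/-- The product of two paths in the path algebra: `q` followed by `p`, or zero if they do not
compose. -/
noncomputable def pthMul (p q : Pth V) : PathAlgebra k V :=
  if h : q.tgt = p.src then ofPth k (p.comp q h) else 0

/-- The multiplication of the path algebra, as a bilinear map. -/
noncomputable def PathAlgebra.mulMap : PathAlgebra k V →ₗ[k] PathAlgebra k V →ₗ[k] PathAlgebra k V :=
  PathAlgebra.lift k fun p => PathAlgebra.lift k fun q => pthMul k p q

noncomputable instance : Mul (PathAlgebra k V) := ⟨fun x y => PathAlgebra.mulMap k x y⟩

noncomputable instance : One (PathAlgebra k V) := ⟨∑ᶠ v : V, ofPth k (Pth.nil v)⟩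

theorem PathAlgebra.mul_def (x y : PathAlgebra k V) : x * y = PathAlgebra.mulMap k x y := rfl

theorem ofPth_mul (p q : Pth V) : ofPth k p * ofPth k q = pthMul k p q := by
  simp [PathAlgebra.mul_def, PathAlgebra.mulMap]

theorem ofPth_mul_of_eq {p q : Pth V} (h : q.tgt = p.src) :
    ofPth k p * ofPth k q = ofPth k (p.comp q h) := by
  rw [ofPth_mul, pthMul, dif_pos h]

theorem ofPth_mul_of_ne {p q : Pth V} (h : q.tgt ≠ p.src) : ofPth k p * ofPth k q = 0 := by
  rw [ofPth_mul, pthMul, dif_neg h]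

variable {k} in
theorem PathAlgebra.induction {P : PathAlgebra k V → Prop} (h0 : P 0)
    (hadd : ∀ x y, P x → P y → P (x + y)) (hsmul : ∀ (c : k) p, P (c • ofPth k p)) (x) : P x := by
  refine Finsupp.induction_linear (motive := P) x h0 hadd fun p c => ?_
  have : (Finsupp.single p c : Pth V →₀ k) = c • Finsupp.single p 1 := by simp
  rw [this]
  exact hsmul c p

theorem PathAlgebra.mul_assoc' (x y z : PathAlgebra k V) : x * y * z = x * (y * z) := by
  have hz : ∀ x : PathAlgebra k V, x * 0 = 0 := fun x => map_zero (PathAlgebra.mulMap k x)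
  have zh : ∀ x : PathAlgebra k V, 0 * x = 0 := fun x => by simp [PathAlgebra.mul_def]
  have ha : ∀ x y z : PathAlgebra k V, x * (y + z) = x * y + x * z :=
    fun x y z => map_add (PathAlgebra.mulMap k x) y z
  have ah : ∀ x y z : PathAlgebra k V, (x + y) * z = x * z + y * z :=
    fun x y z => by simp [PathAlgebra.mul_def]
  have hs : ∀ (c : k) (x y : PathAlgebra k V), x * (c • y) = c • (x * y) :=
    fun c x y => map_smul (PathAlgebra.mulMap k x) c y
  have sh : ∀ (c : k) (x y : PathAlgebra k V), (c • x) * y = c • (x * y) :=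
    fun c x y => by simp [PathAlgebra.mul_def]
  induction x using PathAlgebra.induction with
  | h0 => simp only [zh]
  | hadd x x' h h' => simp only [ah, h, h']
  | hsmul c p =>
  induction y using PathAlgebra.induction with
  | h0 => simp only [zh, hz]
  | hadd x x' h h' => simp only [ah, ha, h, h']
  | hsmul d q =>
  induction z using PathAlgebra.induction with
  | h0 => simp only [hz]
  | hadd x x' h h' => simp only [ha, h, h']
  | hsmul e r =>
  simp only [hs, sh]
  congr 3
  by_cases h1 : q.tgt = p.src
  · by_cases h2 : r.tgt = q.src
    · rw [ofPth_mul_of_eq k h1, ofPth_mul_of_eq k h2,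
        ofPth_mul_of_eq k (show r.tgt = (p.comp q h1).src from h2),
        ofPth_mul_of_eq k (show (q.comp r h2).tgt = p.src from h1), Pth.comp_assoc]
    · rw [ofPth_mul_of_eq k h1, ofPth_mul_of_ne k h2, ofPth_mul_of_ne k (by simpa using h2), hz]
  · by_cases h2 : r.tgt = q.src
    · rw [ofPth_mul_of_ne k h1, ofPth_mul_of_eq k h2, ofPth_mul_of_ne k (by simpa using h1), zh]
    · rw [ofPth_mul_of_ne k h1, ofPth_mul_of_ne k h2, hz, zh]

theorem PathAlgebra.one_mul_of [Finite V] (p : Pth V) :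
    (1 : PathAlgebra k V) * ofPth k p = ofPth k p := by
  have := Fintype.ofFinite V
  change PathAlgebra.mulMap k (∑ᶠ v : V, ofPth k (Pth.nil v)) _ = _
  rw [finsum_eq_sum_of_fintype, map_sum, LinearMap.sum_apply,
    Finset.sum_eq_single_of_mem p.tgt (Finset.mem_univ _)]
  · rw [← PathAlgebra.mul_def, ofPth_mul_of_eq k rfl, Pth.nil_comp]
  · intro v _ hv
    rw [← PathAlgebra.mul_def, ofPth_mul_of_ne k (by simpa using hv.symm)]

theorem PathAlgebra.of_mul_one [Finite V] (p : Pth V) :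
    ofPth k p * (1 : PathAlgebra k V) = ofPth k p := by
  have := Fintype.ofFinite V
  change PathAlgebra.mulMap k _ (∑ᶠ v : V, ofPth k (Pth.nil v)) = _
  rw [finsum_eq_sum_of_fintype, map_sum,
    Finset.sum_eq_single_of_mem p.src (Finset.mem_univ _)]
  · rw [← PathAlgebra.mul_def, ofPth_mul_of_eq k rfl, Pth.comp_nil]
  · intro v _ hv
    rw [← PathAlgebra.mul_def, ofPth_mul_of_ne k (by simpa using hv)]

theorem PathAlgebra.one_mul' [Finite V] (x : PathAlgebra k V) : 1 * x = x := by
  have h : PathAlgebra.mulMap k 1 = (LinearMap.id : PathAlgebra k V →ₗ[k] PathAlgebra k V) :=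
    PathAlgebra.hom_ext fun p => PathAlgebra.one_mul_of k p
  rw [PathAlgebra.mul_def, h, LinearMap.id_apply]

theorem PathAlgebra.mul_one' [Finite V] (x : PathAlgebra k V) : x * 1 = x := by
  have h : (PathAlgebra.mulMap k).flip 1 = (LinearMap.id : PathAlgebra k V →ₗ[k] PathAlgebra k V) :=
    PathAlgebra.hom_ext fun p => PathAlgebra.of_mul_one k p
  rw [PathAlgebra.mul_def, ← LinearMap.flip_apply, h, LinearMap.id_apply]

noncomputable instance [Finite V] : Ring (PathAlgebra k V) :=
  { instAddCommGroupPathAlgebra k (V := V) with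
    left_distrib := fun x y z => map_add (PathAlgebra.mulMap k x) y z
    right_distrib := fun x y z => LinearMap.map_add₂ (PathAlgebra.mulMap k) x y z
    zero_mul := fun x => LinearMap.map_zero₂ (PathAlgebra.mulMap k) x
    mul_zero := fun x => map_zero (PathAlgebra.mulMap k x)
    mul_assoc := PathAlgebra.mul_assoc' k
    one_mul := PathAlgebra.one_mul' k
    mul_one := PathAlgebra.mul_one' k }

noncomputable instance [Finite V] : Algebra k (PathAlgebra k V) :=
  Algebra.ofModule (fun c x y => LinearMap.map_smul₂ (PathAlgebra.mulMap k) c x y)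
    (fun c x y => map_smul (PathAlgebra.mulMap k x) c y)

variable (V) in
/-- The degree `n` component of `kQ`, the span of the paths of length `n` (zero for `n < 0`). -/
noncomputable def pathGrade (n : ℤ) : Submodule k (PathAlgebra k V) :=
  Submodule.span k (ofPth k '' {p : Pth V | (p.length : ℤ) = n})

theorem ofPth_mem_pathGrade (p : Pth V) : ofPth k p ∈ pathGrade k V p.length :=
  Submodule.subset_span ⟨p, rfl, rfl⟩

instance [Finite V] : SetLike.GradedMonoid (pathGrade k V) where
  one_mem := by
    have := Fintype.ofFinite V
    change ∑ᶠ v : V, ofPth k (Pth.nil v) ∈ _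
    rw [finsum_eq_sum_of_fintype]
    exact Submodule.sum_mem _ fun v _ => ofPth_mem_pathGrade k (Pth.nil v)
  mul_mem := by
    intro i j x y hx hy
    have key : pathGrade k V i * pathGrade k V j ≤ pathGrade k V (i + j) := by
      rw [pathGrade, pathGrade, Submodule.span_mul_span, Submodule.span_le]
      rintro _ ⟨_, ⟨p, rfl, rfl⟩, _, ⟨q, rfl, rfl⟩, rfl⟩
      change ofPth k p * ofPth k q ∈ _
      by_cases h : q.tgt = p.src
      · rw [ofPth_mul_of_eq k h]
        have := ofPth_mem_pathGrade k (p.comp q h)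
        rwa [Pth.comp_length, Nat.cast_add] at this
      · rw [ofPth_mul_of_ne k h]
        exact Submodule.zero_mem _
    exact key (Submodule.mul_mem_mul hx hy)

/-- `kQ` is a graded algebra. -/
noncomputable instance [Finite V] : GradedAlgebra (pathGrade k V) where
  toDecomposition := by
    let d : PathAlgebra k V →ₗ[k] DirectSum ℤ fun i => pathGrade k V i :=
      PathAlgebra.lift k fun p =>
        DirectSum.lof k ℤ (fun i => pathGrade k V i) p.length ⟨ofPth k p, ofPth_mem_pathGrade k p⟩
    refine DirectSum.Decomposition.ofLinearMap _ d ?_ ?_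
    · refine PathAlgebra.hom_ext fun p => ?_
      simp [d]
    · refine DirectSum.linearMap_ext _ fun i => LinearMap.ext fun ⟨x, hx⟩ => ?_
      simp only [LinearMap.coe_comp, Function.comp_apply, DirectSum.coeLinearMap_lof,
        LinearMap.id_coe, id_eq]
      induction hx using Submodule.span_induction with
      | mem x hx =>
        obtain ⟨p, rfl, rfl⟩ := hx
        simp [d]
      | zero => rw [map_zero]; exact (map_zero _).symm
      | add x y hx hy h h' => rw [map_add, h, h', ← map_add]; rfl
      | smul c x hx h => rw [map_smul, h, ← map_smul]; rfl

end PathAlgebra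

/-! ### Graded modules -/

section GradedModules

variable {k A : Type u} [Field k] [Ring A] [Algebra k A] (𝒜 : ℤ → Submodule k A)

/-- A `ℤ`-graded left module over the graded algebra `A = ⨁ 𝒜 n`. -/
structure GrMod : Type (u + 1) where
  carrier : Type u
  [addCommGroup : AddCommGroup carrier]
  [module : Module A carrier]
  /-- the homogeneous components -/
  component : ℤ → AddSubgroup carrier
  internal : DirectSum.IsInternal component
  smul_mem : ∀ {i j : ℤ} {a : A} {m : carrier},
    a ∈ 𝒜 i → m ∈ component j → a • m ∈ component (i + j)

attribute [instance] GrMod.addCommGroup GrMod.module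

namespace GrMod

variable {𝒜}

/-- Degree-preserving homomorphisms of graded modules. -/
@[ext]
structure Hom (M N : GrMod 𝒜) : Type u where
  toLinearMap : M.carrier →ₗ[A] N.carrier
  map_mem : ∀ (i : ℤ) (m : M.carrier), m ∈ M.component i → toLinearMap m ∈ N.component i

/-- The category `Gr A` of graded left modules and degree-preserving homomorphisms. -/
instance : Category.{u} (GrMod 𝒜) where
  Hom := Hom
  id M := ⟨LinearMap.id, fun _ _ h => h⟩
  comp f g := ⟨g.toLinearMap ∘ₗ f.toLinearMap, fun i _ h => g.map_mem i _ (f.map_mem i _ h)⟩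

/-- The `A`-linear map underlying a morphism of graded modules. -/
abbrev lin {M N : GrMod 𝒜} (f : M ⟶ N) : M.carrier →ₗ[A] N.carrier := Hom.toLinearMap f

end GrMod

/-- The degree zero component of a graded module, as a module over the degree zero subring. -/
instance (M : GrMod 𝒜) [SetLike.GradedMonoid 𝒜] : Module (𝒜 0) (M.component 0) where
  smul a m := ⟨(a : A) • (m : M.carrier), by simpa using M.smul_mem a.2 m.2⟩
  one_smul m := Subtype.ext (one_smul A (m : M.carrier))
  mul_smul a b m := Subtype.ext (mul_smul (a : A) (b : A) (m : M.carrier))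
  smul_zero a := Subtype.ext (smul_zero (a : A))
  smul_add a m n := Subtype.ext (smul_add (a : A) (m : M.carrier) (n : M.carrier))
  add_smul a b m := Subtype.ext (add_smul (a : A) (b : A) (m : M.carrier))
  zero_smul m := Subtype.ext (zero_smul A (m : M.carrier))

/-- The functor `Gr A ⥤ Mod A₀`, `M ↦ M₀`. -/
def degreeZero [SetLike.GradedMonoid 𝒜] : GrMod 𝒜 ⥤ ModuleCat.{u} (𝒜 0) where
  obj M := ModuleCat.of (𝒜 0) (M.component 0)
  map f := ModuleCat.ofHom
    { toFun := fun m => ⟨GrMod.lin f m.1, GrMod.Hom.map_mem f 0 m.1 m.2⟩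
      map_add' := fun m n => Subtype.ext (map_add (GrMod.lin f) m.1 n.1)
      map_smul' := fun a m => Subtype.ext (map_smul (GrMod.lin f) a.1 m.1) }

end GradedModules

/-! ### The quotient category `QGr` -/

section QGr

/-- The `A`-module `M` is the sum of those of its submodules that are finite-dimensional
over `k`. -/
def IsFdim (k A : Type u) [Field k] [Ring A] [Algebra k A] (M : Type u) [AddCommGroup M]
    [Module A M] : Prop :=
  sSup {N : Submodule A M | @Module.Finite k N _ _ (Module.compHom N (algebraMap k A))} = ⊤

variable {k A : Type u} [Field k] [Ring A] [Algebra k A] (𝒜 : ℤ → Submodule k A)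

/-- The morphisms of `Gr A` whose kernel and cokernel are sums of finite-dimensional submodules. -/
def fdimIso : MorphismProperty (GrMod 𝒜) := fun _ N f =>
  IsFdim k A (LinearMap.ker (GrMod.lin f)) ∧
    IsFdim k A (N.carrier ⧸ LinearMap.range (GrMod.lin f))

/-- The quotient category `QGr A = Gr A / Fdim A`: the localization of `Gr A` at the morphisms with
kernel and cokernel in the localizing subcategory `Fdim A`. -/
abbrev QGr : Type (u + 1) := (fdimIso 𝒜).Localization

end QGr

/-! ### The ultramatricial algebra `S(Q)` -/

section UltramatricialAlgebra

/-- The paths of length `n`. -/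
abbrev PthN (V : Type u) [Quiver.{u} V] (n : ℕ) : Type u := {p : Pth V // p.length = n}

/-- The vector space `kQ_n` with basis the paths of length `n`. -/
def KQn (k : Type u) [Field k] (V : Type u) [Quiver.{u} V] (n : ℕ) : Type u := PthN V n →₀ k

variable (k : Type u) [Field k] {V : Type u} [Quiver.{u} V]

noncomputable instance (n : ℕ) : AddCommGroup (KQn k V n) :=
  inferInstanceAs (AddCommGroup (PthN V n →₀ k))

noncomputable instance (n : ℕ) : Module k (KQn k V n) :=
  inferInstanceAs (Module k (PthN V n →₀ k))

/-- The left action of `kI`, identified with the algebra of functions `I → k`, on `kQ_n`: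
`e_i p = p` if the path `p` ends at `i`, and `e_i p = 0` otherwise. -/
noncomputable instance (n : ℕ) : Module (V → k) (KQn k V n) :=
  Module.compHom (PthN V n →₀ k)
    (RingHom.pi fun p => Pi.evalRingHom (fun _ => k) p.1.tgt : (V → k) →+* (PthN V n → k))

variable {k} in
/-- A path of length `n` as an element of `kQ_n`. -/
noncomputable def KQn.of {n : ℕ} (p : PthN V n) : KQn k V n := Finsupp.single p (1 : k)

theorem KQn.smul_of {n : ℕ} (c : V → k) (p : PthN V n) :
    c • (KQn.of p : KQn k V n) = c p.1.tgt • KQn.of p := by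
  refine Finsupp.ext fun q => ?_
  change c q.1.tgt * (Finsupp.single p (1 : k)) q = c p.1.tgt * (Finsupp.single p (1 : k)) q
  by_cases h : p = q
  · subst h; rfl
  · simp [h]

instance (n : ℕ) : SMulCommClass k (V → k) (KQn k V n) where
  smul_comm a c x := by
    change PthN V n →₀ k at x
    refine Finsupp.ext fun q => ?_
    change a * (c q.1.tgt * x q) = c q.1.tgt * (a * x q)
    ring

instance (n : ℕ) : IsScalarTower k (V → k) (KQn k V n) where
  smul_assoc a c x := by
    change PthN V n →₀ k at x
    refine Finsupp.ext fun q => ?_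
    change a * c q.1.tgt * x q = a * (c q.1.tgt * x q)
    ring

variable (V) in
/-- The ring `S_n = End_{kI}(kQ_n)`. -/
abbrev Sn (n : ℕ) : Type u := Module.End (V → k) (KQn k V n)

/-- The last arrow of a path of positive length. -/
def lastArrow {n : ℕ} : PthN V (n + 1) → Arr V
  | ⟨⟨_, _, .nil⟩, h⟩ => absurd h (Nat.succ_ne_zero n).symm
  | ⟨⟨_, _, .cons _ a⟩, _⟩ => ⟨_, _, a⟩

/-- A path of positive length without its last arrow. -/
def initPath {n : ℕ} : PthN V (n + 1) → PthN V n
  | ⟨⟨_, _, .nil⟩, h⟩ => absurd h (Nat.succ_ne_zero n).symm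
  | ⟨⟨_, _, .cons p _⟩, h⟩ => ⟨⟨_, _, p⟩, Nat.succ.inj h⟩

/-- The path `ap` for an arrow `a` and a path `p` of length `n` that ends where `a` starts. -/
def consPath {n : ℕ} (a : Arr V) (p : PthN V n) (h : p.1.tgt = a.src) : PthN V (n + 1) :=
  ⟨⟨p.1.src, a.tgt, (p.1.path.cast rfl h).cons a.hom⟩, by
    obtain ⟨⟨c, d, p⟩, hp⟩ := p
    obtain ⟨e, f, a⟩ := a
    obtain rfl : d = e := h
    exact congrArg Nat.succ hp⟩

theorem initPath_tgt {n : ℕ} (p : PthN V (n + 1)) : (initPath p).1.tgt = (lastArrow p).src :=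
  match p with
  | ⟨⟨_, _, .nil⟩, h⟩ => absurd h (Nat.succ_ne_zero n).symm
  | ⟨⟨_, _, .cons _ _⟩, _⟩ => rfl

theorem consPath_init {n : ℕ} (p : PthN V (n + 1)) :
    consPath (lastArrow p) (initPath p) (initPath_tgt p) = p :=
  match p with
  | ⟨⟨_, _, .nil⟩, h⟩ => absurd h (Nat.succ_ne_zero n).symm
  | ⟨⟨_, _, .cons _ _⟩, _⟩ => rfl

theorem init_consPath {n : ℕ} (a : Arr V) (p : PthN V n) (h : p.1.tgt = a.src) :
    initPath (consPath a p h) = p := by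
  obtain ⟨⟨c, d, p⟩, hp⟩ := p
  obtain ⟨e, f, a⟩ := a
  obtain rfl : d = e := h
  rfl

theorem last_consPath {n : ℕ} (a : Arr V) (p : PthN V n) (h : p.1.tgt = a.src) :
    lastArrow (consPath a p h) = a := by
  obtain ⟨⟨c, d, p⟩, hp⟩ := p
  obtain ⟨e, f, a⟩ := a
  obtain rfl : d = e := h
  rfl

theorem KQn.hom_ext {n : ℕ} {W : Type u} [AddCommGroup W] [Module k W] {f g : KQn k V n →ₗ[k] W}
    (h : ∀ p, f (KQn.of p) = g (KQn.of p)) : f = g :=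
  Finsupp.lhom_ext' fun p => LinearMap.ext_ring (h p)

variable {k} in
/-- A linear map out of `kQ_n`, from its values on paths. -/
noncomputable def KQn.lift {n : ℕ} {W : Type u} [AddCommGroup W] [Module k W] (g : PthN V n → W) :
    KQn k V n →ₗ[k] W :=
  Finsupp.linearCombination k g

@[simp] theorem KQn.lift_of {n : ℕ} {W : Type u} [AddCommGroup W] [Module k W] (g : PthN V n → W)
    (p : PthN V n) : KQn.lift (k := k) g (KQn.of p) = g p := by
  have := Finsupp.linearCombination_single k (v := g) (1 : k) p
  rw [one_smul] at this
  exact this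

open Classical in
/-- Left multiplication `x ↦ ax = a ⊗ x` by an arrow `a`, as a map `kQ_n → kQ_{n+1}`. -/
noncomputable def arrowMul (n : ℕ) (a : Arr V) : KQn k V n →ₗ[k] KQn k V (n + 1) :=
  KQn.lift fun p => if h : p.1.tgt = a.src then KQn.of (consPath a p h) else 0

/-- The `k`-linear map `kQ_{n+1} → kQ_{n+1}` with `a ⊗ p ↦ a ⊗ f(p)`, for every arrow `a` and path
`p` of length `n` such that `ap` is a path. -/
noncomputable def thetaLin (n : ℕ) (f : Sn k V n) : KQn k V (n + 1) →ₗ[k] KQn k V (n + 1) :=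
  KQn.lift fun p => arrowMul k n (lastArrow p) (f (KQn.of (initPath p)))

open Classical in
theorem arrowMul_smul (n : ℕ) (a : Arr V) (c : V → k) (x : KQn k V n) :
    arrowMul k n a (c • x) = c a.src • arrowMul k n a x := by
  have : (arrowMul k n a).comp (Algebra.lsmul k k (KQn k V n) c) =
      c a.src • arrowMul k n a := by
    refine KQn.hom_ext k fun p => ?_
    simp only [LinearMap.coe_comp, Function.comp_apply, Algebra.lsmul_coe, KQn.smul_of, map_smul,
      LinearMap.smul_apply, arrowMul, KQn.lift_of]
    by_cases h : p.1.tgt = a.src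
    · rw [dif_pos h, h]
    · rw [dif_neg h, smul_zero, smul_zero]
  exact LinearMap.congr_fun this x

theorem smul_arrowMul (n : ℕ) (a : Arr V) (c : V → k) (x : KQn k V n) :
    c • arrowMul k n a x = c a.tgt • arrowMul k n a x := by
  have : (Algebra.lsmul k k (KQn k V (n + 1)) c).comp (arrowMul k n a) =
      c a.tgt • arrowMul k n a := by
    refine KQn.hom_ext k fun p => ?_
    simp only [LinearMap.coe_comp, Function.comp_apply, Algebra.lsmul_coe,
      LinearMap.smul_apply, arrowMul, KQn.lift_of]
    split_ifs with h
    · rw [KQn.smul_of]; rfl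
    · rw [smul_zero, smul_zero]
  exact LinearMap.congr_fun this x

/-- The defining property of the transition map: `θ(f)(a ⊗ x) = a ⊗ f(x)`. -/
theorem thetaLin_arrowMul (n : ℕ) (f : Sn k V n) (a : Arr V) (x : KQn k V n) :
    thetaLin k n f (arrowMul k n a x) = arrowMul k n a (f x) := by
  classical
  have : (thetaLin k n f).comp (arrowMul k n a) =
      (arrowMul k n a).comp (f.restrictScalars k) := by
    refine KQn.hom_ext k fun p => ?_
    by_cases h : p.1.tgt = a.src
    · have : arrowMul k n a (KQn.of p) = KQn.of (consPath a p h) := by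
        rw [arrowMul, KQn.lift_of, dif_pos h]
      rw [LinearMap.comp_apply, this, thetaLin, KQn.lift_of, init_consPath, last_consPath]
      rfl
    · have h0 : arrowMul k n a (KQn.of p) = 0 := by rw [arrowMul, KQn.lift_of, dif_neg h]
      rw [LinearMap.comp_apply, h0, map_zero]
      have h1 : (KQn.of p : KQn k V n) = (Pi.single p.1.tgt 1 : V → k) • KQn.of p := by
        rw [KQn.smul_of, Pi.single_eq_same, one_smul]
      rw [LinearMap.comp_apply, LinearMap.restrictScalars_apply, h1, map_smul, arrowMul_smul,
        Pi.single_eq_of_ne (Ne.symm h), zero_smul]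
  exact LinearMap.congr_fun this x

theorem KQn.of_succ {n : ℕ} (p : PthN V (n + 1)) :
    (KQn.of p : KQn k V (n + 1)) = arrowMul k n (lastArrow p) (KQn.of (initPath p)) := by
  rw [arrowMul, KQn.lift_of, dif_pos (initPath_tgt p), consPath_init]

/-- The homomorphism `θ_n = kQ_1 ⊗_{kI} - : S_n → S_{n+1}`. -/
noncomputable def theta (n : ℕ) : Sn k V n →+* Sn k V (n + 1) where
  toFun f :=
    { toFun := thetaLin k n f
      map_add' := map_add _
      map_smul' := fun c x => by
        have : (thetaLin k n f).comp (Algebra.lsmul k k (KQn k V (n + 1)) c) =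
            (Algebra.lsmul k k (KQn k V (n + 1)) c).comp (thetaLin k n f) := by
          refine KQn.hom_ext k fun p => ?_
          simp only [LinearMap.coe_comp, Function.comp_apply, Algebra.lsmul_coe]
          rw [KQn.of_succ, smul_arrowMul, map_smul, thetaLin_arrowMul, smul_arrowMul]
        exact LinearMap.congr_fun this x }
  map_one' := LinearMap.ext fun x => LinearMap.congr_fun
    (KQn.hom_ext k (f := thetaLin k n 1) (g := LinearMap.id) fun p => by
      rw [KQn.of_succ, thetaLin_arrowMul]; rfl) x
  map_mul' f g := LinearMap.ext fun x => LinearMap.congr_fun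
    (KQn.hom_ext k (f := thetaLin k n (f * g)) (g := thetaLin k n f ∘ₗ thetaLin k n g) fun p => by
      rw [KQn.of_succ, LinearMap.comp_apply]; simp only [thetaLin_arrowMul]; rfl) x
  map_zero' := LinearMap.ext fun x => LinearMap.congr_fun
    (KQn.hom_ext k (f := thetaLin k n 0) (g := 0) fun p => by
      rw [KQn.of_succ, thetaLin_arrowMul]; simp) x
  map_add' f g := LinearMap.ext fun x => LinearMap.congr_fun
    (KQn.hom_ext k (f := thetaLin k n (f + g)) (g := thetaLin k n f + thetaLin k n g) fun p => by
      rw [KQn.of_succ, LinearMap.add_apply]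
      simp only [thetaLin_arrowMul, LinearMap.add_apply, map_add]) x

variable (V) in
/-- The transition maps `S_m → S_n`, `m ≤ n`, of the directed system: composites of the `θ`s. -/
noncomputable def transition (m n : ℕ) (h : m ≤ n) : Sn k V m →+* Sn k V n :=
  Nat.leRec (motive := fun n _ => Sn k V m →+* Sn k V n) (RingHom.id _)
    (fun n _ g => (theta k n).comp g) h

instance : DirectedSystem (Sn k V) (fun m n h => transition k V m n h) where
  map_self m x := by simp [transition, Nat.leRec_self]
  map_map l m n hij hjk x := by
    induction hjk with
    | refl => simp [transition, Nat.leRec_self]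
    | step h ih =>
      have e1 := Nat.leRec_succ (motive := fun l _ => Sn k V m →+* Sn k V l) (RingHom.id _)
        (fun n _ g => (theta k n).comp g) h (h2 := Nat.le_succ_of_le h)
      have e2 := Nat.leRec_succ (motive := fun l _ => Sn k V n →+* Sn k V l) (RingHom.id _)
        (fun n _ g => (theta k n).comp g) (hij.trans h)
        (h2 := Nat.le_succ_of_le (hij.trans h))
      simp only [transition] at ih ⊢
      erw [e1, e2]
      simp only [RingHom.comp_apply, ih]

variable (V) in
/-- The algebra `S(Q) = lim S_n`, the direct limit of `S_0 → S_1 → ⋯` along the maps `θ_n`. -/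
abbrev SAlg : Type u := DirectLimit (Sn k V) (transition k V)

end UltramatricialAlgebra

/-! ### The Leavitt path algebra -/

section Leavitt

/-- The generators of the Leavitt path algebra: `e_i`, `a` and `a^*`. -/
inductive LeavittGen (V : Type u) [Quiver.{u} V] : Type u
  | vertex (i : V)
  | arrow (a : Arr V)
  | ghost (a : Arr V)

variable (k : Type u) [Field k] {V : Type u} [Quiver.{u} V]

/-- The generator `e_i` of the free algebra. -/
abbrev fe (i : V) : FreeAlgebra k (LeavittGen V) := FreeAlgebra.ι k (LeavittGen.vertex i)

/-- The generator `a` of the free algebra. -/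
abbrev fa (a : Arr V) : FreeAlgebra k (LeavittGen V) := FreeAlgebra.ι k (LeavittGen.arrow a)

/-- The generator `a^*` of the free algebra. -/
abbrev fs (a : Arr V) : FreeAlgebra k (LeavittGen V) := FreeAlgebra.ι k (LeavittGen.ghost a)

variable (V) in
/-- The defining relations of the Leavitt path algebra: those of the path algebra (with `ba` meaning
`a` followed by `b`), `e_{s(a)} a^* e_{t(a)} = a^*`, and the Cuntz–Krieger relations
`a a^* = e_{t(a)}`, `a b^* = 0` for `a ≠ b`, and `e_i = ∑_{s(a) = i} a^* a` if `i` is not a sink. -/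
inductive LeavittRel : FreeAlgebra k (LeavittGen V) → FreeAlgebra k (LeavittGen V) → Prop
  | vertex_mul_self (i : V) : LeavittRel (fe k i * fe k i) (fe k i)
  | vertex_mul (i j : V) (h : i ≠ j) : LeavittRel (fe k i * fe k j) 0
  | vertex_sum : LeavittRel (∑ᶠ i : V, fe k i) 1
  | arrow (a : Arr V) : LeavittRel (fe k a.tgt * fa k a * fe k a.src) (fa k a)
  | ghost (a : Arr V) : LeavittRel (fe k a.src * fs k a * fe k a.tgt) (fs k a)
  | arrow_mul_ghost_self (a : Arr V) : LeavittRel (fa k a * fs k a) (fe k a.tgt)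
  | arrow_mul_ghost (a b : Arr V) (h : a ≠ b) : LeavittRel (fa k a * fs k b) 0
  | sum_ghost_mul_arrow (i : V) (h : ∃ a : Arr V, a.src = i) :
      LeavittRel (∑ᶠ a : {a : Arr V // a.src = i}, fs k a.1 * fa k a.1) (fe k i)

variable (V) in
/-- The Leavitt path algebra `L(Q)`. -/
abbrev LeavittAlg : Type u := RingQuot (LeavittRel k V)

/-- The degrees of the generators: `deg e_i = 0`, `deg a = 1`, `deg a^* = -1`. -/
def LeavittGen.deg : LeavittGen V → ℤ
  | vertex _ => 0
  | arrow _ => 1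
  | ghost _ => -1

/-- The image in `L(Q)` of a word in the generators. -/
noncomputable def leavittWord (w : List (LeavittGen V)) : LeavittAlg k V :=
  RingQuot.mkAlgHom k (LeavittRel k V) (w.map (FreeAlgebra.ι k)).prod

variable (V) in
/-- The degree `n` component of `L(Q)`: the span of the words of degree `n`. -/
noncomputable def leavittGrade (n : ℤ) : Submodule k (LeavittAlg k V) :=
  Submodule.span k (leavittWord k '' {w : List (LeavittGen V) | (w.map LeavittGen.deg).sum = n})

theorem leavittWord_mem (w : List (LeavittGen V)) :
    leavittWord k w ∈ leavittGrade k V (w.map LeavittGen.deg).sum :=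
  Submodule.subset_span ⟨w, rfl, rfl⟩

theorem leavittWord_append (w w' : List (LeavittGen V)) :
    leavittWord k (w ++ w') = leavittWord k w * leavittWord k w' := by
  simp [leavittWord]

instance : SetLike.GradedMonoid (leavittGrade k V) where
  one_mem := by
    have := leavittWord_mem k ([] : List (LeavittGen V))
    simpa [leavittWord] using this
  mul_mem := by
    intro i j x y hx hy
    have key : leavittGrade k V i * leavittGrade k V j ≤ leavittGrade k V (i + j) := by
      rw [leavittGrade, leavittGrade, Submodule.span_mul_span, Submodule.span_le]
      rintro _ ⟨_, ⟨w, rfl, rfl⟩, _, ⟨w', rfl, rfl⟩, rfl⟩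
      change leavittWord k w * leavittWord k w' ∈ _
      have := leavittWord_mem k (w ++ w')
      rwa [leavittWord_append, List.map_append, List.sum_append] at this
    exact key (Submodule.mul_mem_mul hx hy)

theorem leavittGen_mem (x : LeavittGen V) : leavittWord k [x] ∈ leavittGrade k V x.deg := by
  simpa using leavittWord_mem k [x]

/-- The homogeneous element of the external direct sum that is given by a generator. -/
noncomputable def leavittHom (x : LeavittGen V) : DirectSum ℤ fun i => leavittGrade k V i :=
  DirectSum.of (fun i => leavittGrade k V i) x.deg ⟨leavittWord k [x], leavittGen_mem k x⟩

/-- The algebra map from the free algebra to the external direct sum. -/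
noncomputable def leavittFree :
    FreeAlgebra k (LeavittGen V) →ₐ[k] DirectSum ℤ fun i => leavittGrade k V i :=
  FreeAlgebra.lift k (leavittHom k)

/-- Elements of the free algebra that are homogeneous of degree `n` in the external direct sum. -/
def HomDeg (n : ℤ) (x : FreeAlgebra k (LeavittGen V)) : Prop :=
  ∃ h : RingQuot.mkAlgHom k (LeavittRel k V) x ∈ leavittGrade k V n,
    leavittFree k x = DirectSum.of (fun i => leavittGrade k V i) n ⟨_, h⟩

theorem HomDeg.gen (x : LeavittGen V) : HomDeg k x.deg (FreeAlgebra.ι k x) := by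
  have h := leavittGen_mem k x
  have e : leavittWord k [x] = RingQuot.mkAlgHom k (LeavittRel k V) (FreeAlgebra.ι k x) := by
    simp [leavittWord]
  refine ⟨e ▸ h, ?_⟩
  rw [leavittFree, FreeAlgebra.lift_ι_apply, leavittHom]
  congr 1
  exact Subtype.ext e

theorem HomDeg.mul {m n : ℤ} {x y : FreeAlgebra k (LeavittGen V)} (hx : HomDeg k m x)
    (hy : HomDeg k n y) : HomDeg k (m + n) (x * y) := by
  obtain ⟨h, e⟩ := hx
  obtain ⟨h', e'⟩ := hy
  refine ⟨by rw [map_mul]; exact SetLike.GradedMul.mul_mem h h', ?_⟩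
  rw [map_mul, e, e', DirectSum.of_mul_of]
  congr 1
  exact Subtype.ext (map_mul _ _ _).symm

theorem HomDeg.zero (n : ℤ) : HomDeg k n (0 : FreeAlgebra k (LeavittGen V)) := by
  refine ⟨by rw [map_zero]; exact Submodule.zero_mem _, ?_⟩
  rw [map_zero, ← map_zero (DirectSum.of (fun i => leavittGrade k V i) n)]
  congr 1
  exact Subtype.ext (map_zero _).symm

theorem HomDeg.one : HomDeg k 0 (1 : FreeAlgebra k (LeavittGen V)) := by
  refine ⟨by rw [map_one]; exact SetLike.GradedOne.one_mem, ?_⟩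
  rw [map_one, DirectSum.one_def]
  congr 1
  exact Subtype.ext (map_one _).symm

theorem HomDeg.add {n : ℤ} {x y : FreeAlgebra k (LeavittGen V)} (hx : HomDeg k n x)
    (hy : HomDeg k n y) : HomDeg k n (x + y) := by
  obtain ⟨h, e⟩ := hx
  obtain ⟨h', e'⟩ := hy
  refine ⟨by rw [map_add]; exact Submodule.add_mem _ h h', ?_⟩
  rw [map_add, e, e', ← map_add]
  congr 1
  exact Subtype.ext (map_add _ _ _).symm

theorem HomDeg.finsum {n : ℤ} {ι : Type u} {x : ι → FreeAlgebra k (LeavittGen V)}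
    (hx : ∀ i, HomDeg k n (x i)) : HomDeg k n (∑ᶠ i, x i) :=
  finsum_induction (HomDeg k n) (HomDeg.zero k n) (fun _ _ h h' => HomDeg.add k h h') hx

theorem HomDeg.eq {n : ℤ} {x y : FreeAlgebra k (LeavittGen V)} (hx : HomDeg k n x)
    (hy : HomDeg k n y) (h : LeavittRel k V x y) : leavittFree k x = leavittFree k y := by
  obtain ⟨_, e⟩ := hx
  obtain ⟨_, e'⟩ := hy
  rw [e, e']
  congr 1
  exact Subtype.ext (RingQuot.mkAlgHom_rel k h)

theorem leavittFree_rel {x y : FreeAlgebra k (LeavittGen V)} (h : LeavittRel k V x y) :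
    leavittFree k x = leavittFree k y := by
  have hv : ∀ i : V, HomDeg k 0 (fe k i) := fun i => HomDeg.gen k (.vertex i)
  have ha : ∀ a : Arr V, HomDeg k 1 (fa k a) := fun a => HomDeg.gen k (.arrow a)
  have hs : ∀ a : Arr V, HomDeg k (-1) (fs k a) := fun a => HomDeg.gen k (.ghost a)
  cases h with
  | vertex_mul_self i => exact HomDeg.eq k ((hv i).mul k (hv i)) (hv i) (.vertex_mul_self i)
  | vertex_mul i j h =>
    exact HomDeg.eq k ((hv i).mul k (hv j)) (HomDeg.zero k _) (.vertex_mul i j h)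
  | vertex_sum => exact HomDeg.eq k (HomDeg.finsum k hv) (HomDeg.one k) .vertex_sum
  | arrow a => exact HomDeg.eq k (((hv _).mul k (ha a)).mul k (hv _)) (ha a) (.arrow a)
  | ghost a => exact HomDeg.eq k (((hv _).mul k (hs a)).mul k (hv _)) (hs a) (.ghost a)
  | arrow_mul_ghost_self a =>
    exact HomDeg.eq k ((ha a).mul k (hs a)) (hv _) (.arrow_mul_ghost_self a)
  | arrow_mul_ghost a b h =>
    exact HomDeg.eq k ((ha a).mul k (hs b)) (HomDeg.zero k _) (.arrow_mul_ghost a b h)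
  | sum_ghost_mul_arrow i h =>
    have hsa : ∀ a : {a : Arr V // a.src = i}, HomDeg k 0 (fs k a.1 * fa k a.1) := fun a => by
      have := (hs a.1).mul k (ha a.1)
      rwa [neg_add_cancel] at this
    exact HomDeg.eq k (HomDeg.finsum k hsa) (hv i) (.sum_ghost_mul_arrow i h)

/-- The algebra map from `L(Q)` to the external direct sum of its homogeneous components. -/
noncomputable def leavittDecompose :
    LeavittAlg k V →ₐ[k] DirectSum ℤ fun i => leavittGrade k V i :=
  RingQuot.liftAlgHom k ⟨leavittFree k, fun _ _ h => leavittFree_rel k h⟩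

theorem leavittDecompose_mk (x : FreeAlgebra k (LeavittGen V)) :
    leavittDecompose k (RingQuot.mkAlgHom k (LeavittRel k V) x) = leavittFree k x :=
  RingQuot.liftAlgHom_mkAlgHom_apply k _ _ _

theorem leavittDecompose_word (w : List (LeavittGen V)) :
    leavittDecompose k (leavittWord k w) = DirectSum.of (fun i => leavittGrade k V i)
      (w.map LeavittGen.deg).sum ⟨leavittWord k w, leavittWord_mem k w⟩ := by
  have key : HomDeg k (w.map LeavittGen.deg).sum (w.map (FreeAlgebra.ι k)).prod := by
    induction w with
    | nil => exact HomDeg.one k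
    | cons x w ih =>
      simp only [List.map_cons, List.sum_cons, List.prod_cons]
      exact (HomDeg.gen k x).mul k ih
  obtain ⟨_, e⟩ := key
  exact (leavittDecompose_mk k _).trans e

theorem leavittDecompose_coe (i : ℤ) (x : leavittGrade k V i) :
    leavittDecompose k (x : LeavittAlg k V) = DirectSum.lof k ℤ (fun i => leavittGrade k V i) i x := by
  obtain ⟨x, hx⟩ := x
  induction hx using Submodule.span_induction with
  | mem x hx =>
    obtain ⟨w, rfl, rfl⟩ := hx
    exact leavittDecompose_word k w
  | zero => rw [map_zero]; exact (map_zero _).symm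
  | add x y hx hy h h' => rw [map_add, h, h', ← map_add]; rfl
  | smul c x hx h => rw [map_smul, h, ← map_smul]; rfl

theorem coe_leavittDecompose :
    (DirectSum.coeAlgHom (leavittGrade k V)).comp (leavittDecompose k) =
      AlgHom.id k (LeavittAlg k V) := by
  refine RingQuot.ringQuot_ext' k _ _ (FreeAlgebra.hom_ext (funext fun x => ?_))
  have h : leavittFree k (FreeAlgebra.ι k x) = leavittHom k x := FreeAlgebra.lift_ι_apply _ _
  simp only [Function.comp_apply, AlgHom.comp_apply, AlgHom.id_apply, leavittDecompose_mk, h]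
  rw [leavittHom, DirectSum.coeAlgHom_of]
  simp [leavittWord]

/-- `L(Q)` is a `ℤ`-graded algebra. -/
noncomputable instance : GradedAlgebra (leavittGrade k V) :=
  GradedAlgebra.ofAlgHom (leavittGrade k V) (leavittDecompose k) (coe_leavittDecompose k)
    (leavittDecompose_coe k)

end Leavitt

/-! ### Removing sources and sinks -/

section Core

variable (V : Type u) [Quiver.{u} V]

/-- The vertices that remain after `n` rounds of removing all sources and all sinks, together with
the attached arrows. In round `n + 1` a vertex stays if, among the arrows between the remaining
vertices, some arrow begins at it (it is not a sink) and some arrow ends at it (it is not a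
source). -/
def coreStage : ℕ → Set V
  | 0 => Set.univ
  | n + 1 => {v | v ∈ coreStage n ∧ (∃ a : Arr V, a.src = v ∧ a.tgt ∈ coreStage n) ∧
      ∃ a : Arr V, a.tgt = v ∧ a.src ∈ coreStage n}

/-- The vertices of `Q°`: those that are never removed. -/
def CoreVertex : Type u := {v : V // ∀ n, v ∈ coreStage V n}

/-- `Q°` has all the arrows of `Q` between its vertices. -/
instance : Quiver.{u} (CoreVertex V) where
  Hom i j := i.1 ⟶ j.1

end Core

end QuiverLeavitt

set_option autoImplicit false

/-! Unrolling the length grading turns a graded `kQ`-module into a representation of the covering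
quiver `Cov V`, whose vertices are pairs (vertex, degree) and whose arrows raise the degree by one.
A graded module over the Leavitt path algebra of a quiver without sinks is such a representation
with one extra property. The relations `aa^* = e`, `ab^* = 0` and `e = ∑ a^*a` say that the star
map, from the value at `x` to the product of the values at the ends of the arrows out of `x`, is
bijective; the ghost arrows are the components of its inverse. Representations with this property
are called saturated, so `Gr L` is the category of saturated representations of the cover of the
core (`isEquivalence_leavittRep`).

Over a finite quiver a graded module lies in `Fdim` exactly when each homogeneous element is killed
by all long enough paths (`isFdim_iff_pathTorsion`). The morphisms inverted in `QGr` are therefore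
the eventual isomorphisms. Saturated representations are local for them (`exists_extension`,
`extension_unique`): by iterated star maps, an element of a saturated representation amounts to an
arbitrary prescription of its images along the paths of a fixed length. Every `X` has an eventual
isomorphism to a saturated representation, made of germs at infinity of families indexed by paths
(`saturated_saturation`). So saturated representations are reflective, and the reflection inverts
precisely the eventual isomorphisms. Passing to the core loses nothing, because a long path can
leave the core only near its two ends (`eventualIso_restrictCore_iff`), and because the core is
convex, restriction to it has a fully faithful right adjoint. Restriction followed by reflection is
thus a localization of `Gr kQ` at the right morphisms, which gives `QGr kQ ≌ Gr L`.

The algebra `L` is strongly graded: the core has no sources, so each vertex `j` is the end of a path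
`p` of any length and `e_j = pp^*`; it has no sinks, so `1 = ∑ p^*p` over the paths of any fixed
length. Dade's argument then shows that `M ↦ M₀` is an equivalence.

Finally `L₀` is a full corner of the opposite of `S(Q)`. Let `e` be the projection onto the paths
that start in the core. The matrix unit that takes `q` to `p`, for paths of the core, is sent to
`q^*p`; this identifies `eS(Q)e` with the opposite of `L₀`. It is onto because these elements span
`L₀` (`mem_span_coval_mul_val_zero`), and it is injective because vertex idempotents of `L` are not
zero (`leavittFamily_e_ne_zero`) and because matrix entries at dead ends vanish in the limit
(`toSAlg_eq_zero`). The ideal generated by `e` contains `1` (`toSAlg_one_mem`), so Morita theory for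
a full corner compares right `S(Q)`-modules with left `L₀`-modules. -/

namespace QuiverLeavitt

/-! ### Representations of a quiver and eventual isomorphisms -/

section Representations

variable (k : Type u) [Field k] (U : Type u) [Quiver.{u} U]

/-- Representations of a quiver over `k`. -/
abbrev Rep : Type (u + 1) := Paths U ⥤ ModuleCat.{u} k

variable {k U}

/-- The action of a path on a representation. -/
def act (X : Rep k U) {x y : U} (p : Quiver.Path x y) : X.obj x →ₗ[k] X.obj y :=
  ModuleCat.Hom.hom (X.map (X := (x : Paths U)) (Y := (y : Paths U)) p)

/-- The component of a morphism of representations at a vertex. -/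
def appl {X Y : Rep k U} (f : X ⟶ Y) (x : U) : X.obj x →ₗ[k] Y.obj x :=
  ModuleCat.Hom.hom (f.app x)

variable {X Y Z : Rep k U}

theorem act_nil {x : U} (v : X.obj x) : act X Quiver.Path.nil v = v := by
  have := X.map_id (x : Paths U)
  exact congrArg (fun f => ModuleCat.Hom.hom f v) this

theorem act_comp {x y z : U} (p : Quiver.Path x y) (q : Quiver.Path y z) (v : X.obj x) :
    act X (p.comp q) v = act X q (act X p v) := by
  have := X.map_comp (X := (x : Paths U)) (Y := (y : Paths U)) (Z := (z : Paths U)) p q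
  exact congrArg (fun f => ModuleCat.Hom.hom f v) this

theorem act_cons {x y z : U} (p : Quiver.Path x y) (a : y ⟶ z) (v : X.obj x) :
    act X (p.cons a) v = act X a.toPath (act X p v) := act_comp p a.toPath v

theorem appl_act (f : X ⟶ Y) {x y : U} (p : Quiver.Path x y) (v : X.obj x) :
    appl f y (act X p v) = act Y p (appl f x v) := by
  have := f.naturality (X := (x : Paths U)) (Y := (y : Paths U)) p
  exact congrArg (fun f => ModuleCat.Hom.hom f v) this

theorem appl_comp (f : X ⟶ Y) (g : Y ⟶ Z) {x : U} (v : X.obj x) :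
    appl (f ≫ g) x v = appl g x (appl f x v) := rfl

theorem appl_ext {f g : X ⟶ Y} (h : ∀ x v, appl f x v = appl g x v) : f = g := by
  ext x v
  exact h x v

/-- A morphism of representations from linear maps that commute with the arrows. -/
def homOfArrows (g : ∀ x : U, X.obj x →ₗ[k] Y.obj x)
    (h : ∀ {x y : U} (a : x ⟶ y) (v : X.obj x), g y (act X a.toPath v) = act Y a.toPath (g x v)) :
    X ⟶ Y where
  app x := ModuleCat.ofHom (g x)
  naturality x y p := by
    have key : ∀ {x y : U} (p : Quiver.Path x y) (v : X.obj x),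
        g y (act X p v) = act Y p (g x v) := fun {x y} p v => by
      induction p with
      | nil => rw [act_nil, act_nil]
      | cons p a ih => rw [act_cons, act_cons, h, ih]
    ext v
    exact key (x := x) (y := y) p v

theorem isIso_of_bijective (f : X ⟶ Y) (h : ∀ x, Function.Bijective (appl f x)) : IsIso f := by
  have : ∀ x, IsIso (f.app x) := fun x => by
    have := h x
    exact (ConcreteCategory.isIso_iff_bijective (f.app x)).2 this
  exact NatIso.isIso_of_isIso_app f

theorem bijective_of_isIso (f : X ⟶ Y) [IsIso f] (x : U) : Function.Bijective (appl f x) :=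
  (ConcreteCategory.isIso_iff_bijective (f.app (x : Paths U))).1
    (NatIso.isIso_app_of_isIso f (x : Paths U))

/-- The map from the value of a representation at a vertex to the product of the values at the ends
of the arrows that start there. -/
def starMap (X : Rep k U) (x : U) (v : X.obj x) (b : Quiver.Star x) : X.obj b.1 :=
  act X b.2.toPath v

/-- The representations all of whose star maps are bijective. -/
def saturated : ObjectProperty (Rep k U) := fun X => ∀ x, Function.Bijective (starMap X x)

/-- Morphisms whose kernel and cokernel are annihilated by long paths. -/
def eventualIso : MorphismProperty (Rep k U) := fun X Y f =>
  (∀ (x : U) (v : X.obj x), appl f x v = 0 →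
    ∃ m, ∀ (y : U) (p : Quiver.Path x y), m ≤ p.length → act X p v = 0) ∧
  (∀ (x : U) (v : Y.obj x),
    ∃ m, ∀ (y : U) (p : Quiver.Path x y), m ≤ p.length → ∃ u, appl f y u = act Y p v)

/-- Paths grow by appending a last arrow, whereas star maps concern the first one. This splits off
the first arrow and makes induction from the start of a path possible. -/
theorem path_eq_nil_or_comp {x y : U} (p : Quiver.Path x y) :
    p.length = 0 ∨ ∃ (z : U) (a : x ⟶ z) (q : Quiver.Path z y), p = a.toPath.comp q := by
  induction p with
  | nil => exact .inl rfl
  | cons p b ih =>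
    right
    rcases ih with h | ⟨z, a, q, rfl⟩
    · cases p with
      | nil => exact ⟨_, b, .nil, rfl⟩
      | cons p c => simp at h
    · exact ⟨z, a, q.cons b, rfl⟩

theorem path_split {x y : U} (p : Quiver.Path x y) {m n : ℕ} (h : p.length = m + n) :
    ∃ (z : U) (q : Quiver.Path x z) (r : Quiver.Path z y), p = q.comp r ∧ q.length = m ∧
      r.length = n := by
  induction n generalizing y with
  | zero => exact ⟨y, p, .nil, rfl, h, rfl⟩
  | succ n ih =>
    cases p with
    | nil => simp at h
    | cons p a =>
      obtain ⟨z, q, r, rfl, h1, h2⟩ := ih p (by simp at h; omega)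
      exact ⟨z, q, r.cons a, rfl, h1, by simp [h2]⟩

/-- Injectivity of the star maps, iterated `m` times. -/
theorem saturated.eq_zero (hX : saturated X) {x : U} {v : X.obj x} {m : ℕ}
    (h : ∀ (y : U) (p : Quiver.Path x y), p.length = m → act X p v = 0) : v = 0 := by
  induction m generalizing x with
  | zero => simpa [act_nil] using h x .nil rfl
  | succ m ih =>
    refine (hX x).1 (funext fun b => ?_)
    have hb : starMap X x v b = 0 := ih fun y p hp => by
      rw [starMap, ← act_comp]
      exact h y _ (by simp [hp, add_comm])
    have h0 : starMap X x 0 b = 0 := map_zero _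
    rw [hb, h0]

/-- Surjectivity of the star maps, iterated `m` times. -/
theorem saturated.exists_act_eq (hX : saturated X) {x : U} (m : ℕ)
    (w : ∀ (y : U), Quiver.Path x y → X.obj y) :
    ∃ v : X.obj x, ∀ (y : U) (p : Quiver.Path x y), p.length = m → act X p v = w y p := by
  induction m generalizing x with
  | zero =>
    refine ⟨w x .nil, fun y p hp => ?_⟩
    obtain rfl := p.eq_of_length_zero hp
    rw [p.eq_nil_of_length_zero hp, act_nil]
  | succ m ih =>
    choose v hv using fun b : Quiver.Star x => ih (x := b.1) fun y q => w y (b.2.toPath.comp q)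
    obtain ⟨u, hu⟩ := (hX x).2 v
    refine ⟨u, fun y p hp => ?_⟩
    obtain h | ⟨z, a, q, rfl⟩ := path_eq_nil_or_comp p
    · omega
    · have := congrFun hu ⟨z, a⟩
      rw [act_comp]
      change act X a.toPath u = _ at this
      rw [this]
      exact hv ⟨z, a⟩ y q (by simp at hp; omega)

variable (f : X ⟶ Y) (g : X ⟶ Z)

/-- The relation that is the graph of the extension of `g` along `f`. -/
def extRel (x : U) : Submodule k (Y.obj x × Z.obj x) where
  carrier := {vw | ∃ m, ∀ (y : U) (p : Quiver.Path x y), m ≤ p.length →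
    ∃ u, appl f y u = act Y p vw.1 ∧ appl g y u = act Z p vw.2}
  zero_mem' := ⟨0, fun y p _ => ⟨0, by simp⟩⟩
  add_mem' := by
    rintro vw vw' ⟨m, h⟩ ⟨m', h'⟩
    refine ⟨max m m', fun y p hp => ?_⟩
    obtain ⟨u, h1, h2⟩ := h y p (le_trans (le_max_left _ _) hp)
    obtain ⟨u', h1', h2'⟩ := h' y p (le_trans (le_max_right _ _) hp)
    exact ⟨u + u', by simp [h1, h1'], by simp [h2, h2']⟩
  smul_mem' := by
    rintro c vw ⟨m, h⟩
    refine ⟨m, fun y p hp => ?_⟩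
    obtain ⟨u, h1, h2⟩ := h y p hp
    exact ⟨c • u, by simp [h1], by simp [h2]⟩

variable {f}

/-- Along a long path `w` becomes `g u` with `f u = 0`. Such a `u` is killed by long paths, hence so
is `g u`, and a saturated `Z` has no nonzero element of this kind. Applying the same fact to `w`
finishes the argument. -/
theorem extRel_unique (hf : eventualIso f) (hZ : saturated Z) (x : U) {w : Z.obj x}
    (h : ((0 : Y.obj x), w) ∈ extRel f g x) : w = 0 := by
  obtain ⟨m, h⟩ := h
  refine hZ.eq_zero (m := m) fun y p hp => ?_
  obtain ⟨u, h1, h2⟩ := h y p hp.ge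
  rw [map_zero] at h1
  obtain ⟨n, hn⟩ := hf.1 y u h1
  rw [← h2]
  refine hZ.eq_zero (m := n) fun z q hq => ?_
  rw [← appl_act, hn z q hq.ge, map_zero]

theorem extRel_exists (hf : eventualIso f) (hZ : saturated Z) (x : U) (v : Y.obj x) :
    ∃ w, (v, w) ∈ extRel f g x := by
  classical
  obtain ⟨m, hm⟩ := hf.2 x v
  -- The element `u y p` is a lift along `f` of the image of `v` under a path `p` of length at least
  -- `m`. The values of `g` on the lifts at length exactly `m` determine `w`; on a longer path, the
  -- lift at its first `m` arrows is moved along the rest.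
  choose! u hu using hm
  obtain ⟨w, hw⟩ := hZ.exists_act_eq (x := x) m fun y p => appl g y (u y p)
  refine ⟨w, m, fun y p hp => ?_⟩
  obtain ⟨z, q, r, rfl, hq, hr⟩ := path_split p (m := m) (n := p.length - m) (by omega)
  refine ⟨act X r (u z q), ?_, ?_⟩
  · rw [appl_act, hu z q hq.ge, act_comp]
  · rw [appl_act, act_comp, hw z q hq]

/-- The relation `extRel` is linear, total and single-valued, so it is the graph of a linear map at
each vertex. With `extension_unique` this says that saturated representations are local for eventual
isomorphisms. -/
theorem exists_extension (hf : eventualIso f) (hZ : saturated Z) : ∃ h : Y ⟶ Z, f ≫ h = g := by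
  choose e he using fun x => extRel_exists g hf hZ x
  have key : ∀ x v w, (v, w) ∈ extRel f g x → e x v = w := fun x v w h => by
    have := (extRel f g x).sub_mem (he x v) h
    simp only [Prod.mk_sub_mk, sub_self] at this
    exact sub_eq_zero.1 (extRel_unique g hf hZ x this)
  let l : ∀ x, Y.obj x →ₗ[k] Z.obj x := fun x =>
    { toFun := e x
      map_add' := fun v v' => key x _ _ ((extRel f g x).add_mem (he x v) (he x v'))
      map_smul' := fun c v => key x _ _ ((extRel f g x).smul_mem c (he x v)) }
  refine ⟨homOfArrows l fun {x y} a v => key y _ _ ?_, appl_ext fun x v => key x _ _ ?_⟩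
  · obtain ⟨m, hm⟩ := he x v
    refine ⟨m, fun z p hp => ?_⟩
    obtain ⟨u, h1, h2⟩ := hm z (a.toPath.comp p) (by simp; omega)
    exact ⟨u, by rw [h1, act_comp], by rw [h2, act_comp]; rfl⟩
  · exact ⟨0, fun y p _ => ⟨act X p v, appl_act f p v, appl_act g p v⟩⟩

theorem extension_unique (hf : eventualIso f) (hZ : saturated Z) {h h' : Y ⟶ Z}
    (e : f ≫ h = f ≫ h') : h = h' := by
  refine appl_ext fun x v => ?_
  obtain ⟨m, hm⟩ := hf.2 x v
  refine sub_eq_zero.1 (hZ.eq_zero (m := m) fun y p hp => ?_)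
  obtain ⟨u, hu⟩ := hm y p hp.ge
  have := congrArg (fun φ => appl φ y u) e
  simp only [appl_comp, hu] at this
  rw [map_sub, ← appl_act, ← appl_act, this, sub_self]

/-- Finite stars leave only finitely many paths of length `m` out of `x`, so bounds that depend on
such a path have a common upper bound. This is where finiteness of the quiver enters the theory of
saturation. -/
theorem exists_uniform [∀ x : U, Finite (Quiver.Star x)] {x : U}
    (P : ∀ y : U, Quiver.Path x y → Prop) (m : ℕ)
    (h : ∀ (y : U) (p : Quiver.Path x y), p.length = m →
      ∃ n, ∀ (z : U) (q : Quiver.Path y z), n ≤ q.length → P z (p.comp q)) :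
    ∃ n, ∀ (y : U) (p : Quiver.Path x y), n ≤ p.length → P y p := by
  induction m generalizing x with
  | zero =>
    obtain ⟨n, hn⟩ := h x .nil rfl
    exact ⟨n, fun y p hp => by simpa using hn y p hp⟩
  | succ m ih =>
    choose n hn using fun b : Quiver.Star x => ih (x := b.1)
      (fun y q => P y (b.2.toPath.comp q)) fun y q hq => by
        obtain ⟨n, hn⟩ := h y (b.2.toPath.comp q) (by simp [hq, add_comm])
        exact ⟨n, fun z r hr => by rw [← Quiver.Path.comp_assoc]; exact hn z r hr⟩
    obtain ⟨N, hN⟩ := (Set.finite_range n).bddAbove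
    refine ⟨N + 1, fun y p hp => ?_⟩
    obtain h | ⟨z, a, q, rfl⟩ := path_eq_nil_or_comp p
    · omega
    · have : n ⟨z, a⟩ ≤ N := hN ⟨_, rfl⟩
      exact hn ⟨z, a⟩ y q (by simp at hp; omega)

/-- If `g (f u)` equals the image of `g v` under `p`, then `f u` and the image of `v` under `p`
differ by an element of the kernel of `g`, which dies along longer paths. How much longer depends on
`p`, hence the appeal to `exists_uniform`. -/
theorem eventualIso.of_comp {f : X ⟶ Y} {g : Y ⟶ Z} [∀ x : U, Finite (Quiver.Star x)]
    (hfg : eventualIso (f ≫ g)) (hg : eventualIso g) : eventualIso f := by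
  refine ⟨fun x v hv => hfg.1 x v (by rw [appl_comp, hv, map_zero]), fun x v => ?_⟩
  obtain ⟨m, hm⟩ := hfg.2 x (appl g x v)
  refine exists_uniform (fun y p => ∃ u, appl f y u = act Y p v) m fun y p hp => ?_
  obtain ⟨u, hu⟩ := hm y p hp.ge
  obtain ⟨n, hn⟩ := hg.1 y (appl f y u - act Y p v) (by
    rw [map_sub, ← appl_comp, hu, appl_act, sub_self])
  refine ⟨n, fun z q hq => ⟨act X q u, ?_⟩⟩
  have := hn z q hq
  rw [map_sub, sub_eq_zero] at this
  rw [appl_act, this, act_comp]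

theorem eventualIso.comp_isIso {f : X ⟶ Y} (g : Y ⟶ Z) [IsIso g] (hf : eventualIso f) :
    eventualIso (f ≫ g) := by
  refine ⟨fun x v hv => hf.1 x v ?_, fun x v => ?_⟩
  · exact (bijective_of_isIso g x).1 (hv.trans (map_zero _).symm)
  · obtain ⟨w, rfl⟩ := (bijective_of_isIso g x).2 v
    obtain ⟨m, hm⟩ := hf.2 x w
    refine ⟨m, fun y p hp => ?_⟩
    obtain ⟨u, hu⟩ := hm y p hp
    exact ⟨u, by rw [appl_comp, hu, appl_act]⟩

/-! ### The saturation of a representation -/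

/-- Families of elements at the ends of all paths that start at `x`. -/
abbrev PathFamily (X : Rep k U) (x : U) : Type u := ∀ b : (Σ y : U, Quiver.Path x y), X.obj b.1

/-- The families that are eventually compatible with the action of paths. -/
def compatFamily (X : Rep k U) (x : U) : Submodule k (PathFamily X x) where
  carrier := {φ | ∃ m, ∀ (y z : U) (p : Quiver.Path x y) (q : Quiver.Path y z), m ≤ p.length →
    φ ⟨z, p.comp q⟩ = act X q (φ ⟨y, p⟩)}
  zero_mem' := ⟨0, fun y z p q _ => (map_zero _).symm⟩
  add_mem' := by
    rintro φ φ' ⟨m, h⟩ ⟨m', h'⟩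
    refine ⟨max m m', fun y z p q hp => ?_⟩
    rw [Pi.add_apply, Pi.add_apply, map_add, h y z p q (le_trans (le_max_left _ _) hp),
      h' y z p q (le_trans (le_max_right _ _) hp)]
  smul_mem' := by
    rintro c φ ⟨m, h⟩
    exact ⟨m, fun y z p q hp => by rw [Pi.smul_apply, Pi.smul_apply, map_smul, h y z p q hp]⟩

/-- The families that are eventually zero. -/
def nullFamily (X : Rep k U) (x : U) : Submodule k (PathFamily X x) where
  carrier := {φ | ∃ m, ∀ (y : U) (p : Quiver.Path x y), m ≤ p.length → φ ⟨y, p⟩ = 0}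
  zero_mem' := ⟨0, fun y p _ => rfl⟩
  add_mem' := by
    rintro φ φ' ⟨m, h⟩ ⟨m', h'⟩
    refine ⟨max m m', fun y p hp => ?_⟩
    rw [Pi.add_apply, h y p (le_trans (le_max_left _ _) hp),
      h' y p (le_trans (le_max_right _ _) hp), add_zero]
  smul_mem' := by
    rintro c φ ⟨m, h⟩
    exact ⟨m, fun y p hp => by rw [Pi.smul_apply, h y p hp, smul_zero]⟩

/-- Germs at infinity of compatible families. -/
abbrev Germ (X : Rep k U) (x : U) : Type u :=
  compatFamily X x ⧸ (nullFamily X x).comap (compatFamily X x).subtype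

/-- The class of a compatible family. -/
def germ (X : Rep k U) (x : U) : compatFamily X x →ₗ[k] Germ X x := Submodule.mkQ _

theorem germ_surjective (X : Rep k U) (x : U) : Function.Surjective (germ X x) :=
  Submodule.mkQ_surjective _

theorem germ_eq_zero {X : Rep k U} {x : U} {φ : compatFamily X x} :
    germ X x φ = 0 ↔ ∃ m, ∀ (y : U) (p : Quiver.Path x y), m ≤ p.length → φ.1 ⟨y, p⟩ = 0 :=
  Submodule.Quotient.mk_eq_zero _

/-- Translation of compatible families along a path. -/
def compatMap (X : Rep k U) {x y : U} (r : Quiver.Path x y) :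
    compatFamily X x →ₗ[k] compatFamily X y where
  toFun φ := ⟨fun b => φ.1 ⟨b.1, r.comp b.2⟩, by
    obtain ⟨φ, m, h⟩ := φ
    refine ⟨m, fun z w p q hp => ?_⟩
    have := h z w (r.comp p) q (by simp; omega)
    rwa [Quiver.Path.comp_assoc] at this⟩
  map_add' _ _ := rfl
  map_smul' _ _ := rfl

theorem compatMap_nil (X : Rep k U) {x : U} (φ : compatFamily X x) :
    compatMap X .nil φ = φ :=
  Subtype.ext (funext fun ⟨y, p⟩ => by
    change φ.1 ⟨y, Quiver.Path.nil.comp p⟩ = _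
    rw [Quiver.Path.nil_comp])

theorem compatMap_comp (X : Rep k U) {x y z : U} (r : Quiver.Path x y) (s : Quiver.Path y z)
    (φ : compatFamily X x) : compatMap X (r.comp s) φ = compatMap X s (compatMap X r φ) :=
  Subtype.ext (funext fun ⟨w, p⟩ => by
    change φ.1 ⟨w, (r.comp s).comp p⟩ = φ.1 ⟨w, r.comp (s.comp p)⟩
    rw [Quiver.Path.comp_assoc])

/-- Translation of germs along a path. -/
def germMap (X : Rep k U) {x y : U} (r : Quiver.Path x y) : Germ X x →ₗ[k] Germ X y :=
  Submodule.mapQ _ _ (compatMap X r) (by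
    rintro φ ⟨m, h⟩
    exact ⟨m, fun z p hp => h z (r.comp p) (by simp; omega)⟩)

/-- The saturation of a representation. -/
def saturation (X : Rep k U) : Rep k U where
  obj x := ModuleCat.of k (Germ X x)
  map {x y} r := ModuleCat.ofHom (germMap X (x := x) (y := y) r)
  map_id x := by
    refine ModuleCat.hom_ext (LinearMap.ext fun v => ?_)
    obtain ⟨φ, rfl⟩ := germ_surjective X x v
    exact congrArg (germ X x) (compatMap_nil X φ)
  map_comp {x y z} r s := by
    refine ModuleCat.hom_ext (LinearMap.ext fun v => ?_)
    obtain ⟨φ, rfl⟩ := germ_surjective X x v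
    exact congrArg (germ X z) (compatMap_comp X (x := x) (y := y) (z := z) r s φ)

/-- The compatible family of an element. -/
def constFamily (X : Rep k U) (x : U) : X.obj x →ₗ[k] compatFamily X x where
  toFun v := ⟨fun b => act X b.2 v, 0, fun _ _ p q _ => act_comp p q v⟩
  map_add' _ _ := Subtype.ext (funext fun b => map_add (act X b.2) _ _)
  map_smul' _ _ := Subtype.ext (funext fun b => map_smul (act X b.2) _ _)

/-- The canonical morphism from a representation to its saturation. -/
def toSaturation (X : Rep k U) : X ⟶ saturation X :=
  homOfArrows (fun x => (germ X x).comp (constFamily X x)) fun {x y} a v => by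
    refine congrArg (germ X y) (Subtype.ext (funext fun b => ?_))
    exact (act_comp a.toPath b.2 v).symm

theorem eventualIso_toSaturation (X : Rep k U) : eventualIso (toSaturation X) := by
  refine ⟨fun x v hv => germ_eq_zero.1 hv, fun x v => ?_⟩
  obtain ⟨φ, rfl⟩ := germ_surjective X x v
  obtain ⟨φ, m, h⟩ := φ
  refine ⟨m, fun y p hp => ⟨φ ⟨y, p⟩, congrArg (germ X y) (Subtype.ext (funext fun b => ?_))⟩⟩
  exact (h y b.1 p b.2 hp).symm

/-- The value at `pr` of the family with prescribed restrictions along the arrows from `x`. -/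
def glueAux (X : Rep k U) {x : U} (ψ : ∀ b : Quiver.Star x, PathFamily X b.1) :
    ∀ {y z : U}, Quiver.Path x y → Quiver.Path y z → X.obj z
  -- A germ ignores short paths, so the value at the trivial path is an arbitrary default. The other
  -- clauses carry arrows from the end of the first path to the front of the second until only the
  -- first arrow is left, which selects the family to be evaluated.
  | _, _, .nil, _ => 0
  | y, z, .cons .nil a, r => ψ ⟨y, a⟩ ⟨z, r⟩
  | _, _, .cons (.cons p b) a, r => glueAux X ψ (.cons p b) (a.toPath.comp r)

theorem glueAux_comp (X : Rep k U) {x : U} (ψ : ∀ b : Quiver.Star x, PathFamily X b.1) {y z w : U}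
    (a : x ⟶ y) (q : Quiver.Path y z) (r : Quiver.Path z w) :
    glueAux X ψ (a.toPath.comp q) r = ψ ⟨y, a⟩ ⟨w, q.comp r⟩ := by
  induction q with
  | nil => rw [Quiver.Path.nil_comp]; rfl
  | cons q b ih =>
    have : ∀ {z' : U} (p : Quiver.Path x z') (h : p.length ≠ 0) {z w : U} (b : z' ⟶ z)
        (r : Quiver.Path z w),
        glueAux X ψ (p.cons b) r = glueAux X ψ p (b.toPath.comp r) := by
      intro z' p h z w b r
      cases p with
      | nil => simp at h
      | cons p c => rfl
    rw [Quiver.Path.comp_cons, this _ (by simp), ih,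
      ← Quiver.Path.comp_assoc]
    rfl

/-- A nontrivial path from `x` is an arrow out of `x` followed by a path. A family at `x` is
therefore, up to its value at the trivial path, a collection of families at the ends of these
arrows. Since there are finitely many arrows, vanishing or compatibility beyond a bound for each of
them yields a single bound at `x`. -/
theorem saturated_saturation [∀ x : U, Finite (Quiver.Star x)] (X : Rep k U) :
    saturated (saturation X) := by
  intro x
  constructor
  · suffices h : ∀ v, (∀ b, starMap (saturation X) x v b = 0) → v = 0 by
      intro v w hvw
      refine sub_eq_zero.1 (h _ fun b => ?_)
      exact (map_sub (act (saturation X) b.2.toPath) v w).trans (sub_eq_zero.2 (congrFun hvw b))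
    intro v hv
    obtain ⟨φ, rfl⟩ := germ_surjective X x v
    refine germ_eq_zero.2 (exists_uniform (fun y p => φ.1 ⟨y, p⟩ = 0) 1 fun y p hp => ?_)
    obtain h | ⟨z, a, q, rfl⟩ := path_eq_nil_or_comp p
    · omega
    · obtain ⟨m, hm⟩ := germ_eq_zero.1 (hv ⟨z, a⟩)
      refine ⟨m, fun w r hr => ?_⟩
      rw [Quiver.Path.comp_assoc]
      exact hm w (q.comp r) (by simp; omega)
  · intro w
    choose ψ hψ using fun b : Quiver.Star x => germ_surjective X b.1 (w b)
    let φ : PathFamily X x := fun b => glueAux X (fun b => (ψ b).1) b.2 .nil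
    have hφ : ∀ (y z : U) (a : x ⟶ y) (q : Quiver.Path y z),
        φ ⟨z, a.toPath.comp q⟩ = (ψ ⟨y, a⟩).1 ⟨z, q⟩ := fun y z a q => glueAux_comp X _ a q .nil
    have hmem : φ ∈ compatFamily X x := by
      obtain ⟨m, hm⟩ := exists_uniform (x := x)
        (fun y p => ∀ (z : U) (q : Quiver.Path y z), φ ⟨z, p.comp q⟩ = act X q (φ ⟨y, p⟩)) 1
        fun y p hp => by
          obtain h | ⟨z, a, q, rfl⟩ := path_eq_nil_or_comp p
          · omega
          · obtain ⟨m, hm⟩ := (ψ ⟨z, a⟩).2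
            refine ⟨m, fun w r hr w' s => ?_⟩
            have h1 := hφ z w' a ((q.comp r).comp s)
            have h2 := hφ z w a (q.comp r)
            rw [← Quiver.Path.comp_assoc] at h2
            rw [← Quiver.Path.comp_assoc, ← Quiver.Path.comp_assoc] at h1
            exact h1.trans ((hm w w' (q.comp r) s (by simp; omega)).trans
              (congrArg (act X s) h2.symm))
      exact ⟨m, fun y z p q hp => hm y p hp z q⟩
    refine ⟨germ X x ⟨φ, hmem⟩, funext fun b => ?_⟩
    refine Eq.trans ?_ (hψ b)
    exact congrArg (germ X b.1) (Subtype.ext (funext fun c => hφ b.1 c.1 b.2 c.2))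

end Representations

/-! ### Saturated representations as a reflective localization. -/

section Saturate

variable {k : Type u} [Field k] {U : Type u} [Quiver.{u} U] [∀ x : U, Finite (Quiver.Star x)]

/-- Morphisms from the saturation to a saturated representation. -/
noncomputable def saturationHomEquiv (X : Rep k U)
    (Y : (saturated (k := k) (U := U)).FullSubcategory) :
    ((⟨saturation X, saturated_saturation X⟩ : saturated.FullSubcategory) ⟶ Y) ≃ (X ⟶ Y.obj) :=
  Equiv.ofBijective (fun h => toSaturation X ≫ h.hom)
    ⟨fun _ _ e => ObjectProperty.hom_ext _
      (extension_unique (eventualIso_toSaturation X) Y.property e),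
    fun g => by
      obtain ⟨h, hh⟩ := exists_extension g (eventualIso_toSaturation X) Y.property
      exact ⟨ObjectProperty.homMk h, hh⟩⟩

variable (k U) in
/-- The reflection of representations into the saturated representations. -/
noncomputable def saturate : Rep k U ⥤ (saturated (k := k) (U := U)).FullSubcategory :=
  Adjunction.leftAdjointOfEquiv (G := saturated.ι) saturationHomEquiv fun _ _ _ _ _ => rfl

variable (k U) in
/-- The saturated representations form a reflective subcategory. -/
noncomputable def saturateAdjunction : saturate k U ⊣ (saturated (k := k) (U := U)).ι :=
  Adjunction.adjunctionOfEquivLeft (G := saturated.ι) saturationHomEquiv fun _ _ _ _ _ => rfl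

theorem toSaturation_saturate_map {X Y : Rep k U} (f : X ⟶ Y) :
    toSaturation X ≫ ((saturate k U).map f).hom = f ≫ toSaturation Y := by
  have : (saturateAdjunction k U).unit.app X = toSaturation X := by
    simp [saturateAdjunction]
    rfl
  have h := (saturateAdjunction k U).unit.naturality f
  exact h.symm

/-- For a reflection, `f` becomes invertible exactly when the objects of the subcategory are local
for `f`, which eventual isomorphisms satisfy. Conversely, the naturality square of the unit presents
`f ≫ toSaturation Y` as an eventual isomorphism followed by an isomorphism, and
`eventualIso.of_comp` cancels `toSaturation Y`. -/
theorem isIso_saturate_map_iff {X Y : Rep k U} (f : X ⟶ Y) :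
    IsIso ((saturate k U).map f) ↔ eventualIso f := by
  constructor
  · intro h
    refine eventualIso.of_comp (g := toSaturation Y) ?_ (eventualIso_toSaturation Y)
    rw [← toSaturation_saturate_map]
    have : IsIso ((saturate k U).map f).hom :=
      (ObjectProperty.isIso_hom_iff _).2 h
    exact @eventualIso.comp_isIso k _ U _ _ _ _ _ _ this (eventualIso_toSaturation X)
  · intro h
    rw [← ObjectProperty.isLocal_iff_isIso_map (saturateAdjunction k U)]
    rintro _ ⟨Z, rfl⟩
    exact ⟨fun a b e => extension_unique h Z.property e,
      fun g => exists_extension g h Z.property⟩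

end Saturate

/-! ### The covering quiver -/

section Cov

/-- The vertices of the covering quiver of `V` that belongs to the length grading. -/
@[ext]
structure Cov (V : Type u) : Type u where
  vertex : V
  deg : ℤ

variable {V : Type u} [Quiver.{u} V]

/-- The arrows of the covering quiver raise the degree by one. -/
instance : Quiver.{u} (Cov V) where
  Hom x y := {a : Arr V // a.src = x.vertex ∧ a.tgt = y.vertex ∧ y.deg = x.deg + 1}

instance [Finite V] [∀ i j : V, Finite (i ⟶ j)] : Finite (Arr V) :=
  Finite.of_injective (fun a : Arr V => (⟨a.src, a.tgt, a.hom⟩ : Σ (i : V) (j : V), i ⟶ j))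
    fun ⟨_, _, _⟩ ⟨_, _, _⟩ h => by cases h; rfl

/-- Unique lifting of arrows to the cover: the starting point and the underlying arrow fix the end,
including its degree. -/
theorem cov_hom_ext {x y z : Cov V} {a : x ⟶ y} {b : x ⟶ z} (h : a.1 = b.1) :
    (⟨y, a⟩ : Quiver.Star x) = ⟨z, b⟩ := by
  obtain ⟨a, h1, h2, h3⟩ := a
  obtain ⟨b, h4, h5, h6⟩ := b
  obtain rfl : a = b := h
  obtain rfl : y = z := Cov.ext (h2.symm.trans h5) (h3.trans h6.symm)
  rfl

instance [Finite V] [∀ i j : V, Finite (i ⟶ j)] (x : Cov V) : Finite (Quiver.Star x) :=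
  Finite.of_injective (fun b : Quiver.Star x => b.2.1) fun ⟨_, _⟩ ⟨_, _⟩ h => cov_hom_ext h

instance [Finite V] : Finite (CoreVertex V) := Subtype.finite

/-! ### The vertices of the core -/

/-- The vertices at which a path of length `n` starts. -/
def alive (V : Type u) [Quiver.{u} V] : ℕ → Set V
  | 0 => Set.univ
  | n + 1 => {v | ∃ a : Arr V, a.src = v ∧ a.tgt ∈ alive V n}

/-- The vertices at which a path of length `n` ends. -/
def coalive (V : Type u) [Quiver.{u} V] : ℕ → Set V
  | 0 => Set.univ
  | n + 1 => {v | ∃ a : Arr V, a.tgt = v ∧ a.src ∈ coalive V n}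

theorem alive_antitone : Antitone (alive V) := by
  refine antitone_nat_of_succ_le fun n => ?_
  induction n with
  | zero => exact fun _ _ => trivial
  | succ n ih => exact fun v ⟨a, h, h'⟩ => ⟨a, h, ih h'⟩

theorem coalive_antitone : Antitone (coalive V) := by
  refine antitone_nat_of_succ_le fun n => ?_
  induction n with
  | zero => exact fun _ _ => trivial
  | succ n ih => exact fun v ⟨a, h, h'⟩ => ⟨a, h, ih h'⟩

/-- The neighbours that keep a vertex in round `n + 1` are found on the long paths from it and to
it. Such a neighbour has itself paths of length `n` on both sides, so it survives `n` rounds by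
induction. -/
theorem alive_inter_coalive_subset (n : ℕ) : alive V n ∩ coalive V n ⊆ coreStage V n := by
  induction n with
  | zero => exact fun _ _ => trivial
  | succ n ih =>
    rintro v ⟨⟨a, ha, ha'⟩, ⟨b, hb, hb'⟩⟩
    have hv : v ∈ alive V (n + 1) := ⟨a, ha, ha'⟩
    have hv' : v ∈ coalive V (n + 1) := ⟨b, hb, hb'⟩
    refine ⟨ih ⟨alive_antitone n.le_succ hv, coalive_antitone n.le_succ hv'⟩,
      ⟨a, ha, ih ⟨ha', ?_⟩⟩, ⟨b, hb, ih ⟨?_, hb'⟩⟩⟩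
    -- Appending `a` to a path of length `n + 1` that ends at `v` gives a path of length `n + 2` to
    -- the end of `a`.
    · exact coalive_antitone (Nat.le_add_right n 2) ⟨a, rfl, ha ▸ hv'⟩
    · exact alive_antitone (Nat.le_add_right n 2) ⟨b, rfl, hb ▸ hv⟩

theorem coreStage_antitone : Antitone (coreStage V) :=
  antitone_nat_of_succ_le fun _ _ h => h.1

variable (V) in
/-- The removal of sources and sinks of a finite quiver terminates. -/
theorem exists_coreStage_eq [Finite V] : ∃ N, ∀ n, N ≤ n → coreStage V n = coreStage V N := by
  obtain ⟨N, hN⟩ := WellFoundedGT.monotone_chain_condition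
    (⟨fun n => OrderDual.toDual (coreStage V n), fun _ _ h => coreStage_antitone h⟩ :
      ℕ →o (Set V)ᵒᵈ)
  exact ⟨N, fun n hn => (hN n hn).symm⟩

/-- The vertices of the core. -/
def coreSet (V : Type u) [Quiver.{u} V] : Set V := {v | ∀ n, v ∈ coreStage V n}

variable (V) in
theorem exists_coreStage_subset [Finite V] : ∃ N, coreStage V N ⊆ coreSet V := by
  obtain ⟨N, hN⟩ := exists_coreStage_eq V
  refine ⟨N, fun v hv n => ?_⟩
  obtain h | h := le_total n N
  · exact coreStage_antitone h hv
  · rw [hN n h]; exact hv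

variable (V) in
/-- A long path whose end is the start of another long path ends in the core. -/
theorem exists_alive_inter_coalive_subset [Finite V] :
    ∃ N, alive V N ∩ coalive V N ⊆ coreSet V := by
  obtain ⟨N, hN⟩ := exists_coreStage_subset V
  exact ⟨N, (alive_inter_coalive_subset N).trans hN⟩

theorem exists_arrow_of_mem_core [Finite V] {v : V} (hv : v ∈ coreSet V) :
    ∃ a : Arr V, a.src = v ∧ a.tgt ∈ coreSet V := by
  obtain ⟨N, hN⟩ := exists_coreStage_subset V
  obtain ⟨-, ⟨a, h, h'⟩, -⟩ := hv (N + 1)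
  exact ⟨a, h, hN h'⟩

theorem exists_coarrow_of_mem_core [Finite V] {v : V} (hv : v ∈ coreSet V) :
    ∃ a : Arr V, a.tgt = v ∧ a.src ∈ coreSet V := by
  obtain ⟨N, hN⟩ := exists_coreStage_subset V
  obtain ⟨-, -, ⟨a, h, h'⟩⟩ := hv (N + 1)
  exact ⟨a, h, hN h'⟩

theorem core_subset_alive [Finite V] (n : ℕ) : coreSet V ⊆ alive V n := by
  induction n with
  | zero => exact fun _ _ => trivial
  | succ n ih =>
    intro v hv
    obtain ⟨a, h, h'⟩ := exists_arrow_of_mem_core hv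
    exact ⟨a, h, ih h'⟩

theorem core_subset_coalive [Finite V] (n : ℕ) : coreSet V ⊆ coalive V n := by
  induction n with
  | zero => exact fun _ _ => trivial
  | succ n ih =>
    intro v hv
    obtain ⟨a, h, h'⟩ := exists_coarrow_of_mem_core hv
    exact ⟨a, h, ih h'⟩

/-- The core is convex: a vertex with arbitrarily long paths from and to it is in the core. -/
theorem mem_core_of_alive_of_coalive [Finite V] {v : V} (h : ∀ n, v ∈ alive V n)
    (h' : ∀ n, v ∈ coalive V n) : v ∈ coreSet V := by
  obtain ⟨N, hN⟩ := exists_alive_inter_coalive_subset V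
  exact hN ⟨h N, h' N⟩

/-- An arrow of the core as an arrow of the quiver. -/
def coreArr (a : Arr (CoreVertex V)) : Arr V := ⟨a.src.1, a.tgt.1, a.hom⟩

theorem coreArr_injective : Function.Injective (coreArr (V := V)) := by
  rintro ⟨⟨i, hi⟩, ⟨j, hj⟩, a⟩ ⟨⟨i', hi'⟩, ⟨j', hj'⟩, a'⟩ h
  obtain rfl : i = i' := congrArg Arr.src h
  obtain rfl : j = j' := congrArg Arr.tgt h
  have : a = a' := eq_of_heq (Arr.mk.inj h).2.2
  rw [this]

theorem exists_coreArr (a : Arr V) (h : a.src ∈ coreSet V) (h' : a.tgt ∈ coreSet V) :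
    ∃ b : Arr (CoreVertex V), coreArr b = a := ⟨⟨⟨a.src, h⟩, ⟨a.tgt, h'⟩, a.hom⟩, rfl⟩

/-- The inclusion of the covering quiver of the core. -/
def coreIncl (V : Type u) [Quiver.{u} V] : Cov (CoreVertex V) ⥤q Cov V where
  obj x := ⟨x.vertex.1, x.deg⟩
  map a := ⟨coreArr a.1, congrArg Subtype.val a.2.1, congrArg Subtype.val a.2.2.1, a.2.2.2⟩

theorem coreIncl_obj_injective : Function.Injective (coreIncl V).obj := by
  rintro ⟨i, m⟩ ⟨j, n⟩ h
  exact Cov.ext (Subtype.ext (congrArg (fun x : Cov V => x.vertex) h)) (congrArg (fun x : Cov V => x.deg) h)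

theorem coreIncl_map_injective {x y : Cov (CoreVertex V)} :
    Function.Injective ((coreIncl V).map : (x ⟶ y) → _) := fun _ _ h =>
  Subtype.ext (coreArr_injective (congrArg Subtype.val h))

theorem mapPath_coreIncl_injective {x y : Cov (CoreVertex V)} (p q : Quiver.Path x y)
    (h : (coreIncl V).mapPath p = (coreIncl V).mapPath q) : p = q := by
  induction p with
  | nil =>
    cases q with
    | nil => rfl
    | cons q b => exact absurd h (Quiver.Path.nil_ne_cons _ _)
  | @cons y _ p a ih =>
    cases q with
    | nil => exact absurd h (Quiver.Path.cons_ne_nil _ _)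
    | @cons y' _ q b =>
      obtain rfl := coreIncl_obj_injective (Quiver.Path.obj_eq_of_cons_eq_cons h)
      rw [ih q (eq_of_heq (Quiver.Path.heq_of_cons_eq_cons h)),
        coreIncl_map_injective (eq_of_heq (Quiver.Path.hom_heq_of_cons_eq_cons h))]

theorem coalive_of_path {x y : Cov V} (p : Quiver.Path x y) (m : ℕ)
    (h : x.vertex ∈ coalive V m) : y.vertex ∈ coalive V (m + p.length) := by
  induction p with
  | nil => exact h
  | cons p a ih => exact ⟨a.1, a.2.2.1, by rw [a.2.1]; exact ih⟩

theorem alive_of_path {x y : Cov V} (p : Quiver.Path x y) (m : ℕ)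
    (h : y.vertex ∈ alive V m) : x.vertex ∈ alive V (m + p.length) := by
  induction p generalizing m with
  | nil => exact h
  | cons p a ih =>
    have := ih (m + 1) ⟨a.1, a.2.1, by rw [a.2.2.1]; exact h⟩
    rwa [add_assoc, add_comm 1] at this

/-- Every vertex on a path that starts in the core has arbitrarily long paths into it. If the end of
the path continues indefinitely, so does every vertex on it. By convexity all these vertices, and so
the whole path, lie in the core. -/
theorem exists_lift_path [Finite V] {x : Cov (CoreVertex V)} {y : Cov V}
    (p : Quiver.Path ((coreIncl V).obj x) y) (hy : ∀ n, y.vertex ∈ alive V n) :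
    ∃ (z : Cov (CoreVertex V)) (h : (coreIncl V).obj z = y) (q : Quiver.Path x z),
      ((coreIncl V).mapPath q).cast rfl h = p := by
  induction p with
  | nil => exact ⟨x, rfl, .nil, rfl⟩
  | @cons y w p a ih =>
    have hy' : ∀ n, y.vertex ∈ alive V n := fun n =>
      alive_antitone n.le_succ ⟨a.1, a.2.1, by rw [a.2.2.1]; exact hy n⟩
    obtain ⟨z, rfl, q, rfl⟩ := ih hy'
    have hw : w.vertex ∈ coreSet V := mem_core_of_alive_of_coalive hy fun n =>
      coalive_antitone (Nat.le_add_right _ _)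
        (coalive_of_path (a.toPath) n (core_subset_coalive n z.vertex.2))
    obtain ⟨⟨s, t, a⟩, h1, h2, h3⟩ := a
    obtain ⟨i, m⟩ := w
    obtain rfl : s = _ := h1
    obtain rfl : t = i := h2
    obtain rfl : m = _ := h3
    exact ⟨⟨⟨t, hw⟩, z.deg + 1⟩, rfl, q.cons ⟨⟨z.vertex, ⟨t, hw⟩, a⟩, rfl, rfl, rfl⟩, rfl⟩

/-- The inclusion of the core on the path categories. -/
def coreFunctor (V : Type u) [Quiver.{u} V] : Paths (Cov (CoreVertex V)) ⥤ Paths (Cov V) where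
  obj x := (coreIncl V).obj x
  map {x y} p := (coreIncl V).mapPath (a := x) (b := y) p
  map_id _ := rfl
  map_comp {x y _} p q := (coreIncl V).mapPath_comp (a := x) (b := y) p q

instance : (coreFunctor V).Faithful where
  map_injective {x y} p q h := mapPath_coreIncl_injective (x := x) (y := y) p q h

/-- Fullness is convexity of the core. With faithfulness it makes the counit of the right Kan
extension invertible, so that coinduction from the core is fully faithful. -/
instance [Finite V] : (coreFunctor V).Full where
  map_surjective {x y} p := by
    obtain ⟨z, h, q, rfl⟩ := exists_lift_path (x := x) (y := (coreIncl V).obj y) p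
      fun n => core_subset_alive n y.vertex.2
    obtain rfl := coreIncl_obj_injective h
    exact ⟨q, rfl⟩

/-! ### Restriction to the core and coinduction from it. -/

variable (k : Type u) [Field k]

variable (V) in
/-- Restriction of representations to the core. -/
def restrictCore : Rep k (Cov V) ⥤ Rep k (Cov (CoreVertex V)) :=
  (Functor.whiskeringLeft _ _ (ModuleCat.{u} k)).obj (coreFunctor V)

variable (V) in
/-- Coinduction of representations from the core. -/
noncomputable def coinduceCore : Rep k (Cov (CoreVertex V)) ⥤ Rep k (Cov V) :=
  (coreFunctor V).ran

variable (V) in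
/-- Coinduction is right adjoint to restriction. -/
noncomputable def restrictCoreAdjunction : restrictCore V k ⊣ coinduceCore V k :=
  (coreFunctor V).ranAdjunction (ModuleCat.{u} k)

instance [Finite V] : IsIso (restrictCoreAdjunction V k).counit :=
  inferInstanceAs (IsIso ((coreFunctor V).ranAdjunction (ModuleCat.{u} k)).counit)

/-- Coinduction from the core is fully faithful. -/
noncomputable def fullyFaithfulCoinduceCore [Finite V] : (coinduceCore V k).FullyFaithful :=
  (restrictCoreAdjunction V k).fullyFaithfulROfIsIsoCounit

variable {k}

theorem length_mapPath {U W : Type u} [Quiver.{u} U] [Quiver.{u} W] (F : U ⥤q W) {x y : U}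
    (p : Quiver.Path x y) : (F.mapPath p).length = p.length := by
  induction p with
  | nil => rfl
  | cons p a ih => simp [ih]

/-- The conditions on kernel and cokernel concern only long paths. Up to a bounded number `N` of
arrows at each end, a long path lies in the core, and both conditions persist when a path is
prolonged; so it is enough to test them on paths in the core. -/
theorem eventualIso_restrictCore_iff [Finite V] [∀ i j : V, Finite (i ⟶ j)] {X Y : Rep k (Cov V)}
    (f : X ⟶ Y) : eventualIso ((restrictCore V k).map f) ↔ eventualIso f := by
  constructor
  · intro h
    obtain ⟨N, hN⟩ := exists_alive_inter_coalive_subset V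
    have hpath : ∀ {x y z : Cov V} (p : Quiver.Path x y) (q : Quiver.Path y z), p.length = N →
        N ≤ q.length → y.vertex ∈ coreSet V := fun p q hp hq =>
      hN ⟨alive_antitone hq (by simpa using alive_of_path q 0 trivial),
        by simpa [hp] using coalive_of_path p 0 trivial⟩
    -- a property of paths that is eventually true for paths in the core is eventually true
    have key : ∀ (x : Cov V) (P : ∀ y, Quiver.Path x y → Prop),
        (∀ y z (p : Quiver.Path x y) (q : Quiver.Path y z), P y p → P z (p.comp q)) →
        (∀ (y : Cov (CoreVertex V)) (p : Quiver.Path x ((coreIncl V).obj y)), ∃ m,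
          ∀ z (q : Quiver.Path y z), m ≤ q.length → P _ (p.comp ((coreIncl V).mapPath q))) →
        ∃ m, ∀ y p, m ≤ p.length → P y p := by
      intro x P hP hP'
      refine exists_uniform P N fun y p hp => ?_
      by_cases hy : y.vertex ∈ coreSet V
      · obtain ⟨i, d⟩ := y
        obtain ⟨m, hm⟩ := hP' ⟨⟨i, hy⟩, d⟩ p
        refine ⟨m + N, fun z q hq => ?_⟩
        have hq' : m ≤ q.length - N := by omega
        -- The last `N` arrows `s` witness that the end of `r` is alive for `N` steps. Since `r`
        -- starts in the core, its end is also coalive, hence in the core, and `r` lifts.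
        obtain ⟨w, r, s, rfl, hr, hs⟩ := path_split q (m := q.length - N) (n := N) (by omega)
        rw [← Quiver.Path.comp_assoc]
        refine hP _ _ _ _ ?_
        have hw : w.vertex ∈ coreSet V :=
          hN ⟨by simpa [hs] using alive_of_path s 0 trivial,
            coalive_antitone (Nat.le_add_right N r.length)
              (coalive_of_path r N (core_subset_coalive N hy))⟩
        obtain ⟨w', rfl, r', rfl⟩ := exists_lift_path (x := ⟨⟨i, hy⟩, d⟩) r fun n =>
          core_subset_alive n hw
        exact hm w' r' (hq'.trans_eq (hr.symm.trans (length_mapPath (coreIncl V) r')))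
      -- A path of length `N` ends at `y`; if one of length `N` also started there, `y` would be in
      -- the core. The condition is thus vacuous.
      · refine ⟨N, fun z q hq => absurd (hpath p q hp hq) hy⟩
    refine ⟨fun x v hv => key x _ ?_ ?_, fun x v => key x (fun y p => ∃ u, _ = act Y p v) ?_ ?_⟩
    · intro y z p q hp
      rw [act_comp, hp, map_zero]
    · intro y p
      obtain ⟨m, hm⟩ := h.1 y (act X p v) (by
        refine (appl_act f p v).trans ?_
        rw [hv]
        exact map_zero _)
      exact ⟨m, fun z q hq => (act_comp p _ v).trans (hm z q hq)⟩
    · rintro y z p q ⟨u, hu⟩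
      exact ⟨act X q u, by rw [appl_act, hu, act_comp]⟩
    · intro y p
      obtain ⟨m, hm⟩ := h.2 y (act Y p v)
      refine ⟨m, fun z q hq => ?_⟩
      obtain ⟨u, hu⟩ := hm z q hq
      exact ⟨u, hu.trans (act_comp p _ v).symm⟩
  · intro h
    refine ⟨fun x v hv => ?_, fun x v => ?_⟩
    · obtain ⟨m, hm⟩ := h.1 _ v hv
      exact ⟨m, fun y p hp => hm _ _ (hp.trans_eq (length_mapPath (coreIncl V) p).symm)⟩
    · obtain ⟨m, hm⟩ := h.2 _ v
      exact ⟨m, fun y p hp => hm _ _ (hp.trans_eq (length_mapPath (coreIncl V) p).symm)⟩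

end Cov

/-! ### Graded modules as representations of the covering quiver -/

section GradedRepresentations

/-- The maps `π n` recover the coordinates of a formal sum from its value, which gives independence
of the components. -/
theorem isInternal_of_projections {D : Type*} [AddCommGroup D] (P : ℤ → AddSubgroup D)
    (π : ℤ → D →+ D) (h_same : ∀ n, ∀ d ∈ P n, π n d = d)
    (h_ne : ∀ m n, m ≠ n → ∀ d ∈ P m, π n d = 0) (h_sup : ⨆ n, P n = ⊤) :
    DirectSum.IsInternal P := by
  classical
  have key : ∀ (n : ℤ) (x : DirectSum ℤ fun n => P n),
      π n (DirectSum.coeAddMonoidHom P x) = x n := by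
    intro n x
    induction x using DirectSum.induction_on with
    | zero => simp
    | of m d =>
      rw [DirectSum.coeAddMonoidHom_of]
      by_cases h : m = n
      · subst h
        rw [h_same m d d.2, DirectSum.of_eq_same]
      · rw [h_ne m n h d d.2, DirectSum.of_eq_of_ne _ _ _ (Ne.symm h)]
        rfl
    | add x y hx hy => rw [map_add, map_add, hx, hy]; rfl
  constructor
  · intro x y h
    refine DFinsupp.ext fun n => Subtype.ext ?_
    rw [← key n x, ← key n y, h]
  · intro d
    have hd : d ∈ ⨆ n, P n := h_sup ▸ trivial
    induction hd using AddSubgroup.iSup_induction' with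
    | hp n d hd => exact ⟨DirectSum.of (fun n => P n) n ⟨d, hd⟩, DirectSum.coeAddMonoidHom_of _ _ _⟩
    | h1 => exact ⟨0, map_zero _⟩
    | hadd d d' _ _ h h' =>
      obtain ⟨x, rfl⟩ := h
      obtain ⟨y, rfl⟩ := h'
      exact ⟨x + y, map_add _ _ _⟩

variable {k A : Type u} [Field k] [Ring A] [Algebra k A] {𝒜 : ℤ → Submodule k A}

namespace GrMod

/-- The underlying vector space of a graded module. -/
instance (M : GrMod 𝒜) : Module k M.carrier := Module.compHom M.carrier (algebraMap k A)

theorem field_smul_def (M : GrMod 𝒜) (c : k) (m : M.carrier) : c • m = algebraMap k A c • m := rfl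

instance (M : GrMod 𝒜) : IsScalarTower k A M.carrier where
  smul_assoc c a m := by rw [field_smul_def, Algebra.smul_def, mul_smul]

theorem lin_field_smul {M N : GrMod 𝒜} (f : M ⟶ N) (c : k) (m : M.carrier) :
    lin f (c • m) = c • lin f m := map_smul (lin f) (algebraMap k A c) m

noncomputable instance (M : GrMod 𝒜) : DirectSum.Decomposition M.component :=
  M.internal.chooseDecomposition

theorem induction (M : GrMod 𝒜) {P : M.carrier → Prop} (h0 : P 0)
    (hadd : ∀ m m', P m → P m' → P (m + m')) (hP : ∀ n, ∀ m ∈ M.component n, P m)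
    (m : M.carrier) : P m :=
  DirectSum.Decomposition.inductionOn M.component h0 (fun m => hP _ m m.2) hadd m

theorem field_smul_mem [SetLike.GradedMonoid 𝒜] (M : GrMod 𝒜) (c : k) {n : ℤ} {m : M.carrier}
    (hm : m ∈ M.component n) : c • m ∈ M.component n := by
  have : algebraMap k A c ∈ 𝒜 0 := SetLike.algebraMap_mem_graded 𝒜 c
  simpa using M.smul_mem this hm

/-- The projection of a graded module onto a homogeneous component. -/
noncomputable def proj (M : GrMod 𝒜) (n : ℤ) : M.carrier →+ M.carrier where
  toFun m := DirectSum.decompose M.component m n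
  map_zero' := by simp
  map_add' := by simp

theorem proj_mem (M : GrMod 𝒜) (n : ℤ) (m : M.carrier) : M.proj n m ∈ M.component n :=
  SetLike.coe_mem _

theorem proj_same (M : GrMod 𝒜) {n : ℤ} {m : M.carrier} (hm : m ∈ M.component n) :
    M.proj n m = m := DirectSum.decompose_of_mem_same _ hm

theorem proj_ne (M : GrMod 𝒜) {n n' : ℤ} {m : M.carrier} (hm : m ∈ M.component n) (h : n ≠ n') :
    M.proj n' m = 0 := DirectSum.decompose_of_mem_ne _ hm h

theorem proj_lin {M N : GrMod 𝒜} (f : M ⟶ N) (n : ℤ) (m : M.carrier) :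
    N.proj n (lin f m) = lin f (M.proj n m) := by
  induction m using M.induction with
  | h0 => simp
  | hadd m m' h h' => simp only [map_add, h, h']
  | hP n' m hm =>
    have hm' := Hom.map_mem f n' m hm
    by_cases h : n' = n
    · subst h
      rw [proj_same _ hm, proj_same _ hm']
    · rw [proj_ne _ hm h, proj_ne _ hm' h, map_zero]

end GrMod

variable (V : Type u) [Quiver.{u} V] (𝒜)

/-- A complete family of orthogonal idempotents, indexed by the vertices of a quiver, and elements
that are indexed by the arrows. -/
structure QuiverFamily (B : Type*) [Ring B] (V : Type u) [Quiver.{u} V] where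
  e : V → B
  arr : Arr V → B
  e_mul_self : ∀ i, e i * e i = e i
  e_mul_ne : ∀ i j, i ≠ j → e i * e j = 0
  sum_e : ∑ᶠ i, e i = 1
  e_mul_arr : ∀ a, e a.tgt * arr a = arr a
  arr_mul_e : ∀ a, arr a * e a.src = arr a

/-- A family of idempotents of degree zero and elements of degree one in a graded algebra. -/
structure VertexArrows extends QuiverFamily A V where
  e_mem : ∀ i, e i ∈ 𝒜 0
  arr_mem : ∀ a, arr a ∈ 𝒜 1

variable {V 𝒜}

namespace VertexArrows

variable (D : VertexArrows 𝒜 V)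

/-- Additive maps that commute with the vertex idempotents, the arrows and the scalars are linear. -/
def Generates : Prop := ∀ (M N : GrMod 𝒜) (f : M.carrier →ₗ[k] N.carrier),
  (∀ i m, f (D.e i • m) = D.e i • f m) → (∀ a m, f (D.arr a • m) = D.arr a • f m) →
  ∀ (x : A) m, f (x • m) = x • f m

theorem sum_e_smul [Fintype V] (M : GrMod 𝒜) (m : M.carrier) : ∑ i, D.e i • m = m := by
  rw [← Finset.sum_smul, ← finsum_eq_sum_of_fintype, D.sum_e, one_smul]

variable [SetLike.GradedMonoid 𝒜]

/-- The elements of degree `n` of a graded module at a vertex `i`. -/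
def piece (M : GrMod 𝒜) (x : Cov V) : Submodule k M.carrier where
  carrier := {m | m ∈ M.component x.deg ∧ D.e x.vertex • m = m}
  zero_mem' := ⟨zero_mem _, smul_zero _⟩
  add_mem' := fun h h' => ⟨add_mem h.1 h'.1, by rw [smul_add, h.2, h'.2]⟩
  smul_mem' := fun c m h => ⟨M.field_smul_mem c h.1, by rw [smul_comm, h.2]⟩

variable {D} in
theorem arr_smul_mem {M : GrMod 𝒜} {x y : Cov V} (a : x ⟶ y) {m : M.carrier}
    (hm : m ∈ D.piece M x) : D.arr a.1 • m ∈ D.piece M y := by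
  obtain ⟨a, h1, h2, h3⟩ := a
  change D.arr a • m ∈ _
  refine ⟨?_, ?_⟩
  · rw [h3, add_comm]
    exact M.smul_mem (D.arr_mem a) hm.1
  · rw [← h2, ← mul_smul, D.e_mul_arr]

/-- The action of an arrow on the pieces of a graded module. -/
def pieceMap (M : GrMod 𝒜) {x y : Cov V} (a : x ⟶ y) : D.piece M x →ₗ[k] D.piece M y where
  toFun m := ⟨D.arr a.1 • m.1, arr_smul_mem a m.2⟩
  map_add' _ _ := Subtype.ext (smul_add _ _ _)
  map_smul' _ _ := Subtype.ext (smul_comm _ _ _)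

/-- The representation of the covering quiver given by the pieces of a graded module. -/
def repObj (M : GrMod 𝒜) : Rep k (Cov V) := Paths.lift
  { obj := fun x => ModuleCat.of k (D.piece M x)
    map := fun a => ModuleCat.ofHom (D.pieceMap M a) }

/-- Graded modules as representations of the covering quiver. -/
def rep : GrMod 𝒜 ⥤ Rep k (Cov V) where
  obj M := D.repObj M
  map {M N} f := homOfArrows (X := D.repObj M) (Y := D.repObj N) (fun x =>
    { toFun := fun m : D.piece M x => (⟨GrMod.lin f m.1, GrMod.Hom.map_mem f _ _ m.2.1, by
        rw [← map_smul, m.2.2]⟩ : D.piece N x)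
      map_add' := fun _ _ => Subtype.ext (map_add (GrMod.lin f) _ _)
      map_smul' := fun c m => Subtype.ext (GrMod.lin_field_smul f c m.1) })
    fun a m => Subtype.ext (map_smul (GrMod.lin f) (D.arr a.1) m.1)

variable {D} in
theorem e_smul_mem {M : GrMod 𝒜} {i : V} {n : ℤ} {m : M.carrier} (hm : m ∈ M.component n) :
    D.e i • m ∈ D.piece M ⟨i, n⟩ :=
  ⟨by simpa using M.smul_mem (D.e_mem i) hm, by rw [← mul_smul, D.e_mul_self]⟩

theorem induction [Finite V] (M : GrMod 𝒜) {P : M.carrier → Prop} (h0 : P 0)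
    (hadd : ∀ m m', P m → P m' → P (m + m')) (hP : ∀ x, ∀ m ∈ D.piece M x, P m)
    (m : M.carrier) : P m := by
  have := Fintype.ofFinite V
  induction m using M.induction with
  | h0 => exact h0
  | hadd m m' h h' => exact hadd m m' h h'
  | hP n m hm =>
    rw [← D.sum_e_smul M m]
    exact Finset.sum_induction _ P hadd h0 fun i _ => hP ⟨i, n⟩ _ (e_smul_mem hm)

instance [Finite V] : D.rep.Faithful where
  map_injective {M N} f g h := by
    refine GrMod.Hom.ext (LinearMap.ext fun m => ?_)
    induction m using D.induction M with
    | h0 => simp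
    | hadd m m' h h' => simp only [map_add, h, h']
    | hP x m hm =>
      exact congrArg Subtype.val (congrArg (fun φ => appl φ x (⟨m, hm⟩ : D.piece M x)) h)

theorem exists_extend [Finite V] {M N : GrMod 𝒜} (g : ∀ x, D.piece M x →ₗ[k] D.piece N x) :
    ∃ f : M.carrier →ₗ[k] N.carrier, ∀ x (m : D.piece M x), f m.1 = (g x m).1 := by
  classical
  have := Fintype.ofFinite V
  -- In degree `n` the extension is `m ↦ ∑ i, g (e_i m)`. It is built additively first, because the
  -- components are only additive subgroups; scalars are treated at the end.
  let G : ∀ n : ℤ, M.component n →+ N.carrier := fun n =>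
    ∑ i : V, (D.piece N ⟨i, n⟩).subtype.toAddMonoidHom.comp
      ((g ⟨i, n⟩).toAddMonoidHom.comp
        { toFun := fun m => ⟨D.e i • m.1, e_smul_mem m.2⟩
          map_zero' := Subtype.ext (smul_zero _)
          map_add' := fun _ _ => Subtype.ext (smul_add _ _ _) })
  let F : M.carrier →+ N.carrier := (DirectSum.toAddMonoid G).comp
    (DirectSum.decomposeAddEquiv M.component).toAddMonoidHom
  have hF : ∀ x (m : D.piece M x), F m.1 = (g x m).1 := by
    rintro ⟨i, n⟩ ⟨m, hm⟩
    change DirectSum.toAddMonoid G (DirectSum.decompose M.component m) = _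
    rw [DirectSum.decompose_of_mem _ hm.1, DirectSum.toAddMonoid_of]
    simp only [G, AddMonoidHom.finsetSum_apply]
    rw [Finset.sum_eq_single_of_mem i (Finset.mem_univ _)]
    · exact congrArg (fun m => (g ⟨i, n⟩ m).1) (Subtype.ext hm.2)
    · intro j _ hj
      have h0 : D.e j • m = 0 := by
        have : D.e i • m = m := hm.2
        rw [← this, ← mul_smul, D.e_mul_ne j i hj, zero_smul]
      refine (congrArg (fun m => (g ⟨j, n⟩ m).1) (a₂ := 0) (Subtype.ext h0)).trans ?_
      simp
  refine ⟨{ F with map_smul' := fun c m => ?_ }, hF⟩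
  change F (c • m) = c • F m
  induction m using D.induction M with
  | h0 => simp
  | hadd m m' h h' => simp only [map_add, smul_add, h, h']
  | hP x m hm =>
    have h1 := hF x ⟨m, hm⟩
    have h2 := hF x (c • ⟨m, hm⟩)
    rw [map_smul] at h2
    exact h2.trans (congrArg (c • ·) h1.symm)

/-- A graded module is the direct sum of its pieces, so a morphism of representations extends to a
linear map. It commutes with idempotents and arrows piece by piece, and `Generates` upgrades this to
linearity over `A`. -/
theorem full_rep [Finite V] (hD : D.Generates) : D.rep.Full where
  map_surjective {M N} φ := by
    obtain ⟨f, hf⟩ := D.exists_extend (M := M) (N := N) (fun x => appl φ x)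
    have hmem : ∀ x, ∀ m ∈ D.piece M x, f m ∈ D.piece N x := fun x m hm => by
      rw [hf x ⟨m, hm⟩]
      exact SetLike.coe_mem _
    have he : ∀ i m, f (D.e i • m) = D.e i • f m := by
      intro i m
      induction m using D.induction M with
      | h0 => simp
      | hadd m m' h h' => simp only [map_add, smul_add, h, h']
      | hP x m hm =>
        by_cases h : i = x.vertex
        · rw [h, hm.2, (hmem x m hm).2]
        · rw [← hm.2, ← mul_smul, D.e_mul_ne _ _ h, zero_smul, map_zero, hm.2,
            ← (hmem x m hm).2, ← mul_smul, D.e_mul_ne _ _ h, zero_smul]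
    have ha : ∀ a m, f (D.arr a • m) = D.arr a • f m := by
      intro a m
      induction m using D.induction M with
      | h0 => simp
      | hadd m m' h h' => simp only [map_add, smul_add, h, h']
      | hP x m hm =>
        by_cases h : a.src = x.vertex
        · let b : x ⟶ (⟨a.tgt, x.deg + 1⟩ : Cov V) := ⟨a, h, rfl, rfl⟩
          have h1 := appl_act φ b.toPath (⟨m, hm⟩ : D.piece M x)
          have h2 := hf x ⟨m, hm⟩
          have h3 := hf _ (D.pieceMap M b ⟨m, hm⟩)
          exact h3.trans ((congrArg Subtype.val h1).trans (congrArg (D.arr a • ·) h2.symm))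
        -- An arrow that does not start at the vertex of `x` annihilates the piece at `x`, since `a
        -- = a e_{s(a)}`.
        · have h0 : D.e a.src • m = 0 := by rw [← hm.2, ← mul_smul, D.e_mul_ne _ _ h, zero_smul]
          rw [← D.arr_mul_e, mul_smul, mul_smul, ← he, h0, smul_zero, map_zero, smul_zero]
    let F : M.carrier →ₗ[A] N.carrier := { f with map_smul' := hD M N f he ha }
    have hFmem : ∀ n, ∀ m ∈ M.component n, F m ∈ N.component n := by
      intro n m hm
      have := Fintype.ofFinite V
      rw [← D.sum_e_smul M m, map_sum]
      exact sum_mem fun i _ => (hmem ⟨i, n⟩ _ (e_smul_mem hm)).1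
    exact ⟨⟨F, hFmem⟩, appl_ext fun x m => Subtype.ext (hf x m)⟩

end VertexArrows

/-! ### Graded modules from representations -/

/-- The value of a representation at a vertex. -/
def Fiber (X : Rep k (Cov V)) (x : Cov V) : Type u := X.obj x

instance (X : Rep k (Cov V)) (x : Cov V) : AddCommGroup (Fiber X x) :=
  inferInstanceAs (AddCommGroup (X.obj x))

instance (X : Rep k (Cov V)) (x : Cov V) : Module k (Fiber X x) :=
  inferInstanceAs (Module k (X.obj x))

/-- The total space of a representation of the covering quiver. -/
abbrev Total (X : Rep k (Cov V)) : Type u := DirectSum (Cov V) (Fiber X)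

open Classical in
/-- The inclusion of a component of the total space. -/
noncomputable def inTotal (X : Rep k (Cov V)) (x : Cov V) : X.obj x →ₗ[k] Total X :=
  DirectSum.lof k (Cov V) (Fiber X) x

theorem Total.induction {X : Rep k (Cov V)} {P : Total X → Prop} (h0 : P 0)
    (hadd : ∀ d d', P d → P d' → P (d + d')) (hP : ∀ x v, P (inTotal X x v)) (d : Total X) :
    P d := by
  classical
  exact DirectSum.induction_on d h0 (fun x v => hP x v) hadd

/-- The elements of degree `n` of the total space. -/
def totalComponent (X : Rep k (Cov V)) (n : ℤ) : AddSubgroup (Total X) where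
  carrier := {d | ∀ x : Cov V, x.deg ≠ n → d x = 0}
  zero_mem' := fun _ _ => rfl
  add_mem' := fun {d d'} h h' x hx => by rw [DirectSum.add_apply, h x hx, h' x hx, add_zero]
  neg_mem' := fun {d} h x hx => by
    change -(d x) = 0
    rw [h x hx, neg_zero]

theorem inTotal_mem (X : Rep k (Cov V)) (x : Cov V) (v : X.obj x) :
    inTotal X x v ∈ totalComponent X x.deg := fun y hy => by
  classical
  exact DirectSum.of_eq_of_ne _ _ _ (fun h => hy (by rw [h]))

theorem inTotal_apply_same (X : Rep k (Cov V)) (x : Cov V) (v : X.obj x) : inTotal X x v x = v := by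
  classical
  exact DirectSum.of_eq_same _ _

theorem inTotal_apply_ne (X : Rep k (Cov V)) {x y : Cov V} (h : y ≠ x) (v : X.obj x) :
    inTotal X x v y = 0 := by
  classical
  exact DirectSum.of_eq_of_ne _ _ _ h

theorem isInternal_totalComponent (X : Rep k (Cov V)) :
    DirectSum.IsInternal (totalComponent X) := by
  classical
  refine isInternal_of_projections _
    (fun n => DFinsupp.filterAddMonoidHom (Fiber X) (fun x => x.deg = n)) ?_ ?_ ?_
  · intro n d hd
    refine DFinsupp.ext fun x => ?_
    refine (DFinsupp.filter_apply _ x d).trans ?_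
    split_ifs with h
    · rfl
    · exact (hd x h).symm
  · intro m n hmn d hd
    refine DFinsupp.ext fun x => ?_
    refine (DFinsupp.filter_apply _ x d).trans ?_
    split_ifs with h
    · exact hd x fun h' => hmn (h'.symm.trans h)
    · rfl
  · refine eq_top_iff.2 fun d _ => ?_
    induction d using Total.induction with
    | h0 => exact zero_mem _
    | hadd d d' h h' => exact add_mem (h trivial) (h' trivial)
    | hP x v => exact AddSubgroup.mem_iSup_of_mem x.deg (inTotal_mem X x v)

/-- The operators of degree `m` on the total space. -/
def degreeOps (X : Rep k (Cov V)) (m : ℤ) : Submodule k (Module.End k (Total X)) where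
  carrier := {f | ∀ x v, f (inTotal X x v) ∈ totalComponent X (m + x.deg)}
  zero_mem' := fun _ _ => zero_mem _
  add_mem' := fun h h' x v => add_mem (h x v) (h' x v)
  smul_mem' := fun c f h x v => by
    have := h x (c • v)
    rwa [map_smul, map_smul] at this

theorem degreeOps_apply {X : Rep k (Cov V)} {m n : ℤ} {f : Module.End k (Total X)}
    (hf : f ∈ degreeOps X m) {d : Total X} (hd : d ∈ totalComponent X n) :
    f d ∈ totalComponent X (m + n) := by
  classical
  rw [← DirectSum.sum_support_of d, map_sum]
  refine sum_mem fun x hx => ?_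
  have : x.deg = n := by
    by_contra h
    exact DFinsupp.mem_support_iff.1 hx (hd x h)
  rw [← this]
  exact hf x (d x)

theorem degreeOps_mul {X : Rep k (Cov V)} {m n : ℤ} {f g : Module.End k (Total X)}
    (hf : f ∈ degreeOps X m) (hg : g ∈ degreeOps X n) : f * g ∈ degreeOps X (m + n) :=
  fun x v => by
    rw [add_assoc]
    exact degreeOps_apply hf (hg x v)

theorem degreeOps_one (X : Rep k (Cov V)) : 1 ∈ degreeOps X 0 := fun x v => by
  rw [zero_add]
  exact inTotal_mem X x v

/-- The graded module that is given by an action of the algebra on a total space. -/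
noncomputable def ofAction (X : Rep k (Cov V)) (ρ : A →ₐ[k] Module.End k (Total X))
    (hρ : ∀ {n : ℤ} {a : A}, a ∈ 𝒜 n → ρ a ∈ degreeOps X n) :
    GrMod 𝒜 where
  carrier := Total X
  module := Module.compHom (Total X) ρ.toRingHom
  component := totalComponent X
  internal := isInternal_totalComponent X
  smul_mem ha hd := degreeOps_apply (hρ ha) hd

variable [SetLike.GradedMonoid 𝒜]

/-- The common source of essential surjectivity for `kQ` and `L`: any action on the total space in
which vertices and arrows act in the standard way recovers `X` from its pieces. -/
theorem rep_ofAction (D : VertexArrows 𝒜 V) (X : Rep k (Cov V))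
    (ρ : A →ₐ[k] Module.End k (Total X))
    (hρ : ∀ {n : ℤ} {a : A}, a ∈ 𝒜 n → ρ a ∈ degreeOps X n)
    (h_same : ∀ x v, ρ (D.e x.vertex) (inTotal X x v) = inTotal X x v)
    (h_ne : ∀ i x v, i ≠ x.vertex → ρ (D.e i) (inTotal X x v) = 0)
    (h_arr : ∀ {x y : Cov V} (a : x ⟶ y) v,
      ρ (D.arr a.1) (inTotal X x v) = inTotal X y (act X a.toPath v)) :
    Nonempty (D.rep.obj (ofAction (𝒜 := 𝒜) X ρ hρ) ≅ X) := by
  let M : GrMod 𝒜 := ofAction X ρ hρ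
  have hmem : ∀ x v, (inTotal X x v : M.carrier) ∈ D.piece M x := fun x v =>
    ⟨inTotal_mem X x v, h_same x v⟩
  -- The scalars act on the graded module through `A`, and on the total space componentwise; the two
  -- structures agree.
  have hk : ∀ (c : k) (d : Total X), ρ (algebraMap k A c) d = c • d := by
    intro c d
    rw [AlgHom.commutes]
    rfl
  let φ : X ⟶ D.repObj M := homOfArrows (X := X) (Y := D.repObj M)
    (fun x =>
      { toFun := fun v => (⟨inTotal X x v, hmem x v⟩ : D.piece M x)
        map_add' := fun v w => Subtype.ext (map_add (inTotal X x) v w)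
        map_smul' := fun c v => Subtype.ext ((map_smul (inTotal X x) c v).trans (hk c _).symm) })
    fun {x y} a v => Subtype.ext (h_arr a v).symm
  have : IsIso φ := by
    refine isIso_of_bijective φ fun x => ⟨fun v w h => ?_, fun d => ?_⟩
    · have h' : inTotal X x v = inTotal X x w := congrArg Subtype.val h
      rw [← inTotal_apply_same X x v, h', inTotal_apply_same]
    · obtain ⟨d, hd, hd'⟩ := d
      change Total X at d
      refine ⟨d x, Subtype.ext (DFinsupp.ext fun y => ?_)⟩
      change inTotal X x (d x) y = d y
      by_cases h : y = x
      · subst h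
        exact inTotal_apply_same X y _
      · refine (inTotal_apply_ne X h (d x)).trans ?_
        by_cases hdeg : y.deg = x.deg
        · have hv : y.vertex ≠ x.vertex := fun hv => h (Cov.ext hv hdeg)
          -- The image of the idempotent at the vertex of `x` has no component over another vertex,
          -- and `d` is fixed by this idempotent.
          have key : ∀ d : Total X, (ρ (D.e x.vertex) d) y = 0 := by
            intro d
            induction d using Total.induction with
            | h0 => rw [map_zero]; rfl
            | hadd d d' h h' => rw [map_add, DirectSum.add_apply, h, h', add_zero]
            | hP z v =>
              by_cases hz : x.vertex = z.vertex
              · rw [hz, h_same]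
                refine inTotal_apply_ne X (fun hyz => hv ?_) v
                rw [hyz, hz]
              · rw [h_ne _ _ _ hz]; rfl
          exact (key d).symm.trans (congrArg (fun d : Total X => d y) hd')
        · exact (hd y hdeg).symm
  exact ⟨(asIso φ).symm⟩

/-! ### The standard operators on a total space -/

theorem Total.hom_ext {X : Rep k (Cov V)} {f g : Module.End k (Total X)}
    (h : ∀ x v, f (inTotal X x v) = g (inTotal X x v)) : f = g := by
  refine LinearMap.ext fun d => ?_
  induction d using Total.induction with
  | h0 => rw [map_zero, map_zero]
  | hadd d d' h h' => rw [map_add, map_add, h, h']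
  | hP x v => exact h x v

/-- The operator with prescribed values on the components of the total space. -/
noncomputable def Total.lift {X : Rep k (Cov V)} (g : ∀ x : Cov V, X.obj x →ₗ[k] Total X) :
    Module.End k (Total X) := by
  classical
  exact DirectSum.toModule k (Cov V) (Total X) (φ := fun x => (g x : Fiber X x →ₗ[k] Total X))

theorem Total.lift_apply {X : Rep k (Cov V)} (g : ∀ x : Cov V, X.obj x →ₗ[k] Total X) (x : Cov V)
    (v : X.obj x) : Total.lift g (inTotal X x v) = g x v := by
  classical
  exact DirectSum.toModule_lof (M := Fiber X) k x v

open Classical in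
/-- The projection of the total space onto the components at a vertex. -/
noncomputable def vertexOp (X : Rep k (Cov V)) (i : V) : Module.End k (Total X) :=
  Total.lift fun x => if i = x.vertex then inTotal X x else 0

theorem vertexOp_same (X : Rep k (Cov V)) (x : Cov V) (v : X.obj x) :
    vertexOp X x.vertex (inTotal X x v) = inTotal X x v := by
  rw [vertexOp, Total.lift_apply, if_pos rfl]

theorem vertexOp_ne (X : Rep k (Cov V)) {i : V} {x : Cov V} (h : i ≠ x.vertex) (v : X.obj x) :
    vertexOp X i (inTotal X x v) = 0 := by
  rw [vertexOp, Total.lift_apply, if_neg h]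
  rfl

theorem vertexOp_mem (X : Rep k (Cov V)) (i : V) : vertexOp X i ∈ degreeOps X 0 := fun x v => by
  by_cases h : i = x.vertex
  · rw [h, vertexOp_same, zero_add]
    exact inTotal_mem X x v
  · rw [vertexOp_ne X h]
    exact zero_mem _

/-- The arrow of the covering quiver that starts at a vertex and lies over a given arrow. -/
def covArrow (a : Arr V) (x : Cov V) (h : a.src = x.vertex) : x ⟶ (⟨a.tgt, x.deg + 1⟩ : Cov V) :=
  ⟨a, h, rfl, rfl⟩

open Classical in
/-- The action of an arrow on the total space. -/
noncomputable def arrowOp (X : Rep k (Cov V)) (a : Arr V) : Module.End k (Total X) :=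
  Total.lift fun x =>
    if h : a.src = x.vertex then (inTotal X _).comp (act X (covArrow a x h).toPath) else 0

theorem arrowOp_apply (X : Rep k (Cov V)) {x y : Cov V} (a : x ⟶ y) (v : X.obj x) :
    arrowOp X a.1 (inTotal X x v) = inTotal X y (act X a.toPath v) := by
  rw [arrowOp, Total.lift_apply, dif_pos a.2.1]
  obtain ⟨a, h1, h2, h3⟩ := a
  obtain rfl : y = ⟨a.tgt, x.deg + 1⟩ := Cov.ext h2.symm h3
  rfl

theorem arrowOp_ne (X : Rep k (Cov V)) {a : Arr V} {x : Cov V} (h : a.src ≠ x.vertex)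
    (v : X.obj x) : arrowOp X a (inTotal X x v) = 0 := by
  rw [arrowOp, Total.lift_apply, dif_neg h]
  rfl

theorem arrowOp_covArrow (X : Rep k (Cov V)) {a : Arr V} {x : Cov V} (h : a.src = x.vertex)
    (v : X.obj x) : arrowOp X a (inTotal X x v) =
      inTotal X ⟨a.tgt, x.deg + 1⟩ (act X (covArrow a x h).toPath v) :=
  arrowOp_apply X (covArrow a x h) v

theorem arrowOp_mem (X : Rep k (Cov V)) (a : Arr V) : arrowOp X a ∈ degreeOps X 1 := fun x v => by
  by_cases h : a.src = x.vertex
  · rw [arrowOp_covArrow X h, add_comm]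
    exact inTotal_mem X ⟨a.tgt, x.deg + 1⟩ _
  · rw [arrowOp_ne X h]
    exact zero_mem _

/-- The vertices and arrows as operators on the total space of a representation. -/
noncomputable def totalFamily [Finite V] (X : Rep k (Cov V)) :
    QuiverFamily (Module.End k (Total X)) V where
  e := vertexOp X
  arr := arrowOp X
  e_mul_self i := Total.hom_ext fun x v => by
    rw [Module.End.mul_apply]
    by_cases h : i = x.vertex
    · rw [h, vertexOp_same, vertexOp_same]
    · rw [vertexOp_ne X h, map_zero]
  e_mul_ne i j hij := Total.hom_ext fun x v => by
    rw [Module.End.mul_apply]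
    by_cases h : j = x.vertex
    · rw [h, vertexOp_same, vertexOp_ne X (h ▸ hij)]
      rfl
    · rw [vertexOp_ne X h, map_zero]
      rfl
  sum_e := Total.hom_ext fun x v => by
    have := Fintype.ofFinite V
    rw [finsum_eq_sum_of_fintype, LinearMap.sum_apply,
      Finset.sum_eq_single_of_mem x.vertex (Finset.mem_univ _), vertexOp_same]
    · rfl
    · exact fun i _ hi => vertexOp_ne X hi v
  e_mul_arr a := Total.hom_ext fun x v => by
    rw [Module.End.mul_apply]
    by_cases h : a.src = x.vertex
    · rw [arrowOp_covArrow X h]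
      exact vertexOp_same X ⟨a.tgt, x.deg + 1⟩ _
    · rw [arrowOp_ne X h, map_zero]
  arr_mul_e a := Total.hom_ext fun x v => by
    rw [Module.End.mul_apply]
    by_cases h : a.src = x.vertex
    · rw [h, vertexOp_same]
    · rw [vertexOp_ne X h, map_zero, arrowOp_ne X h]

end GradedRepresentations

/-! ### Values of paths -/

namespace QuiverFamily

variable {B : Type*} [Ring B] {V : Type u} [Quiver.{u} V] (F : QuiverFamily B V)

/-- The product of the arrows of a path. -/
def pathVal {i : V} : ∀ {j : V}, Quiver.Path i j → B
  | _, .nil => F.e i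
  | _, .cons p a => F.arr ⟨_, _, a⟩ * pathVal p

theorem e_mul_pathVal {i j : V} (p : Quiver.Path i j) : F.e j * F.pathVal p = F.pathVal p := by
  cases p with
  | nil => exact F.e_mul_self i
  | cons p a =>
    rw [pathVal, ← mul_assoc]
    congr 1
    exact F.e_mul_arr ⟨_, _, a⟩

theorem pathVal_mul_e {i j : V} (p : Quiver.Path i j) : F.pathVal p * F.e i = F.pathVal p := by
  induction p with
  | nil => exact F.e_mul_self i
  | cons p a ih => rw [pathVal, mul_assoc, ih]

theorem pathVal_comp {i j l : V} (p : Quiver.Path i j) (q : Quiver.Path j l) :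
    F.pathVal (p.comp q) = F.pathVal q * F.pathVal p := by
  induction q with
  | nil => exact (F.e_mul_pathVal p).symm
  | cons q a ih => rw [Quiver.Path.comp_cons, pathVal, ih, pathVal, mul_assoc]

theorem pathVal_toPath {i j : V} (a : i ⟶ j) : F.pathVal a.toPath = F.arr ⟨i, j, a⟩ :=
  F.arr_mul_e ⟨i, j, a⟩

theorem pathVal_mul_pathVal_ne {i j i' j' : V} (p : Quiver.Path i j) (q : Quiver.Path i' j')
    (h : j ≠ i') : F.pathVal q * F.pathVal p = 0 := by
  rw [← F.pathVal_mul_e q, ← F.e_mul_pathVal p, mul_assoc, ← mul_assoc (F.e i'),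
    F.e_mul_ne _ _ h.symm, zero_mul, mul_zero]

end QuiverFamily

/-! ### Graded modules over the path algebra -/

section PathAlgebraModules

variable (k : Type u) [Field k] {V : Type u} [Quiver.{u} V]

instance [Finite V] [∀ i j : V, Finite (i ⟶ j)] (n : ℕ) : Finite (PthN V n) := by
  induction n with
  | zero =>
    refine Finite.of_injective (fun p : PthN V 0 => p.1.src) ?_
    rintro ⟨⟨i, j, p⟩, hp⟩ ⟨⟨i', j', p'⟩, hp'⟩ h
    obtain rfl : i = i' := h
    cases p with
    | nil =>
      cases p' with
      | nil => rfl
      | cons p' a => exact absurd hp' (Nat.succ_ne_zero _)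
    | cons p a => exact absurd hp (Nat.succ_ne_zero _)
  | succ n ih =>
    refine Finite.of_injective (fun p : PthN V (n + 1) => (lastArrow p, initPath p)) ?_
    intro p q h
    rw [← consPath_init p, ← consPath_init q]
    have h1 : lastArrow p = lastArrow q := congrArg Prod.fst h
    have h2 : initPath p = initPath q := congrArg Prod.snd h
    have : ∀ (a b : Arr V) (p q : PthN V n) (ha : p.1.tgt = a.src) (hb : q.1.tgt = b.src),
        a = b → p = q → consPath a p ha = consPath b q hb := by
      rintro a b p q ha hb rfl rfl
      rfl
    exact this _ _ _ _ _ _ h1 h2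

instance [Finite V] [∀ i j : V, Finite (i ⟶ j)] (n : ℕ) : Finite {p : Pth V // p.length < n} :=
  Finite.of_injective (fun p => (⟨⟨p.1.length, p.2⟩, ⟨p.1, rfl⟩⟩ : Σ m : Fin n, PthN V m)) (by
    rintro ⟨p, hp⟩ ⟨q, hq⟩ h
    have h1 : (⟨p.length, hp⟩ : Fin n) = ⟨q.length, hq⟩ := congrArg Sigma.fst h
    have : ∀ (m m' : Fin n) (p : PthN V m) (q : PthN V m'),
        (⟨m, p⟩ : Σ m : Fin n, PthN V m) = ⟨m', q⟩ → p.1 = q.1 := by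
      rintro m m' p q h
      cases h
      rfl
    exact Subtype.ext (this _ _ _ _ h))

/-- An arrow as a path. -/
def Arr.toPth (a : Arr V) : Pth V := ⟨a.src, a.tgt, a.hom.toPath⟩

variable (V) in
/-- The vertices and arrows in the path algebra. -/
noncomputable def pathFamily [Finite V] : VertexArrows (pathGrade k V) V where
  e i := ofPth k (Pth.nil i)
  arr a := ofPth k a.toPth
  e_mul_self i := by rw [ofPth_mul_of_eq k rfl]; exact congrArg _ (Pth.nil_comp (Pth.nil i))
  e_mul_ne i j h := ofPth_mul_of_ne k (Ne.symm h)
  sum_e := rfl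
  e_mul_arr a := by rw [ofPth_mul_of_eq k rfl]; exact congrArg _ (Pth.nil_comp a.toPth)
  arr_mul_e a := by rw [ofPth_mul_of_eq k rfl]; exact congrArg _ (Pth.comp_nil a.toPth)
  e_mem i := ofPth_mem_pathGrade k (Pth.nil i)
  arr_mem a := ofPth_mem_pathGrade k a.toPth

theorem ofPth_cons {i j l : V} (p : Quiver.Path i j) (a : j ⟶ l) :
    ofPth k (⟨i, l, p.cons a⟩ : Pth V) =
      ofPth k (Arr.toPth ⟨j, l, a⟩) * ofPth k (⟨i, j, p⟩ : Pth V) := by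
  rw [ofPth_mul_of_eq k rfl]
  rfl

variable {k} in
/-- The homomorphism out of the path algebra that is given by a family. -/
noncomputable def pathLift [Finite V] {B : Type u} [Ring B] [Algebra k B] (F : QuiverFamily B V) :
    PathAlgebra k V →ₐ[k] B :=
  AlgHom.ofLinearMap (PathAlgebra.lift k fun p => F.pathVal p.path)
    (by
      have := Fintype.ofFinite V
      change PathAlgebra.lift k _ (∑ᶠ v : V, ofPth k (Pth.nil v)) = 1
      rw [finsum_eq_sum_of_fintype, map_sum, ← F.sum_e, finsum_eq_sum_of_fintype]
      exact Finset.sum_congr rfl fun i _ => PathAlgebra.lift_of _ _)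
    (by
      have key : ∀ p q : Pth V, PathAlgebra.lift k (fun p => F.pathVal p.path)
          (ofPth k p * ofPth k q) = F.pathVal p.path * F.pathVal q.path := by
        rintro ⟨i, j, p⟩ ⟨i', j', q⟩
        by_cases h : j' = i
        · subst h
          rw [ofPth_mul_of_eq k rfl, PathAlgebra.lift_of]
          exact F.pathVal_comp q p
        · rw [ofPth_mul_of_ne k h, map_zero, F.pathVal_mul_pathVal_ne q p h]
      intro x y
      induction x using PathAlgebra.induction with
      | h0 => rw [zero_mul, map_zero, zero_mul]
      | hadd x x' h h' => rw [add_mul, map_add, map_add, add_mul, h, h']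
      | hsmul c p =>
        induction y using PathAlgebra.induction with
        | h0 => rw [mul_zero, map_zero, mul_zero]
        | hadd y y' h h' => rw [mul_add, map_add, map_add, mul_add, h, h']
        | hsmul d q =>
          rw [smul_mul_smul_comm, map_smul, map_smul, map_smul, key, PathAlgebra.lift_of,
            PathAlgebra.lift_of, smul_mul_smul_comm])

theorem pathLift_ofPth [Finite V] {B : Type u} [Ring B] [Algebra k B] (F : QuiverFamily B V)
    (p : Pth V) : pathLift (k := k) F (ofPth k p) = F.pathVal p.path := PathAlgebra.lift_of _ _

theorem pathFamily_generates [Finite V] : (pathFamily k V).Generates := by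
  intro M N f he ha x m
  induction x using PathAlgebra.induction with
  | h0 => rw [zero_smul, zero_smul, map_zero]
  | hadd x y h h' => rw [add_smul, add_smul, map_add, h, h']
  | hsmul c p =>
    rw [smul_assoc, smul_assoc, map_smul]
    congr 1
    obtain ⟨i, j, p⟩ := p
    induction p with
    | nil => exact he i m
    | @cons j l p a ih =>
      rw [ofPth_cons, mul_smul, mul_smul]
      exact (ha ⟨j, l, a⟩ _).trans (congrArg _ ih)

instance [Finite V] : (pathFamily k V).rep.Full := (pathFamily k V).full_rep (pathFamily_generates k)

instance [Finite V] : (pathFamily k V).rep.EssSurj where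
  mem_essImage X := by
    have hdeg : ∀ p : Pth V, (totalFamily X).pathVal p.path ∈ degreeOps X p.length := by
      rintro ⟨i, j, p⟩
      induction p with
      | nil => exact vertexOp_mem X i
      | cons p a ih =>
        have := degreeOps_mul (arrowOp_mem X ⟨_, _, a⟩) ih
        rwa [add_comm] at this
    refine ⟨_, rep_ofAction (pathFamily k V) X (pathLift (totalFamily X)) ?_ ?_ ?_ ?_⟩
    · intro n a ha
      induction ha using Submodule.span_induction with
      | mem a ha =>
        obtain ⟨p, rfl, rfl⟩ := ha
        rw [pathLift_ofPth]
        exact hdeg p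
      | zero => rw [map_zero]; exact zero_mem _
      | add a b _ _ h h' => rw [map_add]; exact add_mem h h'
      | smul c a _ h => rw [map_smul]; exact Submodule.smul_mem _ c h
    · intro x v
      exact (congrArg (fun f => f (inTotal X x v)) (pathLift_ofPth k (totalFamily X) (Pth.nil x.vertex))).trans
        (vertexOp_same X x v)
    · intro i x v h
      exact (congrArg (fun f => f (inTotal X x v)) (pathLift_ofPth k (totalFamily X) (Pth.nil i))).trans
        (vertexOp_ne X h v)
    · intro x y a v
      refine (congrArg (fun f => f (inTotal X x v)) (pathLift_ofPth k (totalFamily X) _)).trans ?_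
      exact (congrArg (fun f => f (inTotal X x v)) ((totalFamily X).pathVal_toPath a.1.hom)).trans
        (arrowOp_apply X a v)

instance [Finite V] : (pathFamily k V).rep.IsEquivalence where

end PathAlgebraModules

/-! ### Kernels and cokernels of graded modules -/

section KernelCokernel

variable {k A : Type u} [Field k] [Ring A] [Algebra k A] {𝒜 : ℤ → Submodule k A}

namespace GrMod

theorem exists_sum_proj (M : GrMod 𝒜) (m : M.carrier) :
    ∃ s : Finset ℤ, ∑ n ∈ s, M.proj n m = m := by
  classical
  exact ⟨_, DirectSum.sum_support_decompose M.component m⟩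

/-- The kernel of a morphism of graded modules. -/
noncomputable def ker {M N : GrMod 𝒜} (f : M ⟶ N) : GrMod 𝒜 where
  carrier := LinearMap.ker (lin f)
  component n := (M.component n).comap (LinearMap.ker (lin f)).subtype.toAddMonoidHom
  internal := by
    let π : ℤ → LinearMap.ker (lin f) →+ LinearMap.ker (lin f) := fun n =>
      { toFun := fun m => ⟨M.proj n m.1, by
          rw [LinearMap.mem_ker, ← proj_lin, LinearMap.mem_ker.1 m.2, map_zero]⟩
        map_zero' := Subtype.ext (map_zero _)
        map_add' := fun m m' => Subtype.ext (map_add _ _ _) }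
    refine isInternal_of_projections _ π (fun n m hm => Subtype.ext (M.proj_same hm))
      (fun n n' h m hm => Subtype.ext (M.proj_ne hm h)) (eq_top_iff.2 fun m _ => ?_)
    obtain ⟨s, hs⟩ := M.exists_sum_proj m.1
    have : ∑ n ∈ s, π n m = m := Subtype.ext (by
      rw [AddSubmonoidClass.coe_finsetSum]
      exact hs)
    rw [← this]
    exact sum_mem fun n _ => AddSubgroup.mem_iSup_of_mem n (M.proj_mem n m.1)
  smul_mem ha hm := M.smul_mem ha hm

/-- The cokernel of a morphism of graded modules. -/
noncomputable def coker {M N : GrMod 𝒜} (f : M ⟶ N) : GrMod 𝒜 where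
  carrier := N.carrier ⧸ LinearMap.range (lin f)
  component n := (N.component n).map (LinearMap.range (lin f)).mkQ.toAddMonoidHom
  internal := by
    let π : ℤ → N.carrier ⧸ LinearMap.range (lin f) →+ N.carrier ⧸ LinearMap.range (lin f) :=
      fun n => QuotientAddGroup.lift (LinearMap.range (lin f)).toAddSubgroup
        ((LinearMap.range (lin f)).mkQ.toAddMonoidHom.comp (N.proj n)) (by
          rintro _ ⟨m, rfl⟩
          refine (Submodule.Quotient.mk_eq_zero _).2 ?_
          rw [proj_lin]
          exact ⟨_, rfl⟩)
    have hπ : ∀ n m, π n ((LinearMap.range (lin f)).mkQ m) =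
        (LinearMap.range (lin f)).mkQ (N.proj n m) := fun n m => rfl
    refine isInternal_of_projections _ π ?_ ?_ (eq_top_iff.2 fun m _ => ?_)
    · rintro n _ ⟨m, hm, rfl⟩
      exact (hπ n m).trans (congrArg _ (N.proj_same hm))
    · rintro n n' h _ ⟨m, hm, rfl⟩
      exact (hπ n' m).trans ((congrArg _ (N.proj_ne hm h)).trans (map_zero _))
    · obtain ⟨m, rfl⟩ := Submodule.mkQ_surjective _ m
      obtain ⟨s, hs⟩ := N.exists_sum_proj m
      rw [← hs, map_sum]
      exact sum_mem fun n _ => AddSubgroup.mem_iSup_of_mem n ⟨_, N.proj_mem n m, rfl⟩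
  smul_mem := by
    rintro i j a _ ha ⟨m, hm, rfl⟩
    exact ⟨a • m, N.smul_mem ha hm, map_smul (LinearMap.range (lin f)).mkQ a m⟩

theorem proj_field_smul [SetLike.GradedMonoid 𝒜] (M : GrMod 𝒜) (n : ℤ) (c : k) (m : M.carrier) :
    M.proj n (c • m) = c • M.proj n m := by
  induction m using M.induction with
  | h0 => simp
  | hadd m m' h h' => simp only [map_add, smul_add, h, h']
  | hP n' m hm =>
    by_cases h : n' = n
    · subst h
      rw [M.proj_same hm, M.proj_same (M.field_smul_mem c hm)]
    · rw [M.proj_ne hm h, M.proj_ne (M.field_smul_mem c hm) h, smul_zero]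

/-- The elements `m` such that all elements of `Am` vanish in large degrees. -/
theorem exists_bound_of_isFdim [SetLike.GradedMonoid 𝒜] (M : GrMod 𝒜)
    (h : IsFdim k A M.carrier) (m : M.carrier) :
    ∃ b : ℤ, ∀ (x : A) (n : ℤ), b ≤ n → M.proj n (x • m) = 0 := by
  have hm : m ∈ (⊤ : Submodule A M.carrier) := trivial
  rw [← show _ = ⊤ from h, sSup_eq_iSup'] at hm
  induction hm using Submodule.iSup_induction' with
  | mem N m hm =>
    obtain ⟨N, hN⟩ := N
    obtain ⟨s, hs⟩ := hN.fg_top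
    have hb : ∀ m : M.carrier, ∃ b : ℤ, ∀ n, b ≤ n → M.proj n m = 0 := by
      intro m
      induction m using M.induction with
      | h0 => exact ⟨0, fun n _ => map_zero _⟩
      | hadd m m' h h' =>
        obtain ⟨b, h⟩ := h
        obtain ⟨b', h'⟩ := h'
        exact ⟨max b b', fun n hn => by
          rw [map_add, h n (le_trans (le_max_left _ _) hn), h' n (le_trans (le_max_right _ _) hn),
            add_zero]⟩
      | hP n' m hm => exact ⟨n' + 1, fun n hn => M.proj_ne hm (by omega)⟩
    choose b hb using hb
    -- A finite spanning set of `N` over `k` gives one bound for the degrees that occur in `N`, and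
    -- `Am` stays inside `N`.
    obtain ⟨B, hB⟩ := (s.image fun m => b m.1).bddAbove
    have key : ∀ m : N, ∀ n, B ≤ n → M.proj n m.1 = 0 := by
      intro m n hn
      have hm : m ∈ @Submodule.span k N _ _ (Module.compHom N (algebraMap k A)) s := by
        rw [hs]; trivial
      let : Module k N := Module.compHom N (algebraMap k A)
      induction hm using Submodule.span_induction with
      | mem m hm => exact hb m.1 n (le_trans (hB (by simpa using ⟨m.1, ⟨m.2, hm⟩, rfl⟩)) hn)
      | zero => exact map_zero _
      | add m m' _ _ h h' => exact (map_add (M.proj n) m.1 m'.1).trans (by rw [h, h', add_zero])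
      | smul c m _ h => exact (M.proj_field_smul n c m.1).trans (by rw [h, smul_zero])
    exact ⟨B, fun x n hn => key ⟨x • m, N.smul_mem x hm⟩ n hn⟩
  | zero => exact ⟨0, fun x n _ => by rw [smul_zero, map_zero]⟩
  | add m m' _ _ h h' =>
    obtain ⟨b, h⟩ := h
    obtain ⟨b', h'⟩ := h'
    exact ⟨max b b', fun x n hn => by
      rw [smul_add, map_add, h x n (le_trans (le_max_left _ _) hn),
        h' x n (le_trans (le_max_right _ _) hn), add_zero]⟩

end GrMod

end KernelCokernel

/-! ### The morphisms that are inverted in `QGr` -/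

section FdimIso

variable {k : Type u} [Field k] {V : Type u} [Quiver.{u} V] [Finite V]

/-- An element of a module over the path algebra is annihilated by all long paths. -/
def PathTorsion (P : Type u) [AddCommGroup P] [Module (PathAlgebra k V) P] (m : P) : Prop :=
  ∃ n, ∀ p : Pth V, n ≤ p.length → ofPth k p • m = 0

theorem PathTorsion.add {P : Type u} [AddCommGroup P] [Module (PathAlgebra k V) P] {m m' : P}
    (h : PathTorsion (k := k) (V := V) P m) (h' : PathTorsion (k := k) (V := V) P m') :
    PathTorsion (k := k) (V := V) P (m + m') := by
  obtain ⟨n, h⟩ := h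
  obtain ⟨n', h'⟩ := h'
  exact ⟨max n n', fun p hp => by
    rw [smul_add, h p (le_trans (le_max_left _ _) hp), h' p (le_trans (le_max_right _ _) hp),
      add_zero]⟩

/-- If paths of length at least `n` kill `m`, the submodule generated by `m` is spanned by the
elements `pm` with `p` shorter than `n`, and a finite quiver has finitely many such `p`. -/
theorem isFdim_of_pathTorsion [∀ i j : V, Finite (i ⟶ j)] {P : Type u} [AddCommGroup P]
    [Module (PathAlgebra k V) P] (h : ∀ m : P, PathTorsion (k := k) (V := V) P m) :
    IsFdim k (PathAlgebra k V) P := by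
  refine eq_top_iff.2 fun m _ => ?_
  obtain ⟨n, hn⟩ := h m
  have hm : m ∈ Submodule.span (PathAlgebra k V) {m} := Submodule.mem_span_singleton_self m
  suffices hfin : @Module.Finite k (Submodule.span (PathAlgebra k V) {m}) _ _
      (Module.compHom _ (algebraMap k (PathAlgebra k V))) from
    (le_sSup (show _ ∈ {N : Submodule (PathAlgebra k V) P | @Module.Finite k N _ _
      (Module.compHom N (algebraMap k (PathAlgebra k V)))} from hfin)) hm
  let : Module k (Submodule.span (PathAlgebra k V) {m}) :=
    Module.compHom _ (algebraMap k (PathAlgebra k V))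
  let m' : Submodule.span (PathAlgebra k V) {m} := ⟨m, hm⟩
  refine Module.Finite.of_surjective
    (Finsupp.linearCombination k fun p : {p : Pth V // p.length < n} => ofPth k p.1 • m') ?_
  rintro ⟨_, hx⟩
  obtain ⟨x, rfl⟩ := Submodule.mem_span_singleton.1 hx
  have key : ∀ x : PathAlgebra k V, x • m' ∈ LinearMap.range (Finsupp.linearCombination k
      fun p : {p : Pth V // p.length < n} => ofPth k p.1 • m') := by
    intro x
    induction x using PathAlgebra.induction with
    | h0 => rw [zero_smul]; exact zero_mem _
    | hadd x y h h' => rw [add_smul]; exact add_mem h h'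
    | hsmul c p =>
      have : (c • ofPth k p) • m' = c • (ofPth k p • m') := by
        change _ = algebraMap k (PathAlgebra k V) c • (ofPth k p • m')
        rw [Algebra.smul_def, mul_smul]
      rw [this]
      refine Submodule.smul_mem _ c ?_
      by_cases hp : p.length < n
      · exact ⟨Finsupp.single ⟨p, hp⟩ 1, by simp⟩
      · have : ofPth k p • m' = 0 := Subtype.ext (hn p (not_lt.1 hp))
        rw [this]
        exact zero_mem _
  exact key x

theorem isFdim_iff_pathTorsion [∀ i j : V, Finite (i ⟶ j)] (M : GrMod (pathGrade k V)) :
    IsFdim k (PathAlgebra k V) M.carrier ↔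
      ∀ x, ∀ m ∈ (pathFamily k V).piece M x, PathTorsion (k := k) (V := V) M.carrier m := by
  constructor
  · intro h x m hm
    obtain ⟨b, hb⟩ := M.exists_bound_of_isFdim h m
    -- The element `pm` is homogeneous of degree `p.length + x.deg`, which is at least `b` for these
    -- `p`, so it equals a projection that vanishes.
    refine ⟨(b - x.deg).toNat, fun p hp => ?_⟩
    rw [← hb (ofPth k p) (p.length + x.deg) (by omega)]
    exact (M.proj_same (M.smul_mem (ofPth_mem_pathGrade k p) hm.1)).symm
  · intro h
    refine isFdim_of_pathTorsion fun m => ?_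
    induction m using (pathFamily k V).induction M with
    | h0 => exact ⟨0, fun p _ => smul_zero _⟩
    | hadd m m' h h' => exact h.add h'
    | hP x m hm => exact h x m hm

/-- The action of a path on the pieces of a graded module. -/
def VertexArrows.pieceAct {k A : Type u} [Field k] [Ring A] [Algebra k A] {𝒜 : ℤ → Submodule k A}
    [SetLike.GradedMonoid 𝒜] (D : VertexArrows 𝒜 V) (M : GrMod 𝒜) {x y : Cov V}
    (p : Quiver.Path x y) : D.piece M x →ₗ[k] D.piece M y :=
  act (D.repObj M) p

omit [Finite V] in
theorem VertexArrows.pieceAct_nil {k A : Type u} [Field k] [Ring A] [Algebra k A]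
    {𝒜 : ℤ → Submodule k A} [SetLike.GradedMonoid 𝒜] (D : VertexArrows 𝒜 V) (M : GrMod 𝒜)
    {x : Cov V} (m : D.piece M x) : D.pieceAct M .nil m = m :=
  act_nil (X := D.repObj M) m

omit [Finite V] in
theorem VertexArrows.pieceAct_cons {k A : Type u} [Field k] [Ring A] [Algebra k A]
    {𝒜 : ℤ → Submodule k A} [SetLike.GradedMonoid 𝒜] (D : VertexArrows 𝒜 V) (M : GrMod 𝒜)
    {x y z : Cov V} (p : Quiver.Path x y) (a : y ⟶ z) (m : D.piece M x) :
    (D.pieceAct M (p.cons a) m).1 = D.arr a.1 • (D.pieceAct M p m).1 :=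
  congrArg Subtype.val (act_cons (X := D.repObj M) p a m)

theorem exists_pth_of_covPath (M : GrMod (pathGrade k V)) {x y : Cov V} (p : Quiver.Path x y) :
    ∃ q : Quiver.Path x.vertex y.vertex, q.length = p.length ∧
      ∀ m : (pathFamily k V).piece M x,
        ((pathFamily k V).pieceAct M p m).1 =
          ofPth k ⟨_, _, q⟩ • m.1 := by
  induction p with
  | nil =>
    refine ⟨.nil, rfl, fun m => ?_⟩
    rw [VertexArrows.pieceAct_nil]
    exact m.2.2.symm
  | @cons y z p a ih =>
    obtain ⟨q, hq, h⟩ := ih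
    obtain ⟨⟨s, t, a⟩, h1, h2, h3⟩ := a
    obtain ⟨i, d⟩ := y
    obtain ⟨j, d'⟩ := z
    obtain rfl : s = i := h1
    obtain rfl : t = j := h2
    refine ⟨q.cons a, congrArg Nat.succ hq, fun m => ?_⟩
    rw [VertexArrows.pieceAct_cons, ofPth_cons, mul_smul, ← h m]
    rfl

/-- Unique path lifting to the cover. The lift is chosen before the module, because it depends only
on the path and on the starting degree. -/
theorem exists_covPath {x : Cov V} {j : V} (q : Quiver.Path x.vertex j) :
    ∃ (y : Cov V) (p : Quiver.Path x y), y.vertex = j ∧ p.length = q.length ∧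
      ∀ (M : GrMod (pathGrade k V)) (m : (pathFamily k V).piece M x),
        ((pathFamily k V).pieceAct M p m).1 =
          ofPth k ⟨_, _, q⟩ • m.1 := by
  induction q with
  | nil =>
    refine ⟨x, .nil, rfl, rfl, fun M m => ?_⟩
    rw [VertexArrows.pieceAct_nil]
    exact m.2.2.symm
  | @cons j l q a ih =>
    obtain ⟨y, p, hy, hp, h⟩ := ih
    refine ⟨_, p.cons (covArrow ⟨j, l, a⟩ y hy.symm), rfl, congrArg Nat.succ hp, fun M m => ?_⟩
    rw [VertexArrows.pieceAct_cons, ofPth_cons, mul_smul, ← h M m]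
    rfl

/-- The dictionary between paths of the quiver and paths of the cover. The predicate `P` is `= 0`
for kernels and membership in the range for cokernels; `P 0` accounts for the paths that do not
start at the vertex of `x`. -/
theorem pathTorsion_iff (M : GrMod (pathGrade k V)) {x : Cov V}
    (m : (pathFamily k V).piece M x) (P : M.carrier → Prop) (hP : P 0) :
    (∃ n, ∀ p : Pth V, n ≤ p.length → P (ofPth k p • m.1)) ↔
      ∃ n, ∀ (y : Cov V) (p : Quiver.Path x y), n ≤ p.length →
        P ((pathFamily k V).pieceAct M p m).1 := by
  refine exists_congr fun n => ⟨fun h y p hp => ?_, fun h p hp => ?_⟩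
  · obtain ⟨q, hq, e⟩ := exists_pth_of_covPath M p
    rw [e]
    exact h _ (hp.trans_eq hq.symm)
  · obtain ⟨i, j, q⟩ := p
    by_cases hi : i = x.vertex
    · subst hi
      obtain ⟨y, p, -, hp', e⟩ := exists_covPath (k := k) q
      rw [← e]
      exact h y p (hp.trans_eq hp'.symm)
    · have : ofPth k (⟨i, j, q⟩ : Pth V) • m.1 = 0 := by
        rw [← m.2.2, ← mul_smul]
        refine (congrArg (· • m.1) (ofPth_mul_of_ne k (Ne.symm hi))).trans (zero_smul _ _)
      rw [this]
      exact hP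

/-- Torsion of kernel and cokernel, tested on homogeneous elements at a vertex, is the definition of
an eventual isomorphism translated through the dictionary. -/
theorem fdimIso_iff [∀ i j : V, Finite (i ⟶ j)] {M N : GrMod (pathGrade k V)} (f : M ⟶ N) :
    fdimIso (pathGrade k V) f ↔ eventualIso ((pathFamily k V).rep.map f) := by
  refine and_congr ((isFdim_iff_pathTorsion (GrMod.ker f)).trans ?_)
    ((isFdim_iff_pathTorsion (GrMod.coker f)).trans ?_)
  · refine forall_congr' fun x => ⟨fun h m hm => ?_, fun h m hm => ?_⟩
    · have hm' : GrMod.lin f m.1 = 0 := congrArg Subtype.val hm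
      obtain ⟨n, hn⟩ := h ⟨m.1, hm'⟩ ⟨m.2.1, Subtype.ext m.2.2⟩
      obtain ⟨n, hn⟩ := (pathTorsion_iff M m (· = 0) rfl).1
        ⟨n, fun p hp => congrArg Subtype.val (hn p hp)⟩
      exact ⟨n, fun y p hp => Subtype.ext (hn y p hp)⟩
    · let m' : (pathFamily k V).piece M x := ⟨m.1, hm.1, congrArg Subtype.val hm.2⟩
      obtain ⟨n, hn⟩ := h m' (Subtype.ext m.2)
      obtain ⟨n, hn⟩ := (pathTorsion_iff M m' (· = 0) rfl).2
        ⟨n, fun y p hp => congrArg Subtype.val (hn y p hp)⟩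
      exact ⟨n, fun p hp => Subtype.ext (hn p hp)⟩
  · refine forall_congr' fun x => ⟨fun h m => ?_, fun h m hm => ?_⟩
    · obtain ⟨n, hn⟩ := h ((LinearMap.range (GrMod.lin f)).mkQ m.1)
        ⟨⟨m.1, m.2.1, rfl⟩, congrArg (LinearMap.range (GrMod.lin f)).mkQ m.2.2⟩
      obtain ⟨n, hn⟩ := (pathTorsion_iff N m (· ∈ LinearMap.range (GrMod.lin f)) (zero_mem _)).1
        ⟨n, fun p hp => (Submodule.Quotient.mk_eq_zero _).1 (hn p hp)⟩
      refine ⟨n, fun y p hp => ?_⟩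
      obtain ⟨u, hu⟩ := hn y p hp
      have hm := ((pathFamily k V).pieceAct N p m).2
      -- A preimage `u` need not be homogeneous. As `f` preserves degrees and commutes with
      -- idempotents, the part of `u` at `y` is still a preimage.
      let u' : (pathFamily k V).piece M y :=
        ⟨(pathFamily k V).e y.vertex • M.proj y.deg u,
          VertexArrows.e_smul_mem (M.proj_mem y.deg u)⟩
      refine ⟨u', Subtype.ext ?_⟩
      refine (map_smul (GrMod.lin f) _ _).trans ?_
      rw [← GrMod.proj_lin, hu]
      refine Eq.trans ?_ hm.2
      rw [N.proj_same hm.1]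
    · obtain ⟨⟨w, hw, rfl⟩, hm⟩ := hm
      -- The representative `w` has the right degree but may have parts at other vertices.
      -- Multiplying by `e_x` does not change its class, which is fixed by this idempotent.
      let m' : (pathFamily k V).piece N x :=
        ⟨(pathFamily k V).e x.vertex • w, VertexArrows.e_smul_mem hw⟩
      obtain ⟨n, hn⟩ := h m'
      obtain ⟨n, hn⟩ := (pathTorsion_iff N m' (· ∈ LinearMap.range (GrMod.lin f)) (zero_mem _)).2
        ⟨n, fun y p hp => by
          obtain ⟨u, hu⟩ := hn y p hp
          exact ⟨u.1, congrArg Subtype.val hu⟩⟩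
      refine ⟨n, fun p hp => ?_⟩
      have : (LinearMap.range (GrMod.lin f)).mkQ m'.1 = (LinearMap.range (GrMod.lin f)).mkQ w := hm
      exact (congrArg (ofPth k p • ·) this.symm).trans
        ((Submodule.Quotient.mk_eq_zero _).2 (hn p hp))

end FdimIso

/-! ### Leavitt families -/

section LeavittFamily

/-- Elements of an algebra that satisfy the relations of the Leavitt path algebra. -/
structure LeavittFamily (B : Type*) [Ring B] (V : Type u) [Quiver.{u} V] extends
    QuiverFamily B V where
  ghost : Arr V → B
  e_mul_ghost : ∀ a, e a.src * ghost a = ghost a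
  ghost_mul_e : ∀ a, ghost a * e a.tgt = ghost a
  arr_mul_ghost_self : ∀ a, arr a * ghost a = e a.tgt
  arr_mul_ghost_ne : ∀ a b, a ≠ b → arr a * ghost b = 0
  sum_ghost_mul_arr : ∀ i, (∃ a : Arr V, a.src = i) →
    ∑ᶠ a : {a : Arr V // a.src = i}, ghost a.1 * arr a.1 = e i

variable {k : Type u} [Field k] {V : Type u} [Quiver.{u} V] [Finite V]
  [∀ i j : V, Finite (i ⟶ j)]

theorem map_finsum_of_finite {M N F ι : Type*} [AddCommMonoid M] [AddCommMonoid N] [FunLike F M N]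
    [AddMonoidHomClass F M N] [Finite ι] (g : F) (f : ι → M) : g (∑ᶠ i, f i) = ∑ᶠ i, g (f i) :=
  AddMonoidHom.map_finsum (g : M →+ N) (Set.toFinite _)

/-- The image of a generator under a Leavitt family. -/
def LeavittFamily.gen {B : Type u} [Ring B] (F : LeavittFamily B V) : LeavittGen V → B
  | .vertex i => F.e i
  | .arrow a => F.arr a
  | .ghost a => F.ghost a

/-- The homomorphism out of the Leavitt path algebra that is given by a Leavitt family. -/
noncomputable def leavittLift {B : Type u} [Ring B] [Algebra k B] (F : LeavittFamily B V) :
    LeavittAlg k V →ₐ[k] B :=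
  RingQuot.liftAlgHom k ⟨FreeAlgebra.lift k F.gen, fun x y h => by
    have he : ∀ i, FreeAlgebra.lift k F.gen (fe k i) = F.e i :=
      fun i => FreeAlgebra.lift_ι_apply _ _
    have ha : ∀ a, FreeAlgebra.lift k F.gen (fa k a) = F.arr a :=
      fun i => FreeAlgebra.lift_ι_apply _ _
    have hs : ∀ a, FreeAlgebra.lift k F.gen (fs k a) = F.ghost a :=
      fun i => FreeAlgebra.lift_ι_apply _ _
    cases h with
    | vertex_mul_self i => rw [map_mul, he, F.e_mul_self]
    | vertex_mul i j h => rw [map_mul, he, he, F.e_mul_ne i j h, map_zero]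
    | vertex_sum => simp only [map_finsum_of_finite, he, F.sum_e, map_one]
    | arrow a => rw [map_mul, map_mul, he, he, ha, F.e_mul_arr, F.arr_mul_e]
    | ghost a => rw [map_mul, map_mul, he, he, hs, F.e_mul_ghost, F.ghost_mul_e]
    | arrow_mul_ghost_self a => rw [map_mul, ha, hs, he, F.arr_mul_ghost_self]
    | arrow_mul_ghost a b h => rw [map_mul, ha, hs, F.arr_mul_ghost_ne a b h, map_zero]
    | sum_ghost_mul_arrow i h =>
      simp only [map_finsum_of_finite, map_mul, ha, hs, he, F.sum_ghost_mul_arr i h]⟩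

theorem leavittLift_word {B : Type u} [Ring B] [Algebra k B] (F : LeavittFamily B V)
    (w : List (LeavittGen V)) : leavittLift F (leavittWord k w) = (w.map F.gen).prod := by
  refine (RingQuot.liftAlgHom_mkAlgHom_apply k _ _ _).trans ?_
  rw [map_list_prod, List.map_map]
  congr 2
  exact funext fun x => FreeAlgebra.lift_ι_apply _ _

omit [Finite V] [∀ (i j : V), Finite (i ⟶ j)] in
theorem leavittWord_singleton (x : LeavittGen V) :
    leavittWord k [x] = RingQuot.mkAlgHom k (LeavittRel k V) (FreeAlgebra.ι k x) := by
  simp [leavittWord]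

theorem leavittLift_gen {B : Type u} [Ring B] [Algebra k B] (F : LeavittFamily B V)
    (x : LeavittGen V) : leavittLift F (leavittWord k [x]) = F.gen x := by
  rw [leavittLift_word]
  exact List.prod_singleton

variable (k V) in
/-- The vertices and arrows in the Leavitt path algebra. -/
noncomputable def leavittFamily : LeavittFamily (LeavittAlg k V) V where
  e i := leavittWord k [.vertex i]
  arr a := leavittWord k [.arrow a]
  ghost a := leavittWord k [.ghost a]
  e_mul_self i := by
    simpa only [leavittWord_singleton, map_mul] using
      RingQuot.mkAlgHom_rel k (LeavittRel.vertex_mul_self (k := k) i)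
  e_mul_ne i j h := by
    simpa only [leavittWord_singleton, map_mul, map_zero] using
      RingQuot.mkAlgHom_rel k (LeavittRel.vertex_mul (k := k) i j h)
  sum_e := by
    simpa only [leavittWord_singleton, map_finsum_of_finite, map_one] using
      RingQuot.mkAlgHom_rel k (LeavittRel.vertex_sum (k := k) (V := V))
  e_mul_arr a := by
    have h1 := RingQuot.mkAlgHom_rel k (LeavittRel.vertex_mul_self (k := k) a.tgt)
    have h2 := RingQuot.mkAlgHom_rel k (LeavittRel.arrow (k := k) a)
    simp only [leavittWord_singleton, map_mul] at h1 h2 ⊢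
    rw [← h2, ← mul_assoc, ← mul_assoc, h1]
  arr_mul_e a := by
    have h1 := RingQuot.mkAlgHom_rel k (LeavittRel.vertex_mul_self (k := k) a.src)
    have h2 := RingQuot.mkAlgHom_rel k (LeavittRel.arrow (k := k) a)
    simp only [leavittWord_singleton, map_mul] at h1 h2 ⊢
    rw [← h2, mul_assoc, h1]
  e_mul_ghost a := by
    have h1 := RingQuot.mkAlgHom_rel k (LeavittRel.vertex_mul_self (k := k) a.src)
    have h2 := RingQuot.mkAlgHom_rel k (LeavittRel.ghost (k := k) a)
    simp only [leavittWord_singleton, map_mul] at h1 h2 ⊢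
    rw [← h2, ← mul_assoc, ← mul_assoc, h1]
  ghost_mul_e a := by
    have h1 := RingQuot.mkAlgHom_rel k (LeavittRel.vertex_mul_self (k := k) a.tgt)
    have h2 := RingQuot.mkAlgHom_rel k (LeavittRel.ghost (k := k) a)
    simp only [leavittWord_singleton, map_mul] at h1 h2 ⊢
    rw [← h2, mul_assoc, h1]
  arr_mul_ghost_self a := by
    simpa only [leavittWord_singleton, map_mul] using
      RingQuot.mkAlgHom_rel k (LeavittRel.arrow_mul_ghost_self (k := k) a)
  arr_mul_ghost_ne a b h := by
    simpa only [leavittWord_singleton, map_mul, map_zero] using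
      RingQuot.mkAlgHom_rel k (LeavittRel.arrow_mul_ghost (k := k) a b h)
  sum_ghost_mul_arr i h := by
    simpa only [leavittWord_singleton, map_finsum_of_finite, map_mul] using
      RingQuot.mkAlgHom_rel k (LeavittRel.sum_ghost_mul_arrow (k := k) i h)

variable (k V) in
/-- The vertices and arrows in the graded Leavitt path algebra. -/
noncomputable def leavittVertexArrows : VertexArrows (leavittGrade k V) V where
  toQuiverFamily := (leavittFamily k V).toQuiverFamily
  e_mem i := leavittGen_mem k (.vertex i)
  arr_mem a := leavittGen_mem k (.arrow a)

theorem leavittVertexArrows_e (i : V) :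
    (leavittVertexArrows k V).e i = (leavittFamily k V).e i := rfl

theorem leavittVertexArrows_arr (a : Arr V) :
    (leavittVertexArrows k V).arr a = (leavittFamily k V).arr a := rfl

theorem ghost_mem (a : Arr V) : (leavittFamily k V).ghost a ∈ leavittGrade k V (-1) :=
  leavittGen_mem k (.ghost a)

theorem LeavittAlg.induction {P : LeavittAlg k V → Prop} (h0 : P 0)
    (hadd : ∀ x y, P x → P y → P (x + y)) (hsmul : ∀ (c : k) x, P x → P (c • x)) (h1 : P 1)
    (he : ∀ i x, P x → P ((leavittFamily k V).e i * x))
    (ha : ∀ a x, P x → P ((leavittFamily k V).arr a * x))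
    (hs : ∀ a x, P x → P ((leavittFamily k V).ghost a * x)) (x : LeavittAlg k V) : P x := by
  have hx : x ∈ ⨆ n, leavittGrade k V n := by
    rw [(DirectSum.Decomposition.isInternal (leavittGrade k V)).submodule_iSup_eq_top]
    trivial
  induction hx using Submodule.iSup_induction' with
  | zero => exact h0
  | add x y _ _ h h' => exact hadd x y h h'
  | mem n x hx =>
    induction hx using Submodule.span_induction with
    | zero => exact h0
    | add x y _ _ h h' => exact hadd x y h h'
    | smul c x _ h => exact hsmul c x h
    | mem x hx =>
      obtain ⟨w, -, rfl⟩ := hx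
      induction w with
      | nil => simpa [leavittWord] using h1
      | cons g w ih =>
        rw [← List.singleton_append, leavittWord_append]
        cases g with
        | vertex i => exact he i _ ih
        | arrow a => exact ha a _ ih
        | ghost a => exact hs a _ ih

/-- The arrows of the covering quiver that start at a vertex. -/
def starEquiv (x : Cov V) : Quiver.Star x ≃ {a : Arr V // a.src = x.vertex} where
  toFun b := ⟨b.2.1, b.2.2.1⟩
  invFun a := ⟨_, covArrow a.1 x a.2⟩
  left_inv _ := cov_hom_ext rfl
  right_inv _ := rfl

/-- Ghost arrows are determined by arrows. Expanding `e_{s(a)} = ∑ b^*b`, one has `f (a^*m) = ∑ b^*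
f (ba^*m)`, and only `b = a` contributes, with value `a^* f (m)`. The expansion is available at
every vertex because there are no sinks. -/
theorem leavittVertexArrows_generates (hV : ∀ i : V, ∃ a : Arr V, a.src = i) :
    (leavittVertexArrows k V).Generates := by
  intro M N f he ha x m
  let F := leavittFamily k V
  have hs : ∀ a m, f (F.ghost a • m) = F.ghost a • f m := by
    intro a m
    have h1 : f (F.ghost a • m) = F.e a.src • f (F.ghost a • m) := by
      rw [← leavittVertexArrows_e, ← he, ← mul_smul, leavittVertexArrows_e, F.e_mul_ghost]
    rw [h1, ← F.sum_ghost_mul_arr _ (hV _)]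
    have := Fintype.ofFinite {b : Arr V // b.src = a.src}
    rw [finsum_eq_sum_of_fintype, Finset.sum_smul,
      Finset.sum_eq_single_of_mem ⟨a, rfl⟩ (Finset.mem_univ _)]
    · rw [mul_smul, ← leavittVertexArrows_arr, ← ha, ← mul_smul, leavittVertexArrows_arr,
        F.arr_mul_ghost_self, ← leavittVertexArrows_e, he, ← mul_smul, leavittVertexArrows_e,
        F.ghost_mul_e]
    · rintro ⟨b, hb⟩ _ hne
      rw [mul_smul, ← leavittVertexArrows_arr, ← ha, ← mul_smul, leavittVertexArrows_arr,
        F.arr_mul_ghost_ne b a (fun h => hne (Subtype.ext h)), zero_smul, map_zero, smul_zero]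
  induction x using LeavittAlg.induction generalizing m with
  | h0 => rw [zero_smul, zero_smul, map_zero]
  | hadd x y h h' => rw [add_smul, add_smul, map_add, h, h']
  | hsmul c x h => rw [smul_assoc, smul_assoc, map_smul, h]
  | h1 => rw [one_smul, one_smul]
  | he i x h => rw [mul_smul, mul_smul, ← h]; exact he i _
  | ha a x h => rw [mul_smul, mul_smul, ← h]; exact ha a _
  | hs a x h => rw [mul_smul, mul_smul, ← h]; exact hs a _

theorem ghost_smul_mem {M : GrMod (leavittGrade k V)} {x y : Cov V} (b : x ⟶ y) {m : M.carrier}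
    (hm : m ∈ (leavittVertexArrows k V).piece M y) :
    (leavittFamily k V).ghost b.1 • m ∈ (leavittVertexArrows k V).piece M x := by
  obtain ⟨a, h1, h2, h3⟩ := b
  obtain ⟨i, d⟩ := x
  obtain rfl : a.src = i := h1
  refine ⟨?_, ?_⟩
  · have := M.smul_mem (ghost_mem (k := k) a) hm.1
    rwa [h3, neg_add_cancel_comm_assoc] at this
  · rw [← mul_smul]
    exact congrArg (· • m) ((leavittFamily k V).e_mul_ghost a)

/-- The inverse of the star map is `(w_b) ↦ ∑ b^* w_b`: the relation `e = ∑ b^*b` makes the star map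
injective, while `bb^* = e` and `cb^* = 0` for `c ≠ b` make it surjective. -/
theorem saturated_rep (hV : ∀ i : V, ∃ a : Arr V, a.src = i) (M : GrMod (leavittGrade k V)) :
    saturated ((leavittVertexArrows k V).rep.obj M) := by
  classical
  intro x
  let D := leavittVertexArrows k V
  let F := leavittFamily k V
  have := Fintype.ofFinite (Quiver.Star x)
  have hsum : ∑ b : Quiver.Star x, F.ghost b.2.1 * F.arr b.2.1 = F.e x.vertex := by
    rw [← F.sum_ghost_mul_arr _ (hV _), ← finsum_eq_sum_of_fintype]
    exact finsum_comp_equiv (starEquiv x)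
      (f := fun a : {a : Arr V // a.src = x.vertex} => F.ghost a.1 * F.arr a.1)
  change Function.Bijective fun (m : D.piece M x) (b : Quiver.Star x) => D.pieceMap M b.2 m
  constructor
  · intro m m' h
    have key : ∀ m : D.piece M x, m.1 = ∑ b : Quiver.Star x, F.ghost b.2.1 • F.arr b.2.1 • m.1 := by
      intro m
      refine m.2.2.symm.trans ?_
      change F.e x.vertex • m.1 = _
      rw [← hsum, Finset.sum_smul]
      exact Finset.sum_congr rfl fun b _ => mul_smul _ _ _
    refine Subtype.ext ?_
    rw [key m, key m']
    refine Finset.sum_congr rfl fun b _ => congrArg (F.ghost b.2.1 • ·) ?_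
    exact congrArg Subtype.val (congrFun h b)
  · intro w
    have hw : ∀ b : Quiver.Star x, (w b : D.piece M b.1).1 ∈ D.piece M b.1 :=
      fun b => (w b : D.piece M b.1).2
    have hmem : ∀ b : Quiver.Star x, F.ghost b.2.1 • (w b : D.piece M b.1).1 ∈ D.piece M x :=
      fun b => ghost_smul_mem b.2 (hw b)
    refine ⟨⟨_, sum_mem fun b (_ : b ∈ Finset.univ) => hmem b⟩, funext fun c => Subtype.ext ?_⟩
    change F.arr c.2.1 • (∑ b : Quiver.Star x, F.ghost b.2.1 • (w b : D.piece M b.1).1) = _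
    rw [Finset.smul_sum, Finset.sum_eq_single_of_mem c (Finset.mem_univ _)]
    · rw [← mul_smul, F.arr_mul_ghost_self, c.2.2.2.1]
      exact (hw c).2
    · intro b _ hb
      rw [← mul_smul, F.arr_mul_ghost_ne _ _ (fun h => hb (cov_hom_ext h.symm)), zero_smul]

/-! ### The Leavitt path algebra acts on saturated representations -/

variable {X : Rep k (Cov V)} (hX : saturated X)

/-- The map from the value of a representation at a vertex to the product of the values at the ends
of the arrows that start there, as a linear map. -/
def starLin (X : Rep k (Cov V)) (x : Cov V) : X.obj x →ₗ[k] ∀ b : Quiver.Star x, Fiber X b.1 where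
  toFun := starMap X x
  map_add' v w := funext fun b => map_add (act X b.2.toPath) v w
  map_smul' c v := funext fun b => map_smul (act X b.2.toPath) c v

/-- An element of a saturated representation as the family of its images under the arrows. -/
noncomputable def starLinearEquiv (hX : saturated X) (x : Cov V) :
    X.obj x ≃ₗ[k] ∀ b : Quiver.Star x, Fiber X b.1 :=
  LinearEquiv.ofBijective (starLin X x) (hX x)

open Classical in
/-- The action of a ghost arrow on a saturated representation. -/
noncomputable def ghostAct (hX : saturated X) {x y : Cov V} (b : x ⟶ y) : X.obj y →ₗ[k] X.obj x :=
  (starLinearEquiv hX x).symm.toLinearMap.comp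
    (LinearMap.single k (fun b : Quiver.Star x => Fiber X b.1) ⟨y, b⟩)

open Classical in
omit [Finite V] [∀ (i j : V), Finite (i ⟶ j)] in
theorem starLinearEquiv_ghostAct {x y : Cov V} (b : x ⟶ y) (v : X.obj y) :
    starLinearEquiv hX x (ghostAct hX b v) =
      Pi.single (M := fun b : Quiver.Star x => Fiber X b.1) ⟨y, b⟩ v :=
  (starLinearEquiv hX x).apply_symm_apply _

omit [Finite V] [∀ (i j : V), Finite (i ⟶ j)] in
theorem act_ghostAct {x y : Cov V} (b : x ⟶ y) (v : X.obj y) :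
    act X b.toPath (ghostAct hX b v) = v := by
  classical
  exact (congrFun (starLinearEquiv_ghostAct hX b v) ⟨y, b⟩).trans (Pi.single_eq_same _ _)

omit [Finite V] [∀ (i j : V), Finite (i ⟶ j)] in
theorem act_ghostAct_ne {x y z : Cov V} (b : x ⟶ y) (c : x ⟶ z) (h : c.1 ≠ b.1) (v : X.obj y) :
    act X c.toPath (ghostAct hX b v) = 0 := by
  classical
  refine (congrFun (starLinearEquiv_ghostAct hX b v) ⟨z, c⟩).trans (Pi.single_eq_of_ne ?_ _)
  intro h'
  exact h (congrArg (fun d : Quiver.Star x => d.2.1) h')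

theorem sum_ghostAct_act {x : Cov V} (v : X.obj x) :
    ∑ᶠ b : Quiver.Star x, ghostAct hX b.2 (act X b.2.toPath v) = v := by
  have := Fintype.ofFinite (Quiver.Star x)
  rw [finsum_eq_sum_of_fintype]
  refine (hX x).1 (funext fun c => ?_)
  change act X c.2.toPath _ = act X c.2.toPath _
  rw [map_sum, Finset.sum_eq_single_of_mem c (Finset.mem_univ _), act_ghostAct]
  intro b _ hb
  exact act_ghostAct_ne hX _ _ (fun h => hb (cov_hom_ext h.symm)) _

/-- The arrow of the covering quiver that ends at a vertex and lies over a given arrow. -/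
def coArrow (a : Arr V) (y : Cov V) (h : a.tgt = y.vertex) : (⟨a.src, y.deg - 1⟩ : Cov V) ⟶ y :=
  ⟨a, rfl, h, (sub_add_cancel _ _).symm⟩

open Classical in
/-- The action of a ghost arrow on the total space. -/
noncomputable def ghostOp (hX : saturated X) (a : Arr V) : Module.End k (Total X) :=
  Total.lift fun y =>
    if h : a.tgt = y.vertex then (inTotal X _).comp (ghostAct hX (coArrow a y h)) else 0

omit [Finite V] [∀ (i j : V), Finite (i ⟶ j)] in
theorem ghostOp_apply {x y : Cov V} (a : x ⟶ y) (v : X.obj y) :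
    ghostOp hX a.1 (inTotal X y v) = inTotal X x (ghostAct hX a v) := by
  rw [ghostOp, Total.lift_apply, dif_pos a.2.2.1]
  obtain ⟨a, h1, h2, h3⟩ := a
  obtain rfl : x = ⟨a.src, y.deg - 1⟩ := Cov.ext h1.symm (by simp [h3])
  rfl

omit [Finite V] [∀ (i j : V), Finite (i ⟶ j)] in
theorem ghostOp_ne {a : Arr V} {y : Cov V} (h : a.tgt ≠ y.vertex)
    (v : X.obj y) : ghostOp hX a (inTotal X y v) = 0 := by
  rw [ghostOp, Total.lift_apply, dif_neg h]
  rfl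

omit [Finite V] [∀ (i j : V), Finite (i ⟶ j)] in
theorem ghostOp_coArrow {a : Arr V} {y : Cov V} (h : a.tgt = y.vertex)
    (v : X.obj y) : ghostOp hX a (inTotal X y v) =
      inTotal X ⟨a.src, y.deg - 1⟩ (ghostAct hX (coArrow a y h) v) :=
  ghostOp_apply hX (coArrow a y h) v

omit [Finite V] [∀ (i j : V), Finite (i ⟶ j)] in
theorem ghostOp_mem (a : Arr V) : ghostOp hX a ∈ degreeOps X (-1) := fun y v => by
  by_cases h : a.tgt = y.vertex
  · rw [ghostOp_coArrow hX h, neg_add_eq_sub]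
    exact inTotal_mem X ⟨a.src, y.deg - 1⟩ _
  · rw [ghostOp_ne hX h]
    exact zero_mem _

/-- The Leavitt family on the total space of a saturated representation. -/
noncomputable def totalLeavittFamily (hX : saturated X) :
    LeavittFamily (Module.End k (Total X)) V where
  toQuiverFamily := totalFamily X
  ghost := ghostOp hX
  e_mul_ghost a := Total.hom_ext fun y v => by
    change vertexOp X a.src (ghostOp hX a (inTotal X y v)) = _
    by_cases h : a.tgt = y.vertex
    · rw [ghostOp_coArrow hX h]
      exact vertexOp_same X ⟨a.src, y.deg - 1⟩ _
    · rw [ghostOp_ne hX h, map_zero]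
  ghost_mul_e a := Total.hom_ext fun y v => by
    change ghostOp hX a (vertexOp X a.tgt (inTotal X y v)) = _
    by_cases h : a.tgt = y.vertex
    · rw [h, vertexOp_same]
    · rw [vertexOp_ne X h, map_zero, ghostOp_ne hX h]
  arr_mul_ghost_self a := Total.hom_ext fun y v => by
    change arrowOp X a (ghostOp hX a (inTotal X y v)) = vertexOp X a.tgt (inTotal X y v)
    by_cases h : a.tgt = y.vertex
    · rw [ghostOp_coArrow hX h, h, vertexOp_same]
      exact (arrowOp_apply X (coArrow a y h) _).trans (congrArg _ (act_ghostAct hX _ v))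
    · rw [ghostOp_ne hX h, map_zero, vertexOp_ne X h]
  arr_mul_ghost_ne a b hab := Total.hom_ext fun y v => by
    change arrowOp X a (ghostOp hX b (inTotal X y v)) = 0
    by_cases h : b.tgt = y.vertex
    · rw [ghostOp_coArrow hX h]
      by_cases h' : a.src = b.src
      · rw [arrowOp_covArrow X (x := ⟨b.src, y.deg - 1⟩) h',
          act_ghostAct_ne hX (coArrow b y h) (covArrow a ⟨b.src, y.deg - 1⟩ h') hab, map_zero]
      · exact arrowOp_ne X (x := ⟨b.src, y.deg - 1⟩) h' _
    · rw [ghostOp_ne hX h, map_zero]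
  sum_ghost_mul_arr i _ := Total.hom_ext fun x v => by
    change _ = vertexOp X i (inTotal X x v)
    have e := map_finsum_of_finite (LinearMap.applyₗ (R := k) (inTotal X x v))
      fun a : {a : Arr V // a.src = i} => ghostOp hX a.1 * arrowOp X a.1
    refine e.trans ?_
    change ∑ᶠ a : {a : Arr V // a.src = i}, ghostOp hX a.1 (arrowOp X a.1 (inTotal X x v)) = _
    by_cases h : i = x.vertex
    · subst h
      rw [vertexOp_same, ← finsum_comp_equiv (starEquiv x)]
      refine Eq.trans (finsum_congr fun b => ?_) ((map_finsum_of_finite (inTotal X x)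
        fun b : Quiver.Star x => ghostAct hX b.2 (act X b.2.toPath v)).symm.trans
          (congrArg (inTotal X x) (sum_ghostAct_act hX v)))
      change ghostOp hX b.2.1 (arrowOp X b.2.1 (inTotal X x v)) = _
      rw [arrowOp_apply, ghostOp_apply]
    · rw [vertexOp_ne X h]
      refine (finsum_congr fun a => ?_).trans finsum_zero
      rw [arrowOp_ne X (fun h' => h (a.2.symm.trans h')), map_zero]

theorem leavittLift_total_mem {n : ℤ} {a : LeavittAlg k V} (ha : a ∈ leavittGrade k V n) :
    leavittLift (totalLeavittFamily hX) a ∈ degreeOps X n := by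
  induction ha using Submodule.span_induction with
  | mem a ha =>
    obtain ⟨w, rfl, rfl⟩ := ha
    rw [leavittLift_word]
    induction w with
    | nil => exact degreeOps_one X
    | cons g w ih =>
      refine degreeOps_mul ?_ ih
      cases g with
      | vertex i => exact vertexOp_mem X i
      | arrow a => exact arrowOp_mem X a
      | ghost a => exact ghostOp_mem hX a
  | zero => rw [map_zero]; exact zero_mem _
  | add a b _ _ h h' => rw [map_add]; exact add_mem h h'
  | smul c a _ h => rw [map_smul]; exact Submodule.smul_mem _ c h

theorem exists_rep_iso (hX : saturated X) :
    ∃ M, Nonempty ((leavittVertexArrows k V).rep.obj M ≅ X) := by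
  have h : ∀ g, leavittLift (totalLeavittFamily hX) (leavittWord k [g]) =
    (totalLeavittFamily hX).gen g := fun g => leavittLift_gen _ g
  refine ⟨_, rep_ofAction (leavittVertexArrows k V) X (leavittLift (totalLeavittFamily hX))
    (leavittLift_total_mem hX) ?_ ?_ ?_⟩
  · intro x v
    exact (congrArg (fun f => f (inTotal X x v)) (h (.vertex x.vertex))).trans (vertexOp_same X x v)
  · intro i x v hi
    exact (congrArg (fun f => f (inTotal X x v)) (h (.vertex i))).trans (vertexOp_ne X hi v)
  · intro x y a v
    exact (congrArg (fun f => f (inTotal X x v)) (h (.arrow a.1))).trans (arrowOp_apply X a v)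

variable (k) in
/-- Graded modules over the Leavitt path algebra as saturated representations. -/
noncomputable def leavittRep (hV : ∀ i : V, ∃ a : Arr V, a.src = i) :
    GrMod (leavittGrade k V) ⥤ (saturated (k := k) (U := Cov V)).FullSubcategory :=
  saturated.lift (leavittVertexArrows k V).rep (saturated_rep hV)

/-- Essential surjectivity is the point: on a saturated representation the ghost arrows are forced,
as components of the inverse star maps, and the resulting operators satisfy the Leavitt relations.
-/
theorem isEquivalence_leavittRep (hV : ∀ i : V, ∃ a : Arr V, a.src = i) :
    (leavittRep k hV).IsEquivalence := by
  have := (leavittVertexArrows k V).full_rep (leavittVertexArrows_generates hV)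
  have h1 : (leavittRep k hV).Full := inferInstanceAs (saturated.lift _ _).Full
  have h2 : (leavittRep k hV).Faithful := inferInstanceAs (saturated.lift _ _).Faithful
  have h3 : (leavittRep k hV).EssSurj := ⟨fun X => by
    obtain ⟨M, ⟨e⟩⟩ := exists_rep_iso X.property
    exact ⟨M, ⟨saturated.isoMk e⟩⟩⟩
  exact { }

end LeavittFamily

/-! ### The quotient category of graded modules over the path algebra -/

section QGrEquivalence

variable (k : Type u) [Field k] (V : Type u) [Quiver.{u} V] [Finite V]
  [∀ i j : V, Finite (i ⟶ j)]

/-- The saturated representation of the core that is given by a graded module over the path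
algebra. -/
noncomputable def pathSaturate :
    GrMod (pathGrade k V) ⥤ (saturated (k := k) (U := Cov (CoreVertex V))).FullSubcategory :=
  (pathFamily k V).rep ⋙ restrictCore V k ⋙ saturate k (Cov (CoreVertex V))

theorem inverseImage_pathSaturate :
    (MorphismProperty.isomorphisms _).inverseImage (pathSaturate k V) =
      fdimIso (pathGrade k V) := by
  ext M N f
  rw [fdimIso_iff, ← eventualIso_restrictCore_iff, ← isIso_saturate_map_iff]
  rfl

/-- A functor with a fully faithful right adjoint is a localization at the morphisms it inverts.
Here the right adjoint is a composite of the inclusion of saturated representations, coinduction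
from the core, and the inverse of an equivalence. -/
theorem isLocalization_pathSaturate : (pathSaturate k V).IsLocalization (fdimIso (pathGrade k V)) := by
  rw [← inverseImage_pathSaturate]
  have h1 := (fullyFaithfulCoinduceCore (V := V) k).full
  have h2 := (fullyFaithfulCoinduceCore (V := V) k).faithful
  exact ((pathFamily k V).rep.asEquivalence.toAdjunction.comp
    ((restrictCoreAdjunction V k).comp (saturateAdjunction k _))).isLocalization

omit [∀ (i j : V), Finite (i ⟶ j)] in
theorem exists_arrow_core (i : CoreVertex V) : ∃ a : Arr (CoreVertex V), a.src = i := by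
  obtain ⟨a, h, h'⟩ := exists_arrow_of_mem_core i.2
  obtain ⟨b, rfl⟩ := exists_coreArr a (by rw [h]; exact i.2) h'
  exact ⟨b, Subtype.ext h⟩

omit [∀ (i j : V), Finite (i ⟶ j)] in
theorem exists_coarrow_core (i : CoreVertex V) : ∃ a : Arr (CoreVertex V), a.tgt = i := by
  obtain ⟨a, h, h'⟩ := exists_coarrow_of_mem_core i.2
  obtain ⟨b, rfl⟩ := exists_coreArr a h' (by rw [h]; exact i.2)
  exact ⟨b, Subtype.ext h⟩

/-- The quotient category of graded modules over the path algebra is equivalent to the category of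
graded modules over the Leavitt path algebra of the core. -/
noncomputable def qgrEquivalence :
    QGr (pathGrade k V) ≌ GrMod (leavittGrade k (CoreVertex V)) :=
  have := isLocalization_pathSaturate k V
  have := isEquivalence_leavittRep (k := k) (exists_arrow_core V)
  (Localization.equivalenceFromModel (pathSaturate k V) (fdimIso (pathGrade k V))).trans
    (leavittRep k (exists_arrow_core V)).asEquivalence.symm

end QGrEquivalence

/-! ### Paths and ghost paths -/

namespace LeavittFamily

variable {B : Type*} [Ring B] {V : Type u} [Quiver.{u} V] (F : LeavittFamily B V)

/-- The product of the ghost arrows of a path. -/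
def ghostVal {i : V} : ∀ {j : V}, Quiver.Path i j → B
  | _, .nil => F.e i
  | _, .cons p a => ghostVal p * F.ghost ⟨_, _, a⟩

/-- The image of a path. -/
def val (p : Pth V) : B := F.pathVal p.path

/-- The image of a ghost path. -/
def coval (p : Pth V) : B := F.ghostVal p.path

theorem e_mul_val (p : Pth V) : F.e p.tgt * F.val p = F.val p := F.e_mul_pathVal p.path

theorem coval_mul_e (p : Pth V) : F.coval p * F.e p.tgt = F.coval p := by
  obtain ⟨i, j, p⟩ := p
  cases p with
  | nil => exact F.e_mul_self i
  | cons p a =>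
    change F.ghostVal p * F.ghost ⟨_, _, a⟩ * _ = F.ghostVal p * F.ghost ⟨_, _, a⟩
    rw [mul_assoc]
    exact congrArg _ (F.ghost_mul_e ⟨_, _, a⟩)

theorem e_mul_coval (p : Pth V) : F.e p.src * F.coval p = F.coval p := by
  obtain ⟨i, j, p⟩ := p
  change F.e i * F.ghostVal p = F.ghostVal p
  induction p with
  | nil => exact F.e_mul_self i
  | cons p a ih => rw [ghostVal, ← mul_assoc, ih]

theorem val_mul_coval_self (p : Pth V) : F.val p * F.coval p = F.e p.tgt := by
  obtain ⟨i, j, p⟩ := p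
  change F.pathVal p * F.ghostVal p = F.e j
  induction p with
  | nil => exact F.e_mul_self i
  | @cons j l p a ih =>
    rw [ghostVal, QuiverFamily.pathVal, mul_assoc, ← mul_assoc _ (F.ghostVal p), ih,
      F.e_mul_ghost ⟨j, l, a⟩, F.arr_mul_ghost_self]

/-- With last arrows `a` and `b`, the product is `a (p'q'^*) b^*`. The middle factor vanishes by
induction unless `p' = q'`, in which case it is an idempotent and `ab^* = 0`, since then `a ≠ b`. -/
theorem val_mul_coval_ne {p q : Pth V} (h : p.length = q.length) (hne : p ≠ q) :
    F.val p * F.coval q = 0 := by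
  obtain ⟨i, j, p⟩ := p
  obtain ⟨i', j', q⟩ := q
  change F.pathVal p * F.ghostVal q = 0
  induction p generalizing j' with
  | nil =>
    cases q with
    | nil => exact F.e_mul_ne i i' fun h' => hne (by rw [h'])
    | cons q b => exact absurd h (Nat.succ_ne_zero _).symm
  | @cons j l p a ih =>
    cases q with
    | nil => exact absurd h (Nat.succ_ne_zero _)
    | @cons j' l' q b =>
      rw [ghostVal, QuiverFamily.pathVal, mul_assoc, ← mul_assoc _ (F.ghostVal q)]
      by_cases hpq : (⟨i, j, p⟩ : Pth V) = ⟨i', j', q⟩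
      · cases hpq
        rw [show F.pathVal p * F.ghostVal p = F.e j from F.val_mul_coval_self ⟨i, j, p⟩,
          F.e_mul_ghost ⟨j, _, b⟩]
        refine F.arr_mul_ghost_ne _ _ fun hab => hne ?_
        cases hab
        rfl
      · rw [ih j' q (Nat.succ.inj h) hpq, zero_mul, mul_zero]

theorem val_consPath {n : ℕ} (a : Arr V) (p : PthN V n) (h : p.1.tgt = a.src) :
    F.val (consPath a p h).1 = F.arr a * F.val p.1 := by
  obtain ⟨⟨c, d, p⟩, hp⟩ := p
  obtain ⟨e, f, a⟩ := a
  obtain rfl : d = e := h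
  rfl

theorem coval_consPath {n : ℕ} (a : Arr V) (p : PthN V n) (h : p.1.tgt = a.src) :
    F.coval (consPath a p h).1 = F.coval p.1 * F.ghost a := by
  obtain ⟨⟨c, d, p⟩, hp⟩ := p
  obtain ⟨e, f, a⟩ := a
  obtain rfl : d = e := h
  rfl

end LeavittFamily

/-- A path of positive length consists of a shorter path and its last arrow. -/
def consEquiv (V : Type u) [Quiver.{u} V] (n : ℕ) :
    (Σ p : PthN V n, {a : Arr V // a.src = p.1.tgt}) ≃ PthN V (n + 1) where
  toFun x := consPath x.2.1 x.1 x.2.2.symm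
  invFun p := ⟨initPath p, lastArrow p, (initPath_tgt p).symm⟩
  left_inv x := by
    obtain ⟨⟨⟨c, d, p⟩, hp⟩, ⟨⟨e, f, a⟩, ha⟩⟩ := x
    obtain rfl : e = d := ha
    rfl
  right_inv p := consPath_init p

/-- The paths of length zero are the vertices. -/
def nilEquiv (V : Type u) [Quiver.{u} V] : V ≃ PthN V 0 where
  toFun i := ⟨Pth.nil i, rfl⟩
  invFun p := p.1.src
  left_inv _ := rfl
  right_inv p := by
    obtain ⟨⟨i, j, p⟩, hp⟩ := p
    cases p with
    | nil => rfl
    | cons p a => exact absurd hp (Nat.succ_ne_zero _)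

namespace LeavittFamily

variable {B : Type*} [Ring B] {V : Type u} [Quiver.{u} V] [Finite V] [∀ i j : V, Finite (i ⟶ j)]
  (F : LeavittFamily B V)

theorem sum_coval_cons (hV : ∀ i : V, ∃ a : Arr V, a.src = i) (p : Pth V) {x : B}
    (hx : F.e p.tgt * x = x) :
    ∑ᶠ a : {a : Arr V // a.src = p.tgt}, F.coval p * F.ghost a.1 * (F.arr a.1 * x) =
      F.coval p * x := by
  have := Fintype.ofFinite {a : Arr V // a.src = p.tgt}
  have h := F.sum_ghost_mul_arr _ (hV p.tgt)
  rw [finsum_eq_sum_of_fintype] at h ⊢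
  conv_rhs => rw [← hx, ← mul_assoc, ← h, Finset.mul_sum, Finset.sum_mul]
  simp only [mul_assoc]

/-- Inserting `e_{t(p)} = ∑ a^*a` into `p^*p` replaces each path by its prolongations by one arrow.
In the absence of sinks this is possible for every path. -/
theorem sum_coval_mul_val (hV : ∀ i : V, ∃ a : Arr V, a.src = i) (n : ℕ) :
    ∑ᶠ p : PthN V n, F.coval p.1 * F.val p.1 = 1 := by
  induction n with
  | zero =>
    rw [← finsum_comp_equiv (nilEquiv V) (f := fun p => F.coval p.1 * F.val p.1), ← F.sum_e]
    exact finsum_congr fun i => F.e_mul_self i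
  | succ n ih =>
    have := Fintype.ofFinite (PthN V n)
    have : ∀ p : PthN V n, Fintype {a : Arr V // a.src = p.1.tgt} := fun p => Fintype.ofFinite _
    rw [← finsum_comp_equiv (consEquiv V n) (f := fun p => F.coval p.1 * F.val p.1), ← ih, finsum_eq_sum_of_fintype,
      finsum_eq_sum_of_fintype, Fintype.sum_sigma]
    refine Finset.sum_congr rfl fun p _ => ?_
    rw [← F.sum_coval_cons hV p.1 (F.e_mul_val p.1), finsum_eq_sum_of_fintype]
    exact Finset.sum_congr rfl fun a _ =>
      congrArg₂ (· * ·) (F.coval_consPath _ _ _) (F.val_consPath _ _ _)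

end LeavittFamily

/-! ### The Leavitt path algebra is strongly graded -/

section StronglyGraded

variable (k : Type u) [Field k] {V : Type u} [Quiver.{u} V] [Finite V]
  [∀ i j : V, Finite (i ⟶ j)]

theorem val_mem (p : Pth V) : (leavittFamily k V).val p ∈ leavittGrade k V p.length := by
  obtain ⟨i, j, p⟩ := p
  induction p with
  | nil => exact leavittGen_mem k (.vertex i)
  | cons p a ih =>
    have h : (leavittFamily k V).arr ⟨_, _, a⟩ ∈ leavittGrade k V 1 := leavittGen_mem k (.arrow _)
    have := SetLike.GradedMul.mul_mem h ih
    rwa [add_comm] at this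

theorem coval_mem (p : Pth V) : (leavittFamily k V).coval p ∈ leavittGrade k V (-p.length) := by
  obtain ⟨i, j, p⟩ := p
  induction p with
  | nil => exact leavittGen_mem k (.vertex i)
  | cons p a ih =>
    have := SetLike.GradedMul.mul_mem ih (ghost_mem (k := k) ⟨_, _, a⟩)
    rwa [← neg_add] at this

omit [Finite V] [∀ (i j : V), Finite (i ⟶ j)] in
theorem exists_path_to (hV' : ∀ i : V, ∃ a : Arr V, a.tgt = i) (n : ℕ) (j : V) :
    ∃ p : PthN V n, p.1.tgt = j := by
  induction n generalizing j with
  | zero => exact ⟨⟨Pth.nil j, rfl⟩, rfl⟩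
  | succ n ih =>
    obtain ⟨a, rfl⟩ := hV' j
    obtain ⟨p, hp⟩ := ih a.src
    exact ⟨consPath a p hp, rfl⟩

/-- In nonnegative degrees `1 = ∑ e_j` with `e_j = pp^*` for some path `p` of length `n` that ends
at `j`; this uses the absence of sources. In nonpositive degrees `1 = ∑ p^*p`; this uses the absence
of sinks. -/
theorem one_mem_leavittGrade_mul (hV : ∀ i : V, ∃ a : Arr V, a.src = i)
    (hV' : ∀ i : V, ∃ a : Arr V, a.tgt = i) (n : ℤ) :
    1 ∈ leavittGrade k V n * leavittGrade k V (-n) := by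
  have := Fintype.ofFinite V
  obtain ⟨n, rfl | rfl⟩ := n.eq_nat_or_neg
  · rw [← (leavittFamily k V).sum_e, finsum_eq_sum_of_fintype]
    refine sum_mem fun j _ => ?_
    obtain ⟨⟨p, rfl⟩, rfl⟩ := exists_path_to hV' n j
    rw [← LeavittFamily.val_mul_coval_self]
    exact Submodule.mul_mem_mul (val_mem k p) (coval_mem k p)
  · have := Fintype.ofFinite (PthN V n)
    rw [← (leavittFamily k V).sum_coval_mul_val hV n, finsum_eq_sum_of_fintype]
    refine sum_mem fun p _ => ?_
    obtain ⟨p, rfl⟩ := p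
    rw [neg_neg]
    exact Submodule.mul_mem_mul (coval_mem k p) (val_mem k p)

end StronglyGraded

/-- Multiplying `1` by degree zero elements gives `A₀ ⊆ A₀AₙA₋ₙ ⊆ AₙA₋ₙ`. -/
theorem mul_eq_of_one_mem {k A : Type u} [Field k] [Ring A] [Algebra k A] {𝒜 : ℤ → Submodule k A}
    [SetLike.GradedMonoid 𝒜] {n : ℤ} (h : 1 ∈ 𝒜 n * 𝒜 (-n)) : 𝒜 n * 𝒜 (-n) = 𝒜 0 := by
  have hmul : ∀ i j, 𝒜 i * 𝒜 j ≤ 𝒜 (i + j) := fun i j =>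
    Submodule.mul_le.2 fun a ha b hb => SetLike.GradedMul.mul_mem ha hb
  refine le_antisymm ((hmul _ _).trans_eq (by rw [add_neg_cancel])) ?_
  intro a ha
  have h1 : a * 1 ∈ 𝒜 0 * (𝒜 n * 𝒜 (-n)) := Submodule.mul_mem_mul ha h
  rw [mul_one, ← mul_assoc] at h1
  exact Submodule.mul_le.2 (fun b hb c hc => Submodule.mul_mem_mul
    ((hmul 0 n).trans_eq (by rw [zero_add]) hb) hc) h1

/-! ### Graded modules over strongly graded algebras -/

section StronglyGradedModules

variable {k A : Type u} [Field k] [Ring A] [Algebra k A] {𝒜 : ℤ → Submodule k A}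
  [GradedAlgebra 𝒜]

omit [GradedAlgebra 𝒜] in
theorem smul_mem_zero {M : GrMod 𝒜} {n : ℤ} {y : A} {m : M.carrier} (hy : y ∈ 𝒜 (-n))
    (hm : m ∈ M.component n) : y • m ∈ M.component 0 := by
  simpa using M.smul_mem hy hm

omit [GradedAlgebra 𝒜] in
theorem smul_mem_of_zero {M : GrMod 𝒜} {n : ℤ} {x : A} {m : M.carrier} (hx : x ∈ 𝒜 n)
    (hm : m ∈ M.component 0) : x • m ∈ M.component n := by
  simpa using M.smul_mem hx hm

-- Writing `1 = ∑ xy` with `x` in `Aₙ` and `y` in `A₋ₙ` gives `m = ∑ x(ym)` with `ym` of degree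
-- zero: a graded module is generated by its degree zero component.
omit [GradedAlgebra 𝒜] in
theorem GrMod.induction_zero (h : ∀ n, 1 ∈ 𝒜 n * 𝒜 (-n)) (M : GrMod 𝒜) {n : ℤ}
    {P : M.carrier → Prop} (hadd : ∀ m m', P m → P m' → P (m + m'))
    (hP : ∀ x ∈ 𝒜 n, ∀ m ∈ M.component 0, P (x • m)) {m : M.carrier} (hm : m ∈ M.component n) :
    P m := by
  have key : ∀ z ∈ 𝒜 n * 𝒜 (-n), P (z • m) := fun z hz => by
    induction hz using Submodule.mul_induction_on' with
    | mem_mul_mem x hx y hy =>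
      rw [mul_smul]
      exact hP x hx _ (smul_mem_zero hy hm)
    | add x _ y _ hx hy =>
      rw [add_smul]
      exact hadd _ _ hx hy
  have := key 1 (h n)
  rwa [one_smul] at this

theorem faithful_degreeZero (h : ∀ n, 1 ∈ 𝒜 n * 𝒜 (-n)) : (degreeZero 𝒜).Faithful where
  map_injective {M N} f g hfg := by
    have h0 : ∀ m ∈ M.component 0, GrMod.lin f m = GrMod.lin g m := fun m hm =>
      congrArg (fun φ : (degreeZero 𝒜).obj M ⟶ (degreeZero 𝒜).obj N =>
        (ModuleCat.Hom.hom φ (⟨m, hm⟩ : M.component 0) : N.component 0).1) hfg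
    refine GrMod.Hom.ext (LinearMap.ext fun m => ?_)
    change GrMod.lin f m = GrMod.lin g m
    induction m using M.induction with
    | h0 => rw [map_zero, map_zero]
    | hadd m m' h h' => rw [map_add, map_add, h, h']
    | hP n m hm =>
      refine M.induction_zero h (P := fun m => GrMod.lin f m = GrMod.lin g m)
        (fun m m' h h' => ?_) (fun x _ m hm => ?_) hm
      · rw [map_add, map_add, h, h']
      · rw [map_smul, map_smul, h0 m hm]

-- The dual of generation in degree zero. For `y` in `A₋ₙ` the degree zero part of `ym` is `y` times
-- the degree `n` part of `m`; so `A₋ₙ` kills that part, and `1 ∈ AₙA₋ₙ` makes it zero.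
omit [GradedAlgebra 𝒜] in
theorem eq_zero_of_proj_smul (h : ∀ n, 1 ∈ 𝒜 n * 𝒜 (-n)) (N : GrMod 𝒜) {m : N.carrier}
    (hm : ∀ u : A, N.proj 0 (u • m) = 0) : m = 0 := by
  have h1 : ∀ n, N.proj n m = 0 := by
    intro n
    have key : ∀ y ∈ 𝒜 (-n), y • N.proj n m = 0 := by
      intro y hy
      rw [← hm y]
      clear hm
      induction m using N.induction with
      | h0 => simp
      | hadd m m' h h' => simp only [map_add, smul_add, h, h']
      | hP n' m hm =>
        by_cases hn : n' = n
        · subst hn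
          rw [N.proj_same hm, N.proj_same (smul_mem_zero hy hm)]
        · rw [N.proj_ne hm hn, smul_zero, N.proj_ne (N.smul_mem hy hm) (by omega)]
    have : ∀ z ∈ 𝒜 n * 𝒜 (-n), z • N.proj n m = 0 := fun z hz => by
      induction hz using Submodule.mul_induction_on' with
      | mem_mul_mem x hx y hy => rw [mul_smul, key y hy, smul_zero]
      | add x _ y _ hx hy => rw [add_smul, hx, hy, add_zero]
    simpa using this 1 (h n)
  obtain ⟨s, hs⟩ := N.exists_sum_proj m
  rw [← hs]
  exact Finset.sum_eq_zero fun n _ => h1 n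

/-- The projection of a graded module onto its degree zero component. -/
noncomputable def GrMod.projZero (M : GrMod 𝒜) : M.carrier →+ M.component 0 :=
  (M.proj 0).codRestrict _ (M.proj_mem 0)

/-- The graph of the extension of a homomorphism between degree zero components. -/
noncomputable def extensionGraph {M N : GrMod 𝒜} (φ : M.component 0 →ₗ[𝒜 0] N.component 0) :
    Submodule A (M.carrier × N.carrier) where
  carrier := {x | ∀ u : A, φ (M.projZero (u • x.1)) = N.projZero (u • x.2)}
  zero_mem' u := by
    rw [Prod.fst_zero, Prod.snd_zero, smul_zero, smul_zero, map_zero, map_zero, map_zero]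
  add_mem' {x y} hx hy u := by
    rw [Prod.fst_add, Prod.snd_add, smul_add, smul_add, map_add, map_add, map_add, hx u, hy u]
  smul_mem' a x hx u := by
    rw [Prod.smul_fst, Prod.smul_snd, ← mul_smul, ← mul_smul]
    exact hx (u * a)

variable {M N : GrMod 𝒜} (φ : M.component 0 →ₗ[𝒜 0] N.component 0)

theorem extensionGraph_unique (h : ∀ n, 1 ∈ 𝒜 n * 𝒜 (-n)) {m : M.carrier} {n n' : N.carrier}
    (hn : (m, n) ∈ extensionGraph φ) (hn' : (m, n') ∈ extensionGraph φ) : n = n' := by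
  refine sub_eq_zero.1 (eq_zero_of_proj_smul h N fun u => ?_)
  have h1 : N.projZero (u • n) = N.projZero (u • n') := (hn u).symm.trans (hn' u)
  rw [smul_sub, map_sub, sub_eq_zero]
  exact congrArg Subtype.val h1

theorem mem_extensionGraph_zero (m : M.component 0) :
    (m.1, (φ m).1) ∈ extensionGraph φ := by
  intro u
  change φ (M.projZero (u • m.1)) = N.projZero (u • (φ m).1)
  induction u using DirectSum.Decomposition.inductionOn 𝒜 with
  | zero => rw [zero_smul, zero_smul, map_zero, map_zero, map_zero]
  | @homogeneous i a =>
    have h1 := M.smul_mem a.2 m.2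
    have h2 := N.smul_mem a.2 (φ m).2
    rw [add_zero] at h1 h2
    by_cases hi : i = 0
    · subst hi
      have e1 : M.projZero (a.1 • m.1) = a • m := Subtype.ext (M.proj_same h1)
      have e2 : N.projZero (a.1 • (φ m).1) = a • φ m := Subtype.ext (N.proj_same h2)
      rw [e1, e2, map_smul]
    · have e1 : M.projZero (a.1 • m.1) = 0 := Subtype.ext (M.proj_ne h1 hi)
      have e2 : N.projZero (a.1 • (φ m).1) = 0 := Subtype.ext (N.proj_ne h2 hi)
      rw [e1, e2, map_zero]
  | add a b ha hb => rw [add_smul, add_smul, map_add, map_add, map_add, ha, hb]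

theorem exists_mem_extensionGraph (h : ∀ n, 1 ∈ 𝒜 n * 𝒜 (-n)) {n : ℤ} {m : M.carrier}
    (hm : m ∈ M.component n) : ∃ m' ∈ N.component n, (m, m') ∈ extensionGraph φ := by
  refine M.induction_zero h (P := fun m => ∃ m' ∈ N.component n, (m, m') ∈ extensionGraph φ)
    ?_ ?_ hm
  · rintro m m' ⟨a, ha, ha'⟩ ⟨b, hb, hb'⟩
    exact ⟨a + b, add_mem ha hb, (extensionGraph φ).add_mem ha' hb'⟩
  · intro x hx m hm
    exact ⟨_, smul_mem_of_zero hx (φ ⟨m, hm⟩).2,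
      (extensionGraph φ).smul_mem x (mem_extensionGraph_zero φ ⟨m, hm⟩)⟩

/-- The extension is defined by its graph, the pairs `(m, n)` for which `φ` takes the degree zero
part of `um` to that of `un` for all `u`. This is visibly a submodule and contains the graph of `φ`.
Generation in degree zero makes it total, and `eq_zero_of_proj_smul` makes it single-valued. -/
theorem exists_extend_degreeZero (h : ∀ n, 1 ∈ 𝒜 n * 𝒜 (-n)) :
    ∃ F : M ⟶ N, ∀ m : M.component 0, GrMod.lin F m.1 = (φ m).1 := by
  have hex : ∀ m, ∃ m', (m, m') ∈ extensionGraph φ := fun m => by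
    induction m using M.induction with
    | h0 => exact ⟨0, (extensionGraph φ).zero_mem⟩
    | hadd m m' h h' =>
      obtain ⟨a, ha⟩ := h
      obtain ⟨b, hb⟩ := h'
      exact ⟨a + b, (extensionGraph φ).add_mem ha hb⟩
    | hP n m hm =>
      obtain ⟨m', -, h'⟩ := exists_mem_extensionGraph φ h hm
      exact ⟨m', h'⟩
  choose f hf using hex
  let F : M.carrier →ₗ[A] N.carrier :=
    { toFun := f
      map_add' := fun m m' => extensionGraph_unique φ h (hf _)
        ((extensionGraph φ).add_mem (hf m) (hf m'))
      map_smul' := fun a m => extensionGraph_unique φ h (hf _)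
        ((extensionGraph φ).smul_mem a (hf m)) }
  refine ⟨⟨F, fun n m hm => ?_⟩, fun m => extensionGraph_unique φ h (hf m.1)
    (mem_extensionGraph_zero φ m)⟩
  obtain ⟨m', h1, h2⟩ := exists_mem_extensionGraph φ h hm
  have : F m = m' := extensionGraph_unique φ h (hf m) h2
  rwa [this]

theorem full_degreeZero (h : ∀ n, 1 ∈ 𝒜 n * 𝒜 (-n)) : (degreeZero 𝒜).Full where
  map_surjective {M N} φ := by
    obtain ⟨F, hF⟩ := exists_extend_degreeZero (M := M) (N := N) (ModuleCat.Hom.hom φ) h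
    exact ⟨F, ModuleCat.hom_ext (LinearMap.ext fun m => Subtype.ext (hF m))⟩

end StronglyGradedModules

/-! ### Coinduced graded modules -/

section Coinduced

variable {k A : Type u} [Field k] [Ring A] [Algebra k A] {𝒜 : ℤ → Submodule k A}
  [GradedAlgebra 𝒜]

variable (𝒜) in
/-- The additive maps from a graded algebra to a module over its degree zero component that are
linear and vanish in almost all degrees. -/
def Coinduced (N : Type u) [AddCommGroup N] [Module (𝒜 0) N] : AddSubgroup (A →+ N) where
  carrier := {f | (∀ (c : 𝒜 0) (b : A), f (c.1 * b) = c • f b) ∧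
    ∃ s : Finset ℤ, ∀ n ∉ s, ∀ a ∈ 𝒜 n, f a = 0}
  zero_mem' := ⟨fun c b => (smul_zero c).symm, ∅, fun _ _ _ _ => rfl⟩
  add_mem' := by
    classical
    rintro f g ⟨hf, s, hs⟩ ⟨hg, t, ht⟩
    refine ⟨fun c b => ?_, s ∪ t, fun n hn a ha => ?_⟩
    · simp only [AddMonoidHom.add_apply, hf, hg, smul_add]
    · rw [Finset.mem_union, not_or] at hn
      rw [AddMonoidHom.add_apply, hs n hn.1 a ha, ht n hn.2 a ha, add_zero]
  neg_mem' := by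
    rintro f ⟨hf, s, hs⟩
    refine ⟨fun c b => ?_, s, fun n hn a ha => ?_⟩
    · simp only [AddMonoidHom.neg_apply, hf, smul_neg]
    · rw [AddMonoidHom.neg_apply, hs n hn a ha, neg_zero]

variable {N : Type u} [AddCommGroup N]

theorem addHom_ext_grade {f g : A →+ N} (h : ∀ n, ∀ a ∈ 𝒜 n, f a = g a) : f = g := by
  refine AddMonoidHom.ext fun a => ?_
  induction a using DirectSum.Decomposition.inductionOn 𝒜 with
  | zero => simp
  | @homogeneous i a => exact h i a a.2
  | add a b ha hb => rw [map_add, map_add, ha, hb]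

variable [Module (𝒜 0) N]

theorem Coinduced.comp_mem {f : A →+ N} (hf : f ∈ Coinduced 𝒜 N) (a : A) :
    f.comp (AddMonoidHom.mulRight a) ∈ Coinduced 𝒜 N := by
  classical
  induction a using DirectSum.Decomposition.inductionOn 𝒜 with
  | zero =>
    have : f.comp (AddMonoidHom.mulRight (0 : A)) = 0 := AddMonoidHom.ext fun b => by simp
    rw [this]
    exact zero_mem _
  | @homogeneous i a =>
    obtain ⟨h, s, hs⟩ := hf
    -- Right multiplication by `a` takes degree `n` to `n + i`, so the set of degrees where the map
    -- may be nonzero moves by `-i`.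
    refine ⟨fun c b => ?_, s.image (· - i), fun n hn b hb => hs (n + i) (fun h' => hn ?_) _
      (SetLike.GradedMul.mul_mem hb a.2)⟩
    · exact (congrArg f (mul_assoc _ _ _)).trans (h c _)
    · exact Finset.mem_image.2 ⟨n + i, h', add_sub_cancel_right _ _⟩
  | add a b ha hb =>
    have : f.comp (AddMonoidHom.mulRight (a + b)) =
        f.comp (AddMonoidHom.mulRight a) + f.comp (AddMonoidHom.mulRight b) :=
      AddMonoidHom.ext fun c => by simp [mul_add]
    rw [this]
    exact add_mem ha hb

instance : Module A (Coinduced 𝒜 N) where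
  smul a f := ⟨_, Coinduced.comp_mem f.2 a⟩
  one_smul f := Subtype.ext (AddMonoidHom.ext fun b => congrArg f.1 (mul_one b))
  mul_smul a a' f := Subtype.ext (AddMonoidHom.ext fun b => congrArg f.1 (mul_assoc b a a').symm)
  smul_zero _ := rfl
  smul_add _ _ _ := rfl
  add_smul a a' f := Subtype.ext (AddMonoidHom.ext fun b =>
    (congrArg f.1 (mul_add b a a')).trans (map_add f.1 _ _))
  zero_smul f := Subtype.ext (AddMonoidHom.ext fun b =>
    (congrArg f.1 (mul_zero b)).trans (map_zero f.1))

/-- The projection of a graded algebra onto a homogeneous component. -/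
def gradeProj (𝒜 : ℤ → Submodule k A) [GradedAlgebra 𝒜] (n : ℤ) : A →+ A where
  toFun a := DirectSum.decompose 𝒜 a n
  map_zero' := by simp
  map_add' := by simp

theorem gradeProj_same {n : ℤ} {a : A} (ha : a ∈ 𝒜 n) : gradeProj 𝒜 n a = a :=
  DirectSum.decompose_of_mem_same _ ha

theorem gradeProj_ne {n n' : ℤ} {a : A} (ha : a ∈ 𝒜 n) (h : n ≠ n') : gradeProj 𝒜 n' a = 0 :=
  DirectSum.decompose_of_mem_ne _ ha h

theorem gradeProj_mem (n : ℤ) (a : A) : gradeProj 𝒜 n a ∈ 𝒜 n := SetLike.coe_mem _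

theorem gradeProj_mul (n : ℤ) (c : 𝒜 0) (a : A) :
    gradeProj 𝒜 n (c.1 * a) = c.1 * gradeProj 𝒜 n a := by
  induction a using DirectSum.Decomposition.inductionOn 𝒜 with
  | zero => simp
  | @homogeneous i a =>
    have := SetLike.GradedMul.mul_mem c.2 a.2
    rw [zero_add] at this
    by_cases h : i = n
    · subst h
      rw [gradeProj_same a.2, gradeProj_same this]
    · rw [gradeProj_ne a.2 h, gradeProj_ne this h, mul_zero]
  | add a b ha hb => simp only [mul_add, map_add, ha, hb]

theorem Coinduced.comp_gradeProj_mem {f : A →+ N} (hf : f ∈ Coinduced 𝒜 N) (n : ℤ) :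
    f.comp (gradeProj 𝒜 n) ∈ Coinduced 𝒜 N := by
  refine ⟨fun c b => ?_, {n}, fun m hm a ha => ?_⟩
  · exact (congrArg f (gradeProj_mul n c b)).trans (hf.1 c _)
  · rw [AddMonoidHom.comp_apply, gradeProj_ne ha (by simpa using hm), map_zero]

variable (𝒜 N) in
/-- The graded module coinduced by a module over the degree zero component. -/
def coinduced : GrMod 𝒜 where
  carrier := Coinduced 𝒜 N
  component n :=
    -- The sign comes from `(af)(b) = f(ba)`: acting by an element of degree `i` lowers the degree
    -- of the support by `i`. Maps supported in degree `-n` must therefore have degree `n`.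
    { carrier := {f | ∀ m, m ≠ -n → ∀ a ∈ 𝒜 m, f.1 a = 0}
      zero_mem' := fun _ _ _ _ => rfl
      add_mem' := fun {f g} hf hg m hm a ha =>
        (congrArg₂ (· + ·) (hf m hm a ha) (hg m hm a ha)).trans (add_zero _)
      neg_mem' := fun {f} hf m hm a ha => (congrArg (- ·) (hf m hm a ha)).trans neg_zero }
  internal := by
    classical
    refine isInternal_of_projections _ (fun n =>
      { toFun := fun f : Coinduced 𝒜 N => ⟨_, Coinduced.comp_gradeProj_mem f.2 (-n)⟩
        map_zero' := rfl
        map_add' := fun _ _ => rfl }) ?_ ?_ ?_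
    · intro n f hf
      refine Subtype.ext (addHom_ext_grade (𝒜 := 𝒜) fun m a ha => ?_)
      change f.1 (gradeProj 𝒜 (-n) a) = f.1 a
      by_cases h : m = -n
      · subst h
        rw [gradeProj_same ha]
      · rw [gradeProj_ne ha h, map_zero, hf m h a ha]
    · intro m n hmn f hf
      refine Subtype.ext (AddMonoidHom.ext fun a => ?_)
      exact hf (-n) (fun h => hmn (neg_injective h).symm) _ (gradeProj_mem (-n) a)
    · refine eq_top_iff.2 fun f _ => ?_
      obtain ⟨hf, s, hs⟩ := f.2
      have : ∑ n ∈ s, (⟨_, Coinduced.comp_gradeProj_mem f.2 n⟩ : Coinduced 𝒜 N) = f := by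
        refine Subtype.ext (addHom_ext_grade (𝒜 := 𝒜) fun m a ha => ?_)
        rw [AddSubgroup.val_finsetSum, AddMonoidHom.finsetSum_apply]
        by_cases hm : m ∈ s
        · rw [Finset.sum_eq_single_of_mem m hm]
          · exact congrArg f.1 (gradeProj_same ha)
          · exact fun n _ hn => (congrArg f.1 (gradeProj_ne ha hn.symm)).trans (map_zero _)
        · rw [hs m hm a ha]
          refine Finset.sum_eq_zero fun n hn => ?_
          exact (congrArg f.1 (gradeProj_ne ha (fun h => hm (h ▸ hn)))).trans (map_zero _)
      rw [← this]
      refine sum_mem fun n _ => AddSubgroup.mem_iSup_of_mem (-n) ?_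
      intro m hm a ha
      rw [neg_neg] at hm
      exact (congrArg f.1 (gradeProj_ne ha hm)).trans (map_zero _)
  smul_mem := by
    intro i j a f ha hf m hm b hb
    exact hf (m + i) (by omega) _ (SetLike.GradedMul.mul_mem hb ha)

/-- The degree zero component of the coinduced module consists of the `A₀`-linear maps `A₀ → N`,
extended by zero, and evaluation at `1` identifies it with `N`. Strong grading plays no role here.
-/
theorem essSurj_degreeZero : (degreeZero 𝒜).EssSurj where
  mem_essImage N := by
    let ev : (coinduced 𝒜 N).component 0 →ₗ[𝒜 0] N :=
      { toFun := fun f => f.1.1 1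
        map_add' := fun _ _ => rfl
        map_smul' := fun c f => by
          have h1 := f.1.2.1 c 1
          have h2 : f.1.1 (1 * c.1) = f.1.1 (c.1 * 1) := by rw [one_mul, mul_one]
          exact h2.trans h1 }
    refine ⟨coinduced 𝒜 N, ⟨(LinearEquiv.ofBijective ev ⟨?_, fun n => ?_⟩).toModuleIso⟩⟩
    · rw [← LinearMap.ker_eq_bot, LinearMap.ker_eq_bot']
      intro f hf
      refine Subtype.ext (Subtype.ext (addHom_ext_grade (𝒜 := 𝒜) fun m a ha => ?_))
      by_cases h : m = 0
      · subst h
        have h1 := f.1.2.1 ⟨a, ha⟩ 1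
        rw [mul_one] at h1
        exact h1.trans ((congrArg _ hf).trans (smul_zero _))
      · exact f.2 m (by simpa using h) a ha
    · let f : A →+ N :=
        { toFun := fun a => (⟨gradeProj 𝒜 0 a, gradeProj_mem 0 a⟩ : 𝒜 0) • n
          map_zero' := by
            refine Eq.trans (congrArg (· • n) (Subtype.ext (map_zero _))) (zero_smul (𝒜 0) n)
          map_add' := fun a b => by
            rw [← add_smul]
            exact congrArg (· • n) (Subtype.ext (map_add _ _ _)) }
      have hne : ∀ m, m ≠ 0 → ∀ a ∈ 𝒜 m, f a = 0 := fun m hm a ha =>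
        (congrArg (· • n) (Subtype.ext (gradeProj_ne ha hm))).trans (zero_smul (𝒜 0) n)
      refine ⟨⟨⟨f, fun c b => ?_, {0}, fun m hm => hne m (by simpa using hm)⟩,
        fun m hm => hne m (by simpa using hm)⟩, ?_⟩
      · change (_ : 𝒜 0) • n = c • (_ : 𝒜 0) • n
        rw [← mul_smul]
        exact congrArg (· • n) (Subtype.ext (gradeProj_mul 0 c b))
      · change (_ : 𝒜 0) • n = n
        refine Eq.trans (congrArg (· • n) (Subtype.ext (gradeProj_same ?_))) (one_smul (𝒜 0) n)
        exact SetLike.GradedOne.one_mem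

/-- Taking the degree zero component is an equivalence for a strongly graded algebra. -/
theorem isEquivalence_degreeZero (h : ∀ n, 1 ∈ 𝒜 n * 𝒜 (-n)) : (degreeZero 𝒜).IsEquivalence :=
  have := faithful_degreeZero h
  have := full_degreeZero h
  have := essSurj_degreeZero (𝒜 := 𝒜)
  { }

end Coinduced

/-! ### Modules over a full corner of a ring -/

section Corner

/-- A presentation of the ring `B` as the corner `eRe` of `R`, for an idempotent `e` that generates
the unit ideal, by the compression map `R → eRe = B`. -/
structure CornerMap (R B : Type u) [Ring R] [Ring B] where
  e : R
  e_mul_self : e * e = e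
  compress : R →+ B
  compress_mul : ∀ r s, compress (r * e * s) = compress r * compress s
  compress_one : compress 1 = 1
  mul_eq_zero : ∀ r, compress r = 0 → e * r * e = 0
  surjective : Function.Surjective compress
  one_mem : (1 : R) ∈ AddSubgroup.closure {z | ∃ x y, z = x * e * y}

namespace CornerMap

variable {R B : Type u} [Ring R] [Ring B] (C : CornerMap R B)

theorem compress_e_mul (r : R) : C.compress (C.e * r) = C.compress r := by
  have h := C.compress_mul 1 r
  rwa [one_mul, C.compress_one, one_mul] at h

theorem compress_mul_e (r : R) : C.compress (r * C.e) = C.compress r := by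
  have h := C.compress_mul r 1
  rwa [mul_one, C.compress_one, mul_one] at h

/-- The inclusion of the corner. -/
noncomputable def incl (b : B) : R := C.e * Function.surjInv C.surjective b * C.e

/-- Two preimages of `b` differ by an element `s` with `ese = 0`. So any preimage may be used in
computing `incl`, and this makes `incl` additive and multiplicative. -/
theorem incl_eq {r : R} {b : B} (h : C.compress r = b) : C.incl b = C.e * r * C.e := by
  refine sub_eq_zero.1 ?_
  have := C.mul_eq_zero (Function.surjInv C.surjective b - r)
    (by rw [map_sub, Function.surjInv_eq C.surjective, h, sub_self])
  rwa [mul_sub, sub_mul] at this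

theorem compress_incl (b : B) : C.compress (C.incl b) = b := by
  rw [incl, compress_mul_e, compress_e_mul, Function.surjInv_eq C.surjective]

theorem e_mul_incl (b : B) : C.e * C.incl b = C.incl b := by
  rw [incl, mul_assoc, ← mul_assoc, C.e_mul_self]

theorem incl_mul_e (b : B) : C.incl b * C.e = C.incl b := by
  rw [incl, mul_assoc, C.e_mul_self]

theorem incl_compress (r : R) : C.incl (C.compress r) = C.e * r * C.e := C.incl_eq rfl

theorem incl_one : C.incl 1 = C.e := by
  rw [← C.compress_one, incl_compress, mul_one, C.e_mul_self]

theorem incl_zero : C.incl 0 = 0 := by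
  rw [← map_zero C.compress, incl_compress, mul_zero, zero_mul]

theorem incl_add (b b' : B) : C.incl (b + b') = C.incl b + C.incl b' := by
  rw [C.incl_eq (r := C.incl b + C.incl b') (by rw [map_add, compress_incl, compress_incl]),
    mul_add, add_mul, e_mul_incl, e_mul_incl, incl_mul_e, incl_mul_e]

theorem incl_mul (b b' : B) : C.incl (b * b') = C.incl b * C.incl b' := by
  rw [C.incl_eq (r := C.incl b * C.incl b') (by
      rw [← C.incl_mul_e b, C.compress_mul, compress_incl, compress_incl]),
    ← mul_assoc, e_mul_incl, mul_assoc, incl_mul_e]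

theorem compress_incl_mul (b : B) (r : R) : C.compress (C.incl b * r) = b * C.compress r := by
  rw [← C.incl_mul_e, C.compress_mul, compress_incl]

/-- The subgroup `eM` of an `R`-module `M`. -/
def part (M : Type*) [AddCommGroup M] [Module R M] : AddSubgroup M where
  carrier := {m | C.e • m = m}
  zero_mem' := smul_zero _
  add_mem' {m m'} h h' := by
    rw [Set.mem_ofPred_eq] at h h' ⊢
    rw [smul_add, h, h']
  neg_mem' {m} h := by
    rw [Set.mem_ofPred_eq] at h ⊢
    rw [smul_neg, h]

theorem e_smul_mem {M : Type*} [AddCommGroup M] [Module R M] (m : M) : C.e • m ∈ C.part M := by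
  change C.e • C.e • m = C.e • m
  rw [← mul_smul, C.e_mul_self]

noncomputable instance (M : Type*) [AddCommGroup M] [Module R M] : Module B (C.part M) where
  smul b m := ⟨C.incl b • m.1, by
    change C.e • C.incl b • m.1 = _
    rw [← mul_smul, e_mul_incl]⟩
  one_smul m := Subtype.ext ((congrArg (· • m.1) C.incl_one).trans m.2)
  mul_smul b b' m := Subtype.ext ((congrArg (· • m.1) (C.incl_mul b b')).trans (mul_smul _ _ _))
  smul_zero b := Subtype.ext (smul_zero (C.incl b))
  smul_add b m m' := Subtype.ext (smul_add (C.incl b) m.1 m'.1)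
  add_smul b b' m := Subtype.ext ((congrArg (· • m.1) (C.incl_add b b')).trans (add_smul _ _ _))
  zero_smul m := Subtype.ext ((congrArg (· • m.1) C.incl_zero).trans (zero_smul _ _))

theorem coe_smul {M : Type*} [AddCommGroup M] [Module R M] (b : B) (m : C.part M) :
    (b • m).1 = C.incl b • m.1 := rfl

/-- The functor `M ↦ eM`. -/
noncomputable def partFunctor : ModuleCat.{u} R ⥤ ModuleCat.{u} B where
  obj M := ModuleCat.of B (C.part M)
  map {M N} f := ModuleCat.ofHom
    { toFun := fun m : C.part M => (⟨f.hom m.1, by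
        change C.e • f.hom m.1 = _
        rw [← map_smul]
        exact congrArg f.hom m.2⟩ : C.part N)
      map_add' := fun m m' => Subtype.ext (map_add f.hom m.1 m'.1)
      map_smul' := fun b m => Subtype.ext (map_smul f.hom (C.incl b) m.1) }

/-- Fullness `1 ∈ ReR` gives `M = R(eM)`. It plays the part that generation in degree zero has for
strongly graded algebras. -/
theorem induction (M : Type*) [AddCommGroup M] [Module R M] {P : M → Prop} (h0 : P 0)
    (hadd : ∀ m m', P m → P m' → P (m + m')) (hneg : ∀ m, P m → P (-m))
    (hP : ∀ (x : R) (m : C.part M), P (x • m.1)) (m : M) : P m := by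
  have key : ∀ z ∈ AddSubgroup.closure {z | ∃ x y, z = x * C.e * y}, P (z • m) := fun z hz => by
    induction hz using AddSubgroup.closure_induction with
    | mem z hz =>
      obtain ⟨x, y, rfl⟩ := hz
      rw [mul_smul, mul_smul]
      exact hP x ⟨_, C.e_smul_mem (y • m)⟩
    | zero => rwa [zero_smul]
    | add x y _ _ hx hy =>
      rw [add_smul]
      exact hadd _ _ hx hy
    | neg x _ hx =>
      rw [neg_smul]
      exact hneg _ hx
  have := key 1 C.one_mem
  rwa [one_smul] at this

instance : C.partFunctor.Faithful where
  map_injective {M N} f g hfg := by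
    have h0 : ∀ m : C.part M, f.hom m.1 = g.hom m.1 := fun m =>
      congrArg (fun φ : C.partFunctor.obj M ⟶ C.partFunctor.obj N =>
        (ModuleCat.Hom.hom φ m : C.part N).1) hfg
    refine ModuleCat.hom_ext (LinearMap.ext fun m => ?_)
    induction m using C.induction M with
    | h0 => rw [map_zero, map_zero]
    | hadd m m' h h' => rw [map_add, map_add, h, h']
    | hneg m h => rw [map_neg, map_neg, h]
    | hP x m => rw [map_smul, map_smul, h0]

theorem eq_zero_of_e_smul {M : Type*} [AddCommGroup M] [Module R M] {m : M}
    (h : ∀ u : R, C.e • u • m = 0) : m = 0 := by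
  have key : ∀ z ∈ AddSubgroup.closure {z | ∃ x y, z = x * C.e * y}, z • m = 0 := fun z hz => by
    induction hz using AddSubgroup.closure_induction with
    | mem z hz =>
      obtain ⟨x, y, rfl⟩ := hz
      rw [mul_smul, mul_smul, h, smul_zero]
    | zero => rw [zero_smul]
    | add x y _ _ hx hy => rw [add_smul, hx, hy, add_zero]
    | neg x _ hx => rw [neg_smul, hx, neg_zero]
  have := key 1 C.one_mem
  rwa [one_smul] at this

/-- Left multiplication by the idempotent. -/
def toPart (M : Type*) [AddCommGroup M] [Module R M] : M →+ C.part M where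
  toFun m := ⟨C.e • m, C.e_smul_mem m⟩
  map_zero' := Subtype.ext (smul_zero _)
  map_add' _ _ := Subtype.ext (smul_add _ _ _)

section Extension

variable {M N : Type*} [AddCommGroup M] [Module R M] [AddCommGroup N] [Module R N]
  (φ : C.part M →ₗ[B] C.part N)

/-- The graph of the extension of a homomorphism `eM → eN`. -/
def extensionGraph : Submodule R (M × N) where
  carrier := {x | ∀ u : R, φ (C.toPart M (u • x.1)) = C.toPart N (u • x.2)}
  zero_mem' u := by
    rw [Prod.fst_zero, Prod.snd_zero, smul_zero, smul_zero, map_zero, map_zero, map_zero]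
  add_mem' {x y} hx hy u := by
    rw [Prod.fst_add, Prod.snd_add, smul_add, smul_add, map_add, map_add, map_add, hx u, hy u]
  smul_mem' a x hx u := by
    rw [Prod.smul_fst, Prod.smul_snd, ← mul_smul, ← mul_smul]
    exact hx (u * a)

theorem extensionGraph_unique {m : M} {n n' : N} (hn : (m, n) ∈ C.extensionGraph φ)
    (hn' : (m, n') ∈ C.extensionGraph φ) : n = n' := by
  refine sub_eq_zero.1 (C.eq_zero_of_e_smul fun u => ?_)
  have h1 : C.toPart N (u • n) = C.toPart N (u • n') := (hn u).symm.trans (hn' u)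
  rw [smul_sub, smul_sub, sub_eq_zero]
  exact congrArg Subtype.val h1

theorem toPart_smul (u : R) (m : C.part M) : C.toPart M (u • m.1) = C.compress u • m :=
  Subtype.ext (by
    rw [coe_smul, incl_compress, mul_smul, mul_smul]
    exact congrArg (fun m => C.e • u • m) m.2.symm)

theorem mem_extensionGraph (m : C.part M) : (m.1, (φ m).1) ∈ C.extensionGraph φ := by
  intro u
  change φ (C.toPart M (u • m.1)) = C.toPart N (u • (φ m).1)
  rw [toPart_smul, toPart_smul, map_smul]

/-- The same graph argument as for strongly graded modules, with `e` in place of the projection to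
degree zero. -/
theorem exists_extend : ∃ F : M →ₗ[R] N, ∀ m : C.part M, F m.1 = (φ m).1 := by
  have hex : ∀ m, ∃ m', (m, m') ∈ C.extensionGraph φ := fun m => by
    induction m using C.induction M with
    | h0 => exact ⟨0, (C.extensionGraph φ).zero_mem⟩
    | hadd m m' h h' =>
      obtain ⟨a, ha⟩ := h
      obtain ⟨b, hb⟩ := h'
      exact ⟨a + b, (C.extensionGraph φ).add_mem ha hb⟩
    | hneg m h =>
      obtain ⟨a, ha⟩ := h
      exact ⟨-a, (C.extensionGraph φ).neg_mem ha⟩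
    | hP x m => exact ⟨_, (C.extensionGraph φ).smul_mem x (C.mem_extensionGraph φ m)⟩
  choose f hf using hex
  exact ⟨{ toFun := f
           map_add' := fun m m' => C.extensionGraph_unique φ (hf _)
             ((C.extensionGraph φ).add_mem (hf m) (hf m'))
           map_smul' := fun a m => C.extensionGraph_unique φ (hf _)
             ((C.extensionGraph φ).smul_mem a (hf m)) },
    fun m => C.extensionGraph_unique φ (hf m.1) (C.mem_extensionGraph φ m)⟩

end Extension

instance : C.partFunctor.Full where
  map_surjective {M N} φ := by
    obtain ⟨F, hF⟩ := C.exists_extend (M := M) (N := N) (ModuleCat.Hom.hom φ)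
    exact ⟨ModuleCat.ofHom F, ModuleCat.hom_ext (LinearMap.ext fun m => Subtype.ext (hF m))⟩

/-- The `B`-linear maps from `eR` to a `B`-module. -/
def Coinduced (N : Type u) [AddCommGroup N] [Module B N] : AddSubgroup (R →+ N) where
  carrier := {f | ∀ (b : B) (r : R), f (C.incl b * r) = b • f r}
  zero_mem' b _ := (smul_zero b).symm
  add_mem' {f g} hf hg b r := by
    rw [AddMonoidHom.add_apply, AddMonoidHom.add_apply, smul_add, hf b r, hg b r]
  neg_mem' {f} hf b r := by
    rw [AddMonoidHom.neg_apply, AddMonoidHom.neg_apply, smul_neg, hf b r]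

instance (N : Type u) [AddCommGroup N] [Module B N] : Module R (C.Coinduced N) where
  smul a f := ⟨f.1.comp (AddMonoidHom.mulRight a), fun b _ =>
    (congrArg f.1 (mul_assoc _ _ _)).trans (f.2 b _)⟩
  one_smul f := Subtype.ext (AddMonoidHom.ext fun b => congrArg f.1 (mul_one b))
  mul_smul a a' f := Subtype.ext (AddMonoidHom.ext fun b => congrArg f.1 (mul_assoc b a a').symm)
  smul_zero _ := rfl
  smul_add _ _ _ := rfl
  add_smul a a' f := Subtype.ext (AddMonoidHom.ext fun b =>
    (congrArg f.1 (mul_add b a a')).trans (map_add f.1 _ _))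
  zero_smul f := Subtype.ext (AddMonoidHom.ext fun b =>
    (congrArg f.1 (mul_zero b)).trans (map_zero f.1))

/-- The part `e Hom_B(eR, N)` is `Hom_B(eRe, N)`, and evaluation at `1` identifies it with `N`. Maps
on `eR` are encoded as maps `f` on `R` with `f(er) = f(r)`, which is the case `b = 1` of the
condition defining `Coinduced`. -/
instance : C.partFunctor.EssSurj where
  mem_essImage N := by
    let ev : C.part (C.Coinduced N) →ₗ[B] N :=
      { toFun := fun f => f.1.1 1
        map_add' := fun _ _ => rfl
        map_smul' := fun b f => by
          have h1 := f.1.2 b 1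
          have h2 : f.1.1 (1 * C.incl b) = f.1.1 (C.incl b * 1) := by rw [one_mul, mul_one]
          exact h2.trans h1 }
    refine ⟨ModuleCat.of R (C.Coinduced N),
      ⟨(LinearEquiv.ofBijective ev ⟨?_, fun n => ?_⟩).toModuleIso⟩⟩
    · rw [← LinearMap.ker_eq_bot, LinearMap.ker_eq_bot']
      intro f hf
      refine Subtype.ext (Subtype.ext (AddMonoidHom.ext fun r => ?_))
      have h1 : f.1.1 (r * C.e) = f.1.1 r :=
        congrArg (fun g : C.Coinduced N => g.1 r) f.2
      have h2 : f.1.1 (C.e * (r * C.e)) = f.1.1 (r * C.e) := by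
        have := f.1.2 1 (r * C.e)
        rwa [incl_one, one_smul] at this
      -- Together these give `f(r) = f(re) = f(ere) = compress r • f(1)`, so `f` is determined by
      -- `f(1)`.
      have h3 := f.1.2 (C.compress r) 1
      rw [incl_compress, mul_one, mul_assoc] at h3
      exact h1.symm.trans (h2.symm.trans (h3.trans ((congrArg _ hf).trans (smul_zero _))))
    · let f : C.Coinduced N := ⟨
        { toFun := fun r => C.compress r • n
          map_zero' := by rw [map_zero, zero_smul]
          map_add' := fun r s => by rw [map_add, add_smul] }, fun b r => by
        change C.compress (C.incl b * r) • n = b • C.compress r • n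
        rw [compress_incl_mul, mul_smul]⟩
      refine ⟨⟨f, Subtype.ext (AddMonoidHom.ext fun r => ?_)⟩, ?_⟩
      · exact congrArg (· • n) (C.compress_mul_e r)
      · exact (congrArg (· • n) C.compress_one).trans (one_smul B n)

/-- Modules over a ring are equivalent to modules over a full corner. -/
noncomputable def equivalence : ModuleCat.{u} R ≌ ModuleCat.{u} B :=
  have : C.partFunctor.IsEquivalence := { }
  C.partFunctor.asEquivalence

end CornerMap

end Corner

/-! ### The vertex idempotents of the Leavitt path algebra are not zero -/

section VertexNeZero

variable (k : Type u) [Field k] {V : Type u} [Quiver.{u} V] [Finite V]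
  [∀ i j : V, Finite (i ⟶ j)]

omit [Finite V] [∀ (i j : V), Finite (i ⟶ j)] in
theorem exists_covPath_of_length (hV : ∀ i : V, ∃ a : Arr V, a.src = i) (x : Cov V) (n : ℕ) :
    ∃ (y : Cov V) (p : Quiver.Path x y), p.length = n := by
  induction n with
  | zero => exact ⟨x, .nil, rfl⟩
  | succ n ih =>
    obtain ⟨y, p, hp⟩ := ih
    obtain ⟨a, ha⟩ := hV y.vertex
    exact ⟨_, p.cons (covArrow a y ha), congrArg Nat.succ hp⟩

/-- It suffices that `e_i` acts nontrivially on some module. The algebra acts on the saturation of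
the constant representation `k`, and `e_i` fixes the germ of the constant family `1`. This germ is
not zero, because without sinks paths of every length start at `i`. -/
theorem leavittFamily_e_ne_zero (hV : ∀ i : V, ∃ a : Arr V, a.src = i) (i : V) :
    (leavittFamily k V).e i ≠ 0 := by
  intro h0
  let X : Rep k (Cov V) := (Functor.const (Paths (Cov V))).obj (ModuleCat.of k k)
  let x : Cov V := ⟨i, 0⟩
  let φ : compatFamily X x := constFamily X x (1 : k)
  have hX := saturated_saturation X
  have hne : germ X x φ ≠ 0 := by
    intro h
    obtain ⟨m, hm⟩ := germ_eq_zero.1 h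
    obtain ⟨y, p, hp⟩ := exists_covPath_of_length hV x m
    exact one_ne_zero (α := k) (hm y p hp.ge)
  have h1 : leavittLift (k := k) (totalLeavittFamily hX) ((leavittFamily k V).e i) =
    vertexOp (saturation X) i := leavittLift_gen _ (.vertex i)
  rw [h0, map_zero] at h1
  have h2 := vertexOp_same (saturation X) x (germ X x φ)
  have h3 : inTotal (saturation X) x (germ X x φ) = 0 :=
    h2.symm.trans (congrArg (fun f => f (inTotal (saturation X) x (germ X x φ))) h1.symm)
  refine hne ((inTotal_apply_same (saturation X) x (germ X x φ)).symm.trans ?_)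
  rw [h3]
  rfl

end VertexNeZero

/-! ### Spanning sets of the Leavitt path algebra -/

namespace LeavittFamily

variable {B : Type*} [Ring B] {V : Type u} [Quiver.{u} V] (F : LeavittFamily B V)

theorem ghostVal_comp {i j l : V} (p : Quiver.Path i j) (q : Quiver.Path j l) :
    F.ghostVal (p.comp q) = F.ghostVal p * F.ghostVal q := by
  induction q with
  | nil => exact (F.coval_mul_e ⟨i, j, p⟩).symm
  | cons q a ih => rw [Quiver.Path.comp_cons, ghostVal, ih, ghostVal, mul_assoc]

theorem ghostVal_toPath {i j : V} (a : i ⟶ j) : F.ghostVal a.toPath = F.ghost ⟨i, j, a⟩ :=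
  F.e_mul_ghost ⟨i, j, a⟩

end LeavittFamily

section Span

variable (k : Type u) [Field k] {V : Type u} [Quiver.{u} V] [Finite V]
  [∀ i j : V, Finite (i ⟶ j)]

/-- The span of the elements `q^*p` contains `1` and is stable under left multiplication by
generators. The one real case is `a q^*p`: if `q` begins with an arrow `b`, then `ab^*` is an
idempotent or zero; if `q` is trivial, `a` is absorbed into `p` or the product is zero. -/
theorem mem_span_coval_mul_val (x : LeavittAlg k V) :
    x ∈ Submodule.span k {z | ∃ p q : Pth V, p.tgt = q.tgt ∧
      z = (leavittFamily k V).coval q * (leavittFamily k V).val p} := by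
  let F := leavittFamily k V
  set T := Submodule.span k {z | ∃ p q : Pth V, p.tgt = q.tgt ∧ z = F.coval q * F.val p}
  have key : ∀ y : LeavittAlg k V, (∀ p q : Pth V, p.tgt = q.tgt →
      y * (F.coval q * F.val p) ∈ T) → ∀ x ∈ T, y * x ∈ T := by
    intro y hy x hx
    induction hx using Submodule.span_induction with
    | mem x hx =>
      obtain ⟨p, q, h, rfl⟩ := hx
      exact hy p q h
    | zero => rw [mul_zero]; exact zero_mem _
    | add x x' _ _ h h' => rw [mul_add]; exact add_mem h h'
    | smul c x _ h => rw [mul_smul_comm]; exact Submodule.smul_mem _ c h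
  induction x using LeavittAlg.induction with
  | h0 => exact zero_mem _
  | hadd x y h h' => exact add_mem h h'
  | hsmul c x h => exact Submodule.smul_mem _ c h
  | h1 =>
    have := Fintype.ofFinite V
    rw [← F.sum_e, finsum_eq_sum_of_fintype]
    exact sum_mem fun i _ => Submodule.subset_span
      ⟨Pth.nil i, Pth.nil i, rfl, (F.e_mul_self i).symm⟩
  | he i x h =>
    refine key _ (fun p q hpq => ?_) x h
    by_cases hi : i = q.src
    · rw [hi, ← mul_assoc]
      exact Submodule.subset_span ⟨p, q, hpq, congrArg (· * _) (F.e_mul_coval q)⟩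
    · have : F.e i * (F.coval q * F.val p) = 0 := by
        rw [← F.e_mul_coval q, ← mul_assoc, ← mul_assoc, F.e_mul_ne _ _ hi, zero_mul, zero_mul]
      exact this ▸ zero_mem _
  | hs a x h =>
    refine key _ (fun p q hpq => ?_) x h
    by_cases hi : a.tgt = q.src
    · obtain ⟨i, j, a⟩ := a
      obtain ⟨j', l, q⟩ := q
      obtain rfl : j = j' := hi
      refine Submodule.subset_span ⟨p, ⟨i, l, a.toPath.comp q⟩, hpq, ?_⟩
      rw [← mul_assoc]
      refine congrArg (· * F.val p) ?_
      exact ((F.ghostVal_comp a.toPath q).trans (congrArg (· * _) (F.ghostVal_toPath a))).symm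
    · have : F.ghost a * (F.coval q * F.val p) = 0 := by
        rw [← F.e_mul_coval q, ← F.ghost_mul_e a, ← mul_assoc, ← mul_assoc, mul_assoc (F.ghost a),
          F.e_mul_ne _ _ hi, mul_zero, zero_mul, zero_mul]
      exact this ▸ zero_mem _
  | ha a x h =>
    refine key _ (fun p q hpq => ?_) x h
    obtain ⟨i, j, q⟩ := q
    obtain ⟨i', j', p⟩ := p
    obtain rfl : j' = j := hpq
    rcases path_eq_nil_or_comp q with hq | ⟨l, b, q, rfl⟩
    · cases q with
      | cons q b => exact absurd hq (Nat.succ_ne_zero _)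
      | nil =>
        obtain ⟨s, t, a⟩ := a
        have e1 : F.coval ⟨i, i, .nil⟩ * F.val ⟨i', i, p⟩ = F.val ⟨i', i, p⟩ :=
          F.e_mul_val ⟨i', i, p⟩
        rw [e1]
        by_cases hi : s = i
        · subst hi
          refine Submodule.subset_span ⟨⟨i', t, p.cons a⟩, Pth.nil t, rfl, ?_⟩
          exact (F.e_mul_val ⟨i', t, p.cons a⟩).symm
        · have : F.arr ⟨s, t, a⟩ * F.val ⟨i', i, p⟩ = 0 := by
            rw [← F.e_mul_val, ← F.arr_mul_e, ← mul_assoc, mul_assoc (F.arr _),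
              F.e_mul_ne _ _ hi, mul_zero, zero_mul]
          exact this ▸ zero_mem _
    · have e1 : F.coval ⟨i, j', b.toPath.comp q⟩ = F.ghost ⟨i, l, b⟩ * F.coval ⟨l, j', q⟩ :=
        (F.ghostVal_comp b.toPath q).trans (congrArg (· * _) (F.ghostVal_toPath b))
      change F.arr a * (F.coval ⟨i, j', b.toPath.comp q⟩ * _) ∈ T
      rw [e1, mul_assoc, ← mul_assoc]
      by_cases hab : a = ⟨i, l, b⟩
      · rw [hab, F.arr_mul_ghost_self, ← mul_assoc]
        exact Submodule.subset_span ⟨⟨i', j', p⟩, ⟨l, j', q⟩, rfl,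
          congrArg (· * _) (F.e_mul_coval ⟨l, j', q⟩)⟩
      · rw [F.arr_mul_ghost_ne _ _ hab, zero_mul]
        exact zero_mem _

/-- Projecting to degree zero keeps those `q^*p` for which both paths have the same length and kills
the others. -/
theorem mem_span_coval_mul_val_zero {x : LeavittAlg k V} (hx : x ∈ leavittGrade k V 0) :
    x ∈ Submodule.span k {z | ∃ (n : ℕ) (p q : PthN V n), p.1.tgt = q.1.tgt ∧
      z = (leavittFamily k V).coval q.1 * (leavittFamily k V).val p.1} := by
  have key : gradeProj (leavittGrade k V) 0 x ∈ Submodule.span k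
      {z | ∃ (n : ℕ) (p q : PthN V n), p.1.tgt = q.1.tgt ∧
        z = (leavittFamily k V).coval q.1 * (leavittFamily k V).val p.1} := by
    have h := mem_span_coval_mul_val k x
    clear hx
    induction h using Submodule.span_induction with
    | zero => rw [map_zero]; exact zero_mem _
    | add x y _ _ h h' => rw [map_add]; exact add_mem h h'
    | smul c x _ h =>
      have : gradeProj (leavittGrade k V) 0 (c • x) = c • gradeProj (leavittGrade k V) 0 x := by
        change ((DirectSum.decompose (leavittGrade k V) (c • x) 0 : leavittGrade k V 0) :
          LeavittAlg k V) = _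
        rw [DirectSum.decompose_smul]
        rfl
      rw [this]
      exact Submodule.smul_mem _ c h
    | mem x hx =>
      obtain ⟨p, q, hpq, rfl⟩ := hx
      have hmem := SetLike.GradedMul.mul_mem (coval_mem k q) (val_mem k p)
      by_cases h : p.length = q.length
      · rw [h, neg_add_cancel] at hmem
        rw [gradeProj_same hmem]
        exact Submodule.subset_span ⟨q.length, ⟨p, h⟩, ⟨q, rfl⟩, hpq, rfl⟩
      · rw [gradeProj_ne hmem (by omega)]
        exact zero_mem _
  rwa [gradeProj_same hx] at key

end Span

/-! ### Elements of the ultramatricial algebra -/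

section Ultramatricial

variable {k : Type u} [Field k] {V : Type u} [Quiver.{u} V]

theorem transition_self (n : ℕ) (f : Sn k V n) : transition k V n n le_rfl f = f :=
  DirectedSystem.map_self' (transition k V) f

theorem transition_succ {m n : ℕ} (h : m ≤ n) (f : Sn k V m) :
    transition k V m (n + 1) (Nat.le_succ_of_le h) f = theta k n (transition k V m n h f) := by
  have e := Nat.leRec_succ (motive := fun l _ => Sn k V m →+* Sn k V l) (RingHom.id _)
    (fun n _ g => (theta k n).comp g) h (h2 := Nat.le_succ_of_le h)
  exact congrArg (fun g : Sn k V m →+* Sn k V (n + 1) => g f) e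

variable (k V) in
/-- The canonical homomorphism to the direct limit. -/
noncomputable def toSAlg (n : ℕ) : Sn k V n →+* SAlg k V where
  toFun f := (⟦⟨n, f⟩⟧ : DirectLimit (Sn k V) (transition k V))
  map_one' := (DirectLimit.one_def n).symm
  map_mul' f g := (DirectLimit.mul_def n f g).symm
  map_zero' := (DirectLimit.zero_def n).symm
  map_add' f g := (DirectLimit.add_def n f g).symm

theorem toSAlg_theta (n : ℕ) (f : Sn k V n) : toSAlg k V (n + 1) (theta k n f) = toSAlg k V n f := by
  have h := transition_succ (le_refl n) f
  rw [transition_self] at h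
  rw [← h]
  exact DirectLimit.mk_apply (f := transition k V) n (n + 1) f (Nat.le_succ n)

theorem exists_toSAlg (x : SAlg k V) : ∃ n f, x = toSAlg k V n f := DirectLimit.exists_eq_mk _ x

theorem exists_toSAlg₂ (x y : SAlg k V) : ∃ n f g, x = toSAlg k V n f ∧ y = toSAlg k V n g :=
  DirectLimit.exists_eq_mk₂ _ x y

/-- Additive maps out of the direct limit. -/
noncomputable def SAlg.lift {W : Type*} [AddCommGroup W] (g : ∀ n, Sn k V n →+ W)
    (h : ∀ n f, g (n + 1) (theta k n f) = g n f) : SAlg k V →+ W :=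
  AddMonoidHom.mk' (DirectLimit.lift (transition k V) (fun n f => g n f) fun m n hmn f => by
    induction hmn with
    | refl => exact congrArg (g m) (transition_self m f).symm
    | step hmn ih => exact ih.trans ((h _ _).symm.trans (congrArg (g _) (transition_succ hmn f).symm)))
  fun x y => by
    obtain ⟨n, f, g', rfl, rfl⟩ := exists_toSAlg₂ x y
    rw [← map_add]
    exact map_add (g n) f g'

theorem Sn.ext {n : ℕ} {f g : Sn k V n} (h : ∀ p, f (KQn.of p) = g (KQn.of p)) : f = g :=
  LinearMap.ext fun x => LinearMap.congr_fun
    (KQn.hom_ext k (f := f.restrictScalars k) (g := g.restrictScalars k) h) x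

/-- The `kI`-linear endomorphism with prescribed values on paths. -/
noncomputable def Sn.ofFun {n : ℕ} (g : PthN V n → KQn k V n)
    (h : ∀ p (c : V → k), c • g p = c p.1.tgt • g p) : Sn k V n where
  toFun := KQn.lift g
  map_add' := map_add _
  map_smul' c x := by
    have : (KQn.lift (k := k) g).comp (Algebra.lsmul k k (KQn k V n) c) =
        (Algebra.lsmul k k (KQn k V n) c).comp (KQn.lift g) := by
      refine KQn.hom_ext k fun p => ?_
      simp only [LinearMap.coe_comp, Function.comp_apply, Algebra.lsmul_coe, KQn.lift_of,
        KQn.smul_of, map_smul, h]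
    exact LinearMap.congr_fun this x

theorem Sn.ofFun_of {n : ℕ} (g : PthN V n → KQn k V n)
    (h : ∀ p (c : V → k), c • g p = c p.1.tgt • g p) (p : PthN V n) :
    Sn.ofFun g h (KQn.of p) = g p := KQn.lift_of k g p

open Classical in
variable (k) in
/-- The matrix unit that maps the path `q` to the path `p`. -/
noncomputable def matUnit {n : ℕ} (p q : PthN V n) (h : p.1.tgt = q.1.tgt) : Sn k V n :=
  Sn.ofFun (fun r => if r = q then KQn.of p else 0) fun r c => by
    split_ifs with hr
    · rw [KQn.smul_of, h, hr]
    · rw [smul_zero, smul_zero]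

theorem matUnit_same {n : ℕ} (p q : PthN V n) (h : p.1.tgt = q.1.tgt) :
    matUnit k p q h (KQn.of q) = KQn.of p := by
  rw [matUnit, Sn.ofFun_of, if_pos rfl]

theorem matUnit_ne {n : ℕ} (p q : PthN V n) (h : p.1.tgt = q.1.tgt) {r : PthN V n} (hr : r ≠ q) :
    matUnit k p q h (KQn.of r) = 0 := by
  rw [matUnit, Sn.ofFun_of, if_neg hr]

theorem exists_consPath {n : ℕ} (p : PthN V (n + 1)) :
    ∃ (a : Arr V) (q : PthN V n) (h : q.1.tgt = a.src), p = consPath a q h :=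
  ⟨_, _, _, (consPath_init p).symm⟩

theorem of_consPath {n : ℕ} (a : Arr V) (p : PthN V n) (h : p.1.tgt = a.src) :
    (KQn.of (consPath a p h) : KQn k V (n + 1)) = arrowMul k n a (KQn.of p) := by
  rw [arrowMul, KQn.lift_of, dif_pos h]

theorem theta_arrowMul {n : ℕ} (f : Sn k V n) (a : Arr V) (x : KQn k V n) :
    theta k n f (arrowMul k n a x) = arrowMul k n a (f x) := thetaLin_arrowMul k n f a x

/-- After `m` transition maps `f` acts on a path of length `n + m` through its first `n` arrows. The
end of that initial part is alive for `m` more steps, so `f` vanishes on it. -/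
theorem toSAlg_eq_zero {n : ℕ} (m : ℕ) {f : Sn k V n}
    (h : ∀ p : PthN V n, p.1.tgt ∈ alive V m → f (KQn.of p) = 0) : toSAlg k V n f = 0 := by
  induction m generalizing n with
  | zero =>
    have : f = 0 := Sn.ext fun p => h p trivial
    rw [this, map_zero]
  | succ m ih =>
    rw [← toSAlg_theta]
    refine ih fun p hp => ?_
    obtain ⟨a, q, hq, rfl⟩ := exists_consPath p
    rw [of_consPath, theta_arrowMul, h q ⟨a, hq.symm, hp⟩, map_zero]

/-- The coefficient of an element of `kQ_n` at a path. -/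
def KQn.coeff {n : ℕ} (p : PthN V n) : KQn k V n →ₗ[k] k :=
  (Finsupp.lapply p : (PthN V n →₀ k) →ₗ[k] k)

theorem KQn.coeff_same {n : ℕ} (p : PthN V n) : KQn.coeff p (KQn.of p : KQn k V n) = 1 :=
  Finsupp.single_eq_same

theorem KQn.coeff_ne {n : ℕ} {p q : PthN V n} (h : p ≠ q) :
    KQn.coeff p (KQn.of q : KQn k V n) = 0 :=
  Finsupp.single_eq_of_ne h

end Ultramatricial

/-! ### Paths in the core -/

section CorePaths

variable {V : Type u} [Quiver.{u} V]

/-- The inclusion of the core. -/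
def coreVertexIncl (V : Type u) [Quiver.{u} V] : CoreVertex V ⥤q V where
  obj i := i.1
  map a := a

/-- A path of the core as a path of the quiver. -/
def corePath {n : ℕ} (p : PthN (CoreVertex V) n) : PthN V n :=
  ⟨⟨p.1.src.1, p.1.tgt.1, (coreVertexIncl V).mapPath p.1.path⟩,
    (length_mapPath (coreVertexIncl V) p.1.path).trans p.2⟩

theorem corePath_tgt {n : ℕ} (p : PthN (CoreVertex V) n) : (corePath p).1.tgt = p.1.tgt.1 := rfl

theorem corePath_tgt_eq {n : ℕ} {a : Arr (CoreVertex V)} {p : PthN (CoreVertex V) n}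
    (h : p.1.tgt = a.src) : (corePath p).1.tgt = (coreArr a).src :=
  congrArg (fun i : CoreVertex V => i.1) h

theorem corePath_consPath {n : ℕ} (a : Arr (CoreVertex V)) (p : PthN (CoreVertex V) n)
    (h : p.1.tgt = a.src) :
    corePath (consPath a p h) = consPath (coreArr a) (corePath p) (corePath_tgt_eq h) := by
  obtain ⟨⟨c, d, p⟩, hp⟩ := p
  obtain ⟨e, f, a⟩ := a
  obtain rfl : d = e := h
  rfl

theorem corePath_injective (n : ℕ) :
    Function.Injective (corePath : PthN (CoreVertex V) n → PthN V n) := by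
  induction n with
  | zero =>
    intro p q h
    obtain ⟨i, rfl⟩ := (nilEquiv _).surjective p
    obtain ⟨j, rfl⟩ := (nilEquiv _).surjective q
    have : i = j := Subtype.ext (congrArg (fun p : PthN V 0 => p.1.src) h)
    rw [this]
  | succ n ih =>
    intro p q h
    obtain ⟨a, p, hp, rfl⟩ := exists_consPath p
    obtain ⟨b, q, hq, rfl⟩ := exists_consPath q
    rw [corePath_consPath, corePath_consPath] at h
    have h1 := congrArg lastArrow h
    have h2 := congrArg initPath h
    rw [last_consPath, last_consPath] at h1
    rw [init_consPath, init_consPath] at h2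
    obtain rfl := coreArr_injective h1
    obtain rfl := ih h2
    rfl

theorem tgt_mem_coalive {n : ℕ} (p : PthN V n) : p.1.tgt ∈ coalive V n := by
  induction n with
  | zero => trivial
  | succ n ih =>
    obtain ⟨a, p, h, rfl⟩ := exists_consPath p
    exact ⟨a, rfl, h ▸ ih p⟩

variable [Finite V]

theorem tgt_mem_coalive_of_core {n : ℕ} (p : PthN V n) (hp : p.1.src ∈ coreSet V) (m : ℕ) :
    p.1.tgt ∈ coalive V m := by
  induction n generalizing m with
  | zero =>
    obtain ⟨i, rfl⟩ := (nilEquiv V).surjective p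
    exact core_subset_coalive m hp
  | succ n ih =>
    obtain ⟨a, p, h, rfl⟩ := exists_consPath p
    cases m with
    | zero => trivial
    | succ m => exact ⟨a, rfl, h ▸ ih p hp m⟩

/-- Convexity of the core again, now for bundled paths of the quiver itself. -/
theorem exists_corePath_of_alive {n : ℕ} (p : PthN V n) (hp : p.1.src ∈ coreSet V)
    (hp' : ∀ m, p.1.tgt ∈ alive V m) : ∃ q, corePath q = p := by
  induction n with
  | zero =>
    obtain ⟨i, rfl⟩ := (nilEquiv V).surjective p
    exact ⟨⟨Pth.nil ⟨i, hp⟩, rfl⟩, rfl⟩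
  | succ n ih =>
    have htgt := mem_core_of_alive_of_coalive hp' (tgt_mem_coalive_of_core p hp)
    obtain ⟨a, p, h, rfl⟩ := exists_consPath p
    obtain ⟨q, rfl⟩ := ih p hp fun m => h ▸ alive_antitone m.le_succ ⟨a, rfl, hp' m⟩
    obtain ⟨b, rfl⟩ := exists_coreArr a (h ▸ q.1.tgt.2) htgt
    exact ⟨consPath b q (Subtype.ext h), corePath_consPath _ _ _⟩

theorem exists_corePath {n : ℕ} (p : PthN V n) (hp : p.1.src ∈ coreSet V)
    (hp' : p.1.tgt ∈ coreSet V) : ∃ q, corePath q = p :=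
  exists_corePath_of_alive p hp fun m => core_subset_alive m hp'

end CorePaths

/-! ### The map from the ultramatricial algebra to the Leavitt path algebra -/

section Compression

variable {k : Type u} [Field k] {V : Type u} [Quiver.{u} V] [Finite V]
  [∀ i j : V, Finite (i ⟶ j)]

variable (k V) in
/-- The Leavitt family of the core. -/
noncomputable abbrev coreFamily : LeavittFamily (LeavittAlg k (CoreVertex V)) (CoreVertex V) :=
  leavittFamily k (CoreVertex V)

open Classical in
/-- The values of paths in the Leavitt path algebra of the core, where a path that does not lie in
the core has the value zero. -/
noncomputable def coreVal (n : ℕ) : KQn k V n →ₗ[k] LeavittAlg k (CoreVertex V) :=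
  KQn.lift fun p => if h : ∃ q, corePath q = p then (coreFamily k V).val h.choose.1 else 0

theorem coreVal_corePath {n : ℕ} (p : PthN (CoreVertex V) n) :
    coreVal n (KQn.of (corePath p) : KQn k V n) = (coreFamily k V).val p.1 := by
  have h : ∃ q, corePath q = corePath p := ⟨p, rfl⟩
  rw [coreVal, KQn.lift_of, dif_pos h, corePath_injective n h.choose_spec]

theorem coreVal_ne {n : ℕ} {p : PthN V n} (h : ¬ ∃ q, corePath q = p) :
    coreVal n (KQn.of p : KQn k V n) = 0 := by
  rw [coreVal, KQn.lift_of, dif_neg h]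

theorem coreVal_arrowMul {n : ℕ} (a : Arr (CoreVertex V)) (x : KQn k V n) :
    coreVal (n + 1) (arrowMul k n (coreArr a) x) = (coreFamily k V).arr a * coreVal n x := by
  have : (coreVal (n + 1)).comp (arrowMul k n (coreArr a)) =
      (LinearMap.mulLeft k ((coreFamily k V).arr a)).comp (coreVal n) := by
    refine KQn.hom_ext k fun p => ?_
    change coreVal (n + 1) (arrowMul k n (coreArr a) (KQn.of p)) =
      (coreFamily k V).arr a * coreVal n (KQn.of p)
    by_cases hp : ∃ q, corePath q = p
    · obtain ⟨q, rfl⟩ := hp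
      rw [coreVal_corePath]
      by_cases h : q.1.tgt = a.src
      · rw [← of_consPath (coreArr a) (corePath q) (corePath_tgt_eq h), ← corePath_consPath a q h,
          coreVal_corePath, LeavittFamily.val_consPath]
      · rw [← (coreFamily k V).e_mul_val, ← (coreFamily k V).arr_mul_e, mul_assoc,
          ← mul_assoc ((coreFamily k V).e _), (coreFamily k V).e_mul_ne _ _ (Ne.symm h), zero_mul,
          mul_zero]
        have h' : (corePath q).1.tgt ≠ (coreArr a).src := fun h' => h (Subtype.ext h')
        rw [arrowMul, KQn.lift_of, dif_neg h', map_zero]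
    · rw [coreVal_ne hp, mul_zero]
      by_cases h : p.1.tgt = (coreArr a).src
      · rw [← of_consPath _ _ h]
        refine coreVal_ne ?_
        rintro ⟨q, hq⟩
        obtain ⟨b, q, hq', rfl⟩ := exists_consPath q
        rw [corePath_consPath] at hq
        have := congrArg initPath hq
        rw [init_consPath, init_consPath] at this
        exact hp ⟨q, this⟩
      · rw [arrowMul, KQn.lift_of, dif_neg h, map_zero]
  exact LinearMap.congr_fun this x

theorem coreVal_mem {n : ℕ} (x : KQn k V n) : coreVal n x ∈ leavittGrade k (CoreVertex V) n := by
  suffices h : LinearMap.range (coreVal n : KQn k V n →ₗ[k] _) ≤ leavittGrade k (CoreVertex V) n from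
    h ⟨x, rfl⟩
  have htop : Submodule.span k (Set.range (KQn.of : PthN V n → KQn k V n)) = ⊤ :=
    (Finsupp.basisSingleOne (R := k) (ι := PthN V n)).span_eq ▸
      congrArg (fun s => Submodule.span k s) (by
        ext y
        refine exists_congr fun p => ?_
        rw [Finsupp.coe_basisSingleOne]
        rfl)
  rw [LinearMap.range_eq_map, ← htop, Submodule.map_span_le]
  rintro _ ⟨p, rfl⟩
  by_cases hp : ∃ q, corePath q = p
  · obtain ⟨⟨q, rfl⟩, rfl⟩ := hp
    rw [coreVal_corePath]
    exact val_mem k q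
  · rw [coreVal_ne hp]
    exact zero_mem _

-- A `kI`-linear endomorphism preserves the end of a path, so coefficients that are `1` there act
-- trivially on the image.
omit [Finite V] [∀ (i j : V), Finite (i ⟶ j)] in
theorem smul_of_tgt {n : ℕ} (c : V → k) (p : PthN V n) (h : c p.1.tgt = 1) (f : Sn k V n) :
    c • f (KQn.of p) = f (KQn.of p) := by
  rw [← map_smul, KQn.smul_of, h, one_smul]

open Classical in
theorem e_mul_coreVal {n : ℕ} (i : CoreVertex V) (x : KQn k V n) :
    (coreFamily k V).e i * coreVal n x = coreVal n ((Pi.single i.1 1 : V → k) • x) := by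
  have : (LinearMap.mulLeft k ((coreFamily k V).e i)).comp (coreVal n) =
      (coreVal n).comp (Algebra.lsmul k k (KQn k V n) (Pi.single i.1 1 : V → k)) := by
    refine KQn.hom_ext k fun p => ?_
    change (coreFamily k V).e i * coreVal n (KQn.of p) =
      coreVal n ((Pi.single i.1 1 : V → k) • KQn.of p)
    rw [KQn.smul_of, map_smul]
    by_cases hp : ∃ q, corePath q = p
    · obtain ⟨q, rfl⟩ := hp
      rw [coreVal_corePath]
      by_cases h : i = q.1.tgt
      · rw [h, LeavittFamily.e_mul_val, corePath_tgt, Pi.single_eq_same, one_smul]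
      · rw [← LeavittFamily.e_mul_val, ← mul_assoc, (coreFamily k V).e_mul_ne _ _ h, zero_mul,
          corePath_tgt, Pi.single_eq_of_ne fun h' => h (Subtype.ext h'.symm), zero_smul]
    · rw [coreVal_ne hp, mul_zero, smul_zero]
  exact LinearMap.congr_fun this x

theorem e_mul_coreVal_apply {n : ℕ} (f : Sn k V n) (p : PthN (CoreVertex V) n) :
    (coreFamily k V).e p.1.tgt * coreVal n (f (KQn.of (corePath p))) =
      coreVal n (f (KQn.of (corePath p))) := by
  classical
  rw [e_mul_coreVal, smul_of_tgt _ _ (Pi.single_eq_same _ _)]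

-- Orthogonality of paths of equal length lets right multiplication by `p^*` read off the
-- coefficient at `p`. Both multiplicativity and injectivity of the compression rest on this.
open Classical in
theorem coreVal_mul_coval {n : ℕ} (x : KQn k V n) (p : PthN (CoreVertex V) n) :
    coreVal n x * (coreFamily k V).coval p.1 =
      KQn.coeff (corePath p) x • (coreFamily k V).e p.1.tgt := by
  have : (LinearMap.mulRight k ((coreFamily k V).coval p.1)).comp (coreVal n) =
      (KQn.coeff (k := k) (corePath p)).smulRight ((coreFamily k V).e p.1.tgt) := by
    refine KQn.hom_ext k fun q => ?_
    change coreVal n (KQn.of q) * (coreFamily k V).coval p.1 =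
      KQn.coeff (corePath p) (KQn.of q : KQn k V n) • (coreFamily k V).e p.1.tgt
    by_cases hq : ∃ r, corePath r = q
    · obtain ⟨r, rfl⟩ := hq
      rw [coreVal_corePath]
      by_cases h : r = p
      · rw [h, KQn.coeff_same, one_smul, LeavittFamily.val_mul_coval_self]
      · rw [KQn.coeff_ne fun h' => h (corePath_injective n h').symm, zero_smul,
          LeavittFamily.val_mul_coval_ne _ (r.2.trans p.2.symm) fun h' => h (Subtype.ext h')]
    · rw [coreVal_ne hq, zero_mul, KQn.coeff_ne (fun h => hq ⟨p, h⟩), zero_smul]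
  exact LinearMap.congr_fun this x

open Classical in
variable (k V) in
/-- The projection of `kQ_n` onto the span of the paths that start in the core. -/
noncomputable def coreIdem (n : ℕ) : Sn k V n :=
  Sn.ofFun (fun p => if p.1.src ∈ coreSet V then KQn.of p else 0) fun p c => by
    split_ifs
    · exact KQn.smul_of k c p
    · rw [smul_zero, smul_zero]

omit [Finite V] [∀ (i j : V), Finite (i ⟶ j)] in
theorem coreIdem_of {n : ℕ} {p : PthN V n} (h : p.1.src ∈ coreSet V) :
    coreIdem k V n (KQn.of p) = KQn.of p := by
  rw [coreIdem, Sn.ofFun_of, if_pos h]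

omit [Finite V] [∀ (i j : V), Finite (i ⟶ j)] in
theorem coreIdem_of_ne {n : ℕ} {p : PthN V n} (h : p.1.src ∉ coreSet V) :
    coreIdem k V n (KQn.of p) = 0 := by
  rw [coreIdem, Sn.ofFun_of, if_neg h]

omit [Finite V] [∀ (i j : V), Finite (i ⟶ j)] in
theorem coreIdem_mul_self (n : ℕ) : coreIdem k V n * coreIdem k V n = coreIdem k V n :=
  Sn.ext fun p => by
    rw [Module.End.mul_apply]
    by_cases h : p.1.src ∈ coreSet V
    · rw [coreIdem_of h, coreIdem_of h]
    · rw [coreIdem_of_ne h, map_zero]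

omit [Finite V] [∀ (i j : V), Finite (i ⟶ j)] in
theorem theta_coreIdem (n : ℕ) : theta k n (coreIdem k V n) = coreIdem k V (n + 1) :=
  Sn.ext fun p => by
    obtain ⟨a, q, hq, rfl⟩ := exists_consPath p
    by_cases h : q.1.src ∈ coreSet V
    · rw [coreIdem_of (p := consPath a q hq) h, of_consPath, theta_arrowMul, coreIdem_of h]
    · rw [coreIdem_of_ne (p := consPath a q hq) h, of_consPath, theta_arrowMul, coreIdem_of_ne h,
        map_zero]

omit [Finite V] [∀ (i j : V), Finite (i ⟶ j)] in
theorem toSAlg_coreIdem (n : ℕ) : toSAlg k V n (coreIdem k V n) = toSAlg k V 0 (coreIdem k V 0) := by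
  induction n with
  | zero => rfl
  | succ n ih => rw [← theta_coreIdem, toSAlg_theta, ih]

noncomputable instance (n : ℕ) : Fintype (PthN V n) := Fintype.ofFinite _

open Classical in
variable (k V) in
/-- The element of `kI` that is the sum of the trivial paths at the vertices of the core. -/
noncomputable def coreIndicator : V → k := fun i => if i ∈ coreSet V then 1 else 0

omit [Finite V] [∀ (i j : V), Finite (i ⟶ j)] in
theorem coreIndicator_of_mem {i : V} (h : i ∈ coreSet V) : coreIndicator k V i = 1 := if_pos h

omit [Finite V] [∀ (i j : V), Finite (i ⟶ j)] in
theorem coreIndicator_of_notMem {i : V} (h : i ∉ coreSet V) : coreIndicator k V i = 0 := if_neg h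

/-- The indicator selects the paths that end in the core and `coreIdem` those that start there. By
convexity a path with both properties is a path of the core. -/
theorem coreIdem_indicator_smul_of {n : ℕ} (q : PthN V n) :
    coreIdem k V n (coreIndicator k V • (KQn.of q : KQn k V n)) =
      ∑ p : PthN (CoreVertex V) n,
        KQn.coeff (corePath p) (KQn.of q : KQn k V n) • (KQn.of (corePath p) : KQn k V n) := by
  rw [KQn.smul_of]
  by_cases hq : ∃ r, corePath r = q
  · obtain ⟨r, rfl⟩ := hq
    have hs : (corePath r).1.src ∈ coreSet V := r.1.src.2
    have ht : (corePath r).1.tgt ∈ coreSet V := r.1.tgt.2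
    rw [coreIndicator_of_mem ht, one_smul, coreIdem_of hs,
      Finset.sum_eq_single_of_mem r (Finset.mem_univ _), KQn.coeff_same, one_smul]
    intro p _ hp
    rw [KQn.coeff_ne fun h => hp (corePath_injective n h), zero_smul]
  · rw [Finset.sum_eq_zero fun p _ => by rw [KQn.coeff_ne fun h => hq ⟨p, h⟩, zero_smul]]
    by_cases ht : q.1.tgt ∈ coreSet V
    · rw [coreIndicator_of_mem ht, one_smul,
        coreIdem_of_ne fun hs => hq (exists_corePath q hs ht)]
    · rw [coreIndicator_of_notMem ht, zero_smul, map_zero]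

theorem coreIdem_smul {n : ℕ} (x : KQn k V n) : coreIdem k V n (coreIndicator k V • x) =
    ∑ p : PthN (CoreVertex V) n, KQn.coeff (corePath p) x • (KQn.of (corePath p) : KQn k V n) := by
  have : ((coreIdem k V n).restrictScalars k).comp
      (Algebra.lsmul k k (KQn k V n) (coreIndicator k V)) =
      ∑ p : PthN (CoreVertex V) n,
        (KQn.coeff (corePath p)).smulRight (KQn.of (corePath p) : KQn k V n) := by
    refine KQn.hom_ext k fun q => ?_
    rw [LinearMap.sum_apply]
    exact coreIdem_indicator_smul_of q
  refine (LinearMap.congr_fun this x).trans ?_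
  rw [LinearMap.sum_apply]
  rfl

theorem coreIdem_apply {n : ℕ} (f : Sn k V n) (q : PthN (CoreVertex V) n) :
    coreIdem k V n (f (KQn.of (corePath q))) = ∑ p : PthN (CoreVertex V) n,
      KQn.coeff (corePath p) (f (KQn.of (corePath q))) • KQn.of (corePath p) := by
  rw [← coreIdem_smul, smul_of_tgt]
  exact if_pos q.1.tgt.2

/-- The map `S_n → L` that maps the matrix unit with row `p` and column `q` to `q^* p`, for paths in
the core. -/
noncomputable def compressN (n : ℕ) : Sn k V n →ₗ[k] LeavittAlg k (CoreVertex V) where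
  toFun f := ∑ q : PthN (CoreVertex V) n,
    (coreFamily k V).coval q.1 * coreVal n (f (KQn.of (corePath q)))
  map_add' f g := by
    simp only [LinearMap.add_apply, map_add, mul_add, Finset.sum_add_distrib]
  map_smul' c f := by
    simp only [LinearMap.smul_apply, map_smul, mul_smul_comm, Finset.smul_sum, RingHom.id_apply]

theorem compressN_apply {n : ℕ} (f : Sn k V n) : compressN n f = ∑ q : PthN (CoreVertex V) n,
    (coreFamily k V).coval q.1 * coreVal n (f (KQn.of (corePath q))) := rfl

theorem compressN_mem {n : ℕ} (f : Sn k V n) : compressN n f ∈ leavittGrade k (CoreVertex V) 0 := by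
  refine sum_mem fun q _ => ?_
  have h := SetLike.GradedMul.mul_mem (coval_mem k q.1)
    (coreVal_mem (f (KQn.of (corePath q))))
  rwa [show q.1.length = n from q.2, neg_add_cancel] at h

/-- Each summand `q^* f(q)` is split by inserting `∑ a^*a` over the core arrows `a` out of the end
of `q`. The resulting terms `(aq)^* a f(q)` are those of `θ(f)`. -/
theorem compressN_theta (n : ℕ) (f : Sn k V n) :
    compressN (n + 1) (theta k n f) = compressN n f := by
  have : ∀ p : PthN (CoreVertex V) n, Fintype {a : Arr (CoreVertex V) // a.src = p.1.tgt} :=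
    fun p => Fintype.ofFinite _
  rw [compressN_apply, compressN_apply, ← (consEquiv (CoreVertex V) n).sum_comp,
    Fintype.sum_sigma]
  refine Finset.sum_congr rfl fun p _ => ?_
  rw [← (coreFamily k V).sum_coval_cons (exists_arrow_core V) p.1 (e_mul_coreVal_apply f p),
    finsum_eq_sum_of_fintype]
  refine Finset.sum_congr rfl fun a _ => ?_
  refine congrArg₂ (· * ·) ((coreFamily k V).coval_consPath _ _ _) ?_
  change coreVal (n + 1) (theta k n f (KQn.of (corePath (consPath a.1 p a.2.symm)))) = _
  rw [corePath_consPath, of_consPath, theta_arrowMul, coreVal_arrowMul]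

/-- The order is reversed: matrix units compose as `(q → p)(s → r)`, nonzero when `q = r`, and their
images satisfy `(s^*r)(q^*p) = s^*p` in that case. The idempotent in the middle restricts the
intermediate paths to those of the core. -/
theorem compressN_mul {n : ℕ} (f g : Sn k V n) :
    compressN n (f * coreIdem k V n * g) = compressN n g * compressN n f := by
  rw [compressN_apply, compressN_apply, compressN_apply, Finset.sum_mul]
  refine Finset.sum_congr rfl fun q _ => ?_
  rw [Module.End.mul_apply, Module.End.mul_apply, coreIdem_apply, mul_assoc, Finset.mul_sum,
    map_sum, map_sum]
  refine congrArg _ (Finset.sum_congr rfl fun p _ => ?_)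
  rw [← mul_assoc, coreVal_mul_coval, smul_mul_assoc, e_mul_coreVal_apply]
  have : f (KQn.coeff (corePath p) (g (KQn.of (corePath q))) • KQn.of (corePath p)) =
      KQn.coeff (corePath p) (g (KQn.of (corePath q))) • f (KQn.of (corePath p)) :=
    map_smul (f.restrictScalars k) _ _
  rw [this, map_smul]

theorem compressN_one (n : ℕ) : compressN n (1 : Sn k V n) = 1 := by
  rw [← (coreFamily k V).sum_coval_mul_val (exists_arrow_core V) n, finsum_eq_sum_of_fintype,
    compressN_apply]
  refine Finset.sum_congr rfl fun q _ => ?_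
  rw [Module.End.one_apply, coreVal_corePath]

/-- Left multiplication by `q` isolates the term of `q`, and right multiplication by `p^*` turns it
into a coefficient times a vertex idempotent. That idempotent is not zero, so each coefficient is.
-/
theorem compressN_eq_zero {n : ℕ} {f : Sn k V n} (h : compressN n f = 0)
    (q : PthN (CoreVertex V) n) : coreIdem k V n (f (KQn.of (corePath q))) = 0 := by
  have h1 : coreVal n (f (KQn.of (corePath q))) = 0 := by
    have h2 : (coreFamily k V).val q.1 * compressN n f = coreVal n (f (KQn.of (corePath q))) := by
      rw [compressN_apply, Finset.mul_sum, Finset.sum_eq_single_of_mem q (Finset.mem_univ _)]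
      · rw [← mul_assoc, LeavittFamily.val_mul_coval_self, e_mul_coreVal_apply]
      · intro p _ hp
        rw [← mul_assoc, LeavittFamily.val_mul_coval_ne _ (q.2.trans p.2.symm)
          fun h' => hp (Subtype.ext h'.symm), zero_mul]
    rw [← h2, h, mul_zero]
  rw [coreIdem_apply]
  refine Finset.sum_eq_zero fun p _ => ?_
  have h3 := coreVal_mul_coval (f (KQn.of (corePath q))) p
  rw [h1, zero_mul] at h3
  rw [(smul_eq_zero.1 h3.symm).resolve_right
    (leavittFamily_e_ne_zero k (exists_arrow_core V) p.1.tgt), zero_smul]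

theorem toSAlg_corner_eq_zero {n : ℕ} {f : Sn k V n} (h : compressN n f = 0) :
    toSAlg k V n (coreIdem k V n * f * coreIdem k V n) = 0 := by
  obtain ⟨N, hN⟩ := exists_alive_inter_coalive_subset V
  refine toSAlg_eq_zero N fun p hp => ?_
  rw [Module.End.mul_apply, Module.End.mul_apply]
  by_cases hs : p.1.src ∈ coreSet V
  -- In the limit only paths `p` whose end continues for `N` steps matter; if such a path starts in
  -- the core, it lies in the core.
  · obtain ⟨q, rfl⟩ := exists_corePath p hs (hN ⟨hp, tgt_mem_coalive_of_core p hs N⟩)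
    rw [coreIdem_of hs, compressN_eq_zero h]
  · rw [coreIdem_of_ne hs, map_zero, map_zero]

theorem compressN_matUnit {n : ℕ} (p q : PthN (CoreVertex V) n)
    (h : (corePath p).1.tgt = (corePath q).1.tgt) :
    compressN n (matUnit k (corePath p) (corePath q) h) =
      (coreFamily k V).coval q.1 * (coreFamily k V).val p.1 := by
  rw [compressN_apply, Finset.sum_eq_single_of_mem q (Finset.mem_univ _), matUnit_same,
    coreVal_corePath]
  intro r _ hr
  rw [matUnit_ne _ _ _ fun h => hr (corePath_injective n h), map_zero, mul_zero]

/-- At level `N` the identity is the sum of the diagonal matrix units of paths `p` of length `N`. If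
the end of `p` does not continue for `N` steps, the summand is zero in the limit. Otherwise `p` ends
in the core and its matrix unit factors through a path of the core. -/
theorem toSAlg_one_mem : (1 : SAlg k V) ∈
    AddSubgroup.closure {z | ∃ x y, z = x * toSAlg k V 0 (coreIdem k V 0) * y} := by
  obtain ⟨N, hN⟩ := exists_alive_inter_coalive_subset V
  have h1 : (1 : Sn k V N) = ∑ p : PthN V N, matUnit k p p rfl := Sn.ext fun q => by
    rw [LinearMap.sum_apply, Finset.sum_eq_single_of_mem q (Finset.mem_univ _), matUnit_same]
    · rfl
    · exact fun p _ hp => matUnit_ne _ _ _ hp.symm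
  rw [← map_one (toSAlg k V N), h1, map_sum]
  refine sum_mem fun p _ => ?_
  by_cases hp : p.1.tgt ∈ alive V N
  · have hcore := hN ⟨hp, tgt_mem_coalive p⟩
    -- The core has no sources, so some path `q` of the core has length `N` and the same end as `p`.
    -- The diagonal matrix unit of `p` is then `(q → p) e (p → q)`.
    obtain ⟨q, hq⟩ := exists_path_to (exists_coarrow_core V) N ⟨p.1.tgt, hcore⟩
    have hq' : (corePath q).1.tgt = p.1.tgt := congrArg (fun i : CoreVertex V => i.1) hq
    refine AddSubgroup.subset_closure ⟨toSAlg k V N (matUnit k p (corePath q) hq'.symm),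
      toSAlg k V N (matUnit k (corePath q) p hq'), ?_⟩
    rw [← toSAlg_coreIdem N, ← map_mul, ← map_mul]
    refine congrArg _ (Sn.ext fun r => ?_)
    rw [Module.End.mul_apply, Module.End.mul_apply]
    by_cases hr : r = p
    · rw [hr, matUnit_same, matUnit_same,
        coreIdem_of (show (corePath q).1.src ∈ coreSet V from q.1.src.2), matUnit_same]
    · rw [matUnit_ne _ _ _ hr, matUnit_ne _ _ _ hr, map_zero, map_zero]
  · rw [toSAlg_eq_zero N fun q hq => matUnit_ne p p rfl fun h => hp (h ▸ hq)]
    exact zero_mem _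

variable (k V) in
/-- The map from the ultramatricial algebra to the Leavitt path algebra. -/
noncomputable def compressL : SAlg k V →+ LeavittAlg k (CoreVertex V) :=
  SAlg.lift (fun n => (compressN n).toAddMonoidHom) compressN_theta

theorem compressL_mem (x : SAlg k V) : compressL k V x ∈ leavittGrade k (CoreVertex V) 0 := by
  obtain ⟨n, f, rfl⟩ := exists_toSAlg x
  exact compressN_mem f

variable (k V) in
/-- The map from the ultramatricial algebra to the degree zero component of the Leavitt path
algebra. -/
noncomputable def compressS : SAlg k V →+ leavittGrade k (CoreVertex V) 0 where
  toFun x := ⟨compressL k V x, compressL_mem x⟩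
  map_zero' := Subtype.ext (map_zero (compressL k V))
  map_add' x y := Subtype.ext (map_add (compressL k V) x y)

theorem compressS_mul (x y : SAlg k V) :
    compressS k V (x * toSAlg k V 0 (coreIdem k V 0) * y) = compressS k V y * compressS k V x := by
  obtain ⟨n, f, g, rfl, rfl⟩ := exists_toSAlg₂ x y
  rw [← toSAlg_coreIdem n, ← map_mul, ← map_mul]
  exact Subtype.ext (compressN_mul f g)

/-- The spanning elements `q^*p` of `L₀` are the images of matrix units. -/
theorem compressS_surjective : Function.Surjective (compressS k V) := by
  rintro ⟨x, hx⟩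
  suffices h : ∃ s, (compressS k V s).1 = x by
    obtain ⟨s, hs⟩ := h
    exact ⟨s, Subtype.ext hs⟩
  have h := mem_span_coval_mul_val_zero k hx
  clear hx
  induction h using Submodule.span_induction with
  | mem x hx =>
    obtain ⟨n, p, q, h, rfl⟩ := hx
    have h' : (corePath p).1.tgt = (corePath q).1.tgt := congrArg (fun i : CoreVertex V => i.1) h
    exact ⟨toSAlg k V n (matUnit k (corePath p) (corePath q) h'), compressN_matUnit p q h'⟩
  | zero => exact ⟨0, by rw [map_zero]; rfl⟩
  | add x y _ _ h h' =>
    obtain ⟨s, rfl⟩ := h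
    obtain ⟨t, rfl⟩ := h'
    exact ⟨s + t, by rw [map_add]; rfl⟩
  | smul c x _ h =>
    obtain ⟨s, rfl⟩ := h
    obtain ⟨n, f, rfl⟩ := exists_toSAlg s
    exact ⟨toSAlg k V n (c • f), map_smul (compressN n) c f⟩

variable (k V) in
/-- The degree zero component of the Leavitt path algebra of the core as a full corner of the
opposite of the ultramatricial algebra. -/
noncomputable def leavittCorner :
    CornerMap (SAlg k V)ᵐᵒᵖ (leavittGrade k (CoreVertex V) 0) where
  e := MulOpposite.op (toSAlg k V 0 (coreIdem k V 0))
  e_mul_self := by rw [← MulOpposite.op_mul, ← map_mul, coreIdem_mul_self]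
  compress := (compressS k V).comp MulOpposite.opAddEquiv.symm.toAddMonoidHom
  compress_mul r s := by
    obtain ⟨x, rfl⟩ := MulOpposite.op_surjective r
    obtain ⟨y, rfl⟩ := MulOpposite.op_surjective s
    rw [← MulOpposite.op_mul, ← MulOpposite.op_mul, ← mul_assoc]
    exact compressS_mul y x
  compress_one := Subtype.ext (by
    have h : (compressS k V 1).1 = (compressS k V (toSAlg k V 0 1)).1 := by rw [map_one (toSAlg k V 0)]
    exact h.trans (compressN_one 0))
  mul_eq_zero r h := by
    obtain ⟨x, rfl⟩ := MulOpposite.op_surjective r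
    rw [← MulOpposite.op_mul, ← MulOpposite.op_mul, ← mul_assoc]
    obtain ⟨n, f, rfl⟩ := exists_toSAlg x
    have h' : compressN n f = 0 := congrArg Subtype.val h
    rw [← toSAlg_coreIdem n, ← map_mul, ← map_mul, toSAlg_corner_eq_zero h', MulOpposite.op_zero]
  surjective x := by
    obtain ⟨s, hs⟩ := compressS_surjective x
    exact ⟨MulOpposite.op s, hs⟩
  one_mem := by
    have key : ∀ z ∈ AddSubgroup.closure {z | ∃ x y, z = x * toSAlg k V 0 (coreIdem k V 0) * y},
        MulOpposite.op z ∈ AddSubgroup.closure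
          {z | ∃ x y, z = x * MulOpposite.op (toSAlg k V 0 (coreIdem k V 0)) * y} := fun z hz => by
      induction hz using AddSubgroup.closure_induction with
      | mem z hz =>
        obtain ⟨x, y, rfl⟩ := hz
        refine AddSubgroup.subset_closure ⟨MulOpposite.op y, MulOpposite.op x, ?_⟩
        rw [← MulOpposite.op_mul, ← MulOpposite.op_mul, mul_assoc]
      | zero => exact zero_mem _
      | add x y _ _ hx hy => exact add_mem hx hy
      | neg x _ hx => exact neg_mem hx
    exact key 1 toSAlg_one_mem

end Compression

end QuiverLeavitt

theorem mainTheorem7 (k : Type u) [Field k] (V : Type u) [Quiver.{u} V] [Finite V]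
    [∀ i j : V, Finite (i ⟶ j)] :
    Nonempty (QuiverLeavitt.QGr (QuiverLeavitt.pathGrade k V) ≌
      ModuleCat.{u} (QuiverLeavitt.SAlg k V)ᵐᵒᵖ) ∧
    Nonempty (ModuleCat.{u} (QuiverLeavitt.SAlg k V)ᵐᵒᵖ ≌
      QuiverLeavitt.GrMod (QuiverLeavitt.leavittGrade k (QuiverLeavitt.CoreVertex V))) ∧
    (∀ n : ℤ, QuiverLeavitt.leavittGrade k (QuiverLeavitt.CoreVertex V) n *
        QuiverLeavitt.leavittGrade k (QuiverLeavitt.CoreVertex V) (-n) =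
      QuiverLeavitt.leavittGrade k (QuiverLeavitt.CoreVertex V) 0) ∧
    (QuiverLeavitt.degreeZero
      (QuiverLeavitt.leavittGrade k (QuiverLeavitt.CoreVertex V))).IsEquivalence := by
  have h := QuiverLeavitt.one_mem_leavittGrade_mul k
    (QuiverLeavitt.exists_arrow_core V) (QuiverLeavitt.exists_coarrow_core V)
  have := QuiverLeavitt.isEquivalence_degreeZero h
  let D := (QuiverLeavitt.degreeZero
    (QuiverLeavitt.leavittGrade k (QuiverLeavitt.CoreVertex V))).asEquivalence
  let E := (QuiverLeavitt.leavittCorner k V).equivalence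
  exact ⟨⟨(QuiverLeavitt.qgrEquivalence k V).trans (D.trans E.symm)⟩, ⟨E.trans D.symm⟩,
    fun n => QuiverLeavitt.mul_eq_of_one_mem (h n), this⟩
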